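/- **Setting.** Let $k$ be a field and let $(H,R,\Phi,\alpha,\beta)$ be a quasitriangular quasi-Hopf algebra over $k$ with comultiplication $\Delta$, counit $\varepsilon$ and bijective antipode $S$. Explicitly: $H$ is an associative unital $k$-algebra, $\Delta:H\to H\otimes H$ and $\varepsilon:H\to k$ are algebra maps with $(\varepsilon\otimes 1)\Delta=\mathrm{id}=(1\otimes\varepsilon)\Delta$; $\Phi\in H^{\otimes 3}$ is invertible with $(1\otimes\Delta)\Delta(h)\,\Phi=\Phi\,(\Delta\otimes 1)\Delta(h)$, $(1\otimes\Phi)(1\otimes\Delta\otimes 1)(\Phi)(\Phi\otimes 1)=(1\otimes1\otimes\Delta)(\Phi)(\Delta\otimes1\otimes1)(\Phi)$ and $(1\otimes\varepsilon\otimes1)(\Phi)=1$; $S$ is a bijective anti-automorphism with $S(h_{(1)})\alpha h_{(2)}=\varepsilon(h)\alpha$, $h_{(1)}\beta S(h_{(2)})=\varepsilon(h)\beta$, $X_1\beta S(X_2)\alpha X_3=1$, $S(x_1)\alpha x_2\beta S(x_3)=1$; $R=R_1\otimes R_2\in H^{\otimes2}$ is invertible with $\Delta^{op}(h)R=R\Delta(h)$,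 $(\Delta\otimes1)(R)=(X_2\otimes X_3\otimes X_1)R_{13}(x_1\otimes x_3\otimes x_2)R_{23}\Phi$ and $(1\otimes\Delta)(R)=(x_3\otimes x_1\otimes x_2)R_{13}(X_2\otimes X_1\otimes X_3)R_{12}\Phi^{-1}$. Here and below $\Phi=X_1\otimes X_2\otimes X_3$, $\Phi^{-1}=x_1\otimes x_2\otimes x_3=y_1\otimes y_2\otimes y_3$ (summation understood). The category $H\text{-Mod}$ of left $H$-modules is a braided monoidal abelian category: the tensor product is $\otimes_k$ with the diagonal action through $\Delta$, the unit is $k$ with action through $\varepsilon$, the associator $(U\otimes V)\otimes W\to U\otimes(V\otimes W)$ is the action of $\Phi$, and the braiding is $v\otimes w\mapsto R_2w\otimes R_1v$. Let $\underline H=H$ with the action $a\rhd h=a_{(1)}hS(a_{(2)})$, multiplication $$a\,\underline{\cdot}\,b=X_1\,a\,S(x_1X_2)\,\alpha\,x_2\,X_{3(1)}\,b\,S(x_3X_{3(2)}),$$ unit $\beta$, comultiplication $$\underline\Delta(h)=x_1X_1h_{(1)}g_1S(x_2R_2y_3X_{3(2)})\otimes x_3R_1\rhd\bigl(y_1X_2h_{(2)}g_2S(y_2X_{3(1)})\bigr),$$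 counit $\underline\varepsilon=\varepsilon(\alpha)\,\varepsilon$, and antipode $$\underline S(h)=X_1R_2p_2\,S\bigl(q_1(X_2R_1p_1\rhd h)S(q_2)X_3\bigr),$$ where $p_1\otimes p_2=x_1\otimes x_2\beta S(x_3)$, $q_1\otimes q_2=X_1\otimes S^{-1}(\alpha X_3)X_2$, $g_1\otimes g_2=\Delta(S(x_1)\alpha x_2)\,\xi\,(S\otimes S)(\Delta^{op}(x_3))$, $\xi=B_1\beta S(B_4)\otimes B_2\beta S(B_3)$ and $B_1\otimes B_2\otimes B_3\otimes B_4=(\Delta\otimes1\otimes1)(\Phi)(\Phi^{-1}\otimes1)$. A *braided modular pair in involution* for a Hopf algebra $(\mathcal H,m,\eta,\Delta,\varepsilon,S)$ in a braided monoidal category is a pair consisting of an algebra morphism $\delta:\mathcal H\to I$ and a coalgebra morphism $\sigma:I\to\mathcal H$ such that $\delta\sigma=\mathrm{id}_I$ and $m(m\otimes1)(S\sigma\otimes\widetilde S^2\otimes\sigma)=\mathrm{id}_{\mathcal H}$, where $\widetilde S=(\delta\otimes S)\Delta$ (unit and associativity constraints suppressed). To $(\mathcal H,\delta,\sigma)$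 one associates the objects $C^n=\mathcal H^{\otimes n}$ ($C^0=I$) with $$\delta_i=\begin{cases}(\eta,1,\dots,1)& i=0\\ (1,\dots,1,\Delta,1,\dots,1)\ (\Delta\text{ at place } i)&1\le i\le n\\ (1,\dots,1,\sigma)&i=n+1\end{cases}\;:C^n\to C^{n+1},$$ $\sigma_i=(1,\dots,1,\varepsilon,1,\dots,1):C^{n+1}\to C^n$ ($\varepsilon$ at place $i+1$, $0\le i\le n$), and $\tau_0=\mathrm{id}$, $\tau_n=m_n(\Delta^{n-1}\widetilde S,1_{\mathcal H^{\otimes (n-1)}},\sigma):C^n\to C^n$ for $n\ge1$, where $m_n$ is the multiplication of the tensor product algebra $\mathcal H^{\otimes n}$ defined by the braiding. A *para-cocyclic object* satisfies all relations of a cocyclic object except possibly $\tau_n^{n+1}=\mathrm{id}$. **Statement.** (i) With these structure maps $\underline H$ is a Hopf algebra in the braided monoidal category $H\text{-Mod}$. (ii) For every braided modular pair in involution $(\delta,\sigma)$ for $\underline H$, the objects $\underline H^{\otimes n}$ with the operators $\delta_i,\sigma_i,\tau_n$ above form a para-cocyclic object in $H\text{-Mod}$; the operators restrict to the submodules $\ker(1-\tau_n^{n+1})\subseteq\underline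 H^{\otimes n}$ and make these a cocyclic object in $H\text{-Mod}$. (iii) Consequently $(H,R,\Phi,\alpha,\beta)$ with $(\delta,\sigma)$ has a Hopf cyclic cohomology $HC^*_{(\delta,\sigma)}(H,R,\Phi,\alpha,\beta)$, namely the cyclic cohomology of this cocyclic object, i.e. the cohomology of the total complex of its cyclic $(b,b',1-\lambda,N)$-bicomplex, where $\lambda_n=(-1)^n\tau_n$ and $N=\sum_{j=0}^n\lambda_n^j$. -/

import Mathlib

open CategoryTheory CategoryTheory.Limits

universe v u

/-- The data of a (para-)cocyclic object, without the relations. -/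
structure CocyclicData (C : Type u) [Category.{v} C] where
  X : ℕ → C
  coface (n : ℕ) (i : Fin (n + 2)) : X n ⟶ X (n + 1)
  codegen (n : ℕ) (i : Fin (n + 1)) : X (n + 1) ⟶ X n
  cyc (n : ℕ) : X n ⟶ X n

namespace CocyclicData

section Relations

variable {C : Type u} [Category.{v} C]

/-- `D.cycPow n m` is the `m`-th power of the cyclic operator in degree `n`. -/
def cycPow (D : CocyclicData C) (n : ℕ) : ℕ → (D.X n ⟶ D.X n)
  | 0 => 𝟙 _
  | m + 1 => D.cycPow n m ≫ D.cyc n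

/-- The relations of a para-cocyclic object: all the relations of a cocyclic object except
that the `(n + 1)`-st power of the cyclic operator in degree `n` is the identity. -/
structure IsParaCocyclic (D : CocyclicData C) : Prop where
  coface_coface (n : ℕ) (i j : Fin (n + 2)) (h : i ≤ j) :
    D.coface n i ≫ D.coface (n + 1) j.succ = D.coface n j ≫ D.coface (n + 1) i.castSucc
  codegen_codegen (n : ℕ) (i j : Fin (n + 1)) (h : i ≤ j) :
    D.codegen (n + 1) i.castSucc ≫ D.codegen n j = D.codegen (n + 1) j.succ ≫ D.codegen n i
  coface_codegen_of_le (n : ℕ) (i : Fin (n + 2)) (j : Fin (n + 1)) (h : i ≤ j.castSucc) :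
    D.coface (n + 1) i.castSucc ≫ D.codegen (n + 1) j.succ = D.codegen n j ≫ D.coface n i
  coface_codegen_self (n : ℕ) (i : Fin (n + 1)) :
    D.coface n i.castSucc ≫ D.codegen n i = 𝟙 _
  coface_codegen_succ (n : ℕ) (i : Fin (n + 1)) :
    D.coface n i.succ ≫ D.codegen n i = 𝟙 _
  coface_codegen_of_gt (n : ℕ) (i : Fin (n + 2)) (j : Fin (n + 1)) (h : j.castSucc < i) :
    D.coface (n + 1) i.succ ≫ D.codegen (n + 1) j.castSucc = D.codegen n j ≫ D.coface n i
  coface_succ_cyc (n : ℕ) (i : Fin (n + 1)) :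
    D.coface n i.succ ≫ D.cyc (n + 1) = D.cyc n ≫ D.coface n i.castSucc
  coface_zero_cyc (n : ℕ) : D.coface n 0 ≫ D.cyc (n + 1) = D.coface n (Fin.last (n + 1))
  codegen_succ_cyc (n : ℕ) (i : Fin n) :
    D.codegen n i.succ ≫ D.cyc n = D.cyc (n + 1) ≫ D.codegen n i.castSucc
  codegen_zero_cyc (n : ℕ) :
    D.codegen n 0 ≫ D.cyc n = D.cyc (n + 1) ≫ D.cyc (n + 1) ≫ D.codegen n (Fin.last n)

/-- The relations of a cocyclic object. -/
structure IsCocyclic (D : CocyclicData C) : Prop extends D.IsParaCocyclic where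
  cycPow_eq_id (n : ℕ) : D.cycPow n (n + 1) = 𝟙 _

lemma cycPow_add (D : CocyclicData C) (n a b : ℕ) :
    D.cycPow n (a + b) = D.cycPow n a ≫ D.cycPow n b := by
  induction b with
  | zero => simp [cycPow]
  | succ b ih => rw [← Nat.add_assoc]; simp [cycPow, ih]

lemma cycPow_one (D : CocyclicData C) (n : ℕ) : D.cycPow n 1 = D.cyc n := by
  simp [cycPow]

variable {D : CocyclicData C}

lemma IsParaCocyclic.coface_cycPow_aux (h : D.IsParaCocyclic) (n j i : ℕ) (hi : i + j < n + 2) :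
    D.coface n ⟨i + j, hi⟩ ≫ D.cycPow (n + 1) j =
      D.cycPow n j ≫ D.coface n ⟨i, by omega⟩ := by
  induction j generalizing i with
  | zero => simp [cycPow]
  | succ j ih =>
    have h1 := ih (i + 1) (by omega)
    have e : (⟨i + (j + 1), hi⟩ : Fin (n + 2)) = ⟨i + 1 + j, by omega⟩ :=
      Fin.ext (by simp only; omega)
    rw [e, cycPow, ← Category.assoc, h1, Category.assoc]
    have h2 := h.coface_succ_cyc n ⟨i, by omega⟩
    simp only [Fin.succ_mk, Fin.castSucc_mk] at h2
    rw [h2, cycPow, Category.assoc]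

lemma IsParaCocyclic.codegen_cycPow_aux (h : D.IsParaCocyclic) (n j i : ℕ) (hi : i + j < n + 1) :
    D.codegen n ⟨i + j, hi⟩ ≫ D.cycPow n j =
      D.cycPow (n + 1) j ≫ D.codegen n ⟨i, by omega⟩ := by
  induction j generalizing i with
  | zero => simp [cycPow]
  | succ j ih =>
    have h1 := ih (i + 1) (by omega)
    have e : (⟨i + (j + 1), hi⟩ : Fin (n + 1)) = ⟨i + 1 + j, by omega⟩ :=
      Fin.ext (by simp only; omega)
    rw [e, cycPow, ← Category.assoc, h1, Category.assoc]
    have h2 := h.codegen_succ_cyc n ⟨i, by omega⟩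
    simp only [Fin.succ_mk, Fin.castSucc_mk] at h2
    rw [h2, cycPow, Category.assoc]

/-- The cofaces commute with the operators `τ_n ^ (n + 1)`. -/
lemma IsParaCocyclic.coface_cycPow (h : D.IsParaCocyclic) (n : ℕ) (i : Fin (n + 2)) :
    D.coface n i ≫ D.cycPow (n + 1) (n + 2) = D.cycPow n (n + 1) ≫ D.coface n i := by
  obtain ⟨i, hi⟩ := i
  have h1 := h.coface_cycPow_aux n i 0 (by omega)
  simp only [Nat.zero_add] at h1
  have h0 := h.coface_zero_cyc n
  have h2 := h.coface_cycPow_aux n (n + 1 - i) i (by omega)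
  have e2 : (⟨i + (n + 1 - i), by omega⟩ : Fin (n + 2)) = Fin.last (n + 1) :=
    Fin.ext (by simp only [Fin.val_last]; omega)
  rw [e2] at h2
  have e3 : D.cycPow n (n + 1) = D.cycPow n i ≫ D.cycPow n (n + 1 - i) := by
    rw [← cycPow_add]
    congr 1
    omega
  have e4 : D.cycPow (n + 1) (n + 2) =
      D.cycPow (n + 1) i ≫ D.cyc (n + 1) ≫ D.cycPow (n + 1) (n + 1 - i) := by
    rw [← D.cycPow_one (n + 1), ← cycPow_add, ← cycPow_add]
    congr 1
    omega
  rw [e4, ← Category.assoc, h1, Category.assoc]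
  change D.cycPow n i ≫ D.coface n 0 ≫ _ = _
  rw [reassoc_of% h0, h2, e3, Category.assoc]

/-- The codegeneracies commute with the operators `τ_n ^ (n + 1)`. -/
lemma IsParaCocyclic.codegen_cycPow (h : D.IsParaCocyclic) (n : ℕ) (i : Fin (n + 1)) :
    D.codegen n i ≫ D.cycPow n (n + 1) = D.cycPow (n + 1) (n + 2) ≫ D.codegen n i := by
  obtain ⟨i, hi⟩ := i
  have h1 := h.codegen_cycPow_aux n i 0 (by omega)
  simp only [Nat.zero_add] at h1
  have h0 := h.codegen_zero_cyc n
  have h2 := h.codegen_cycPow_aux n (n - i) i (by omega)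
  have e2 : (⟨i + (n - i), by omega⟩ : Fin (n + 1)) = Fin.last n :=
    Fin.ext (by simp only [Fin.val_last]; omega)
  rw [e2] at h2
  have e3 : D.cycPow n (n + 1) = D.cycPow n i ≫ D.cyc n ≫ D.cycPow n (n - i) := by
    rw [← D.cycPow_one n, ← cycPow_add, ← cycPow_add]
    congr 1
    omega
  have e4 : D.cycPow (n + 1) (n + 2) =
      D.cycPow (n + 1) i ≫ D.cyc (n + 1) ≫ D.cyc (n + 1) ≫ D.cycPow (n + 1) (n - i) := by
    rw [← D.cycPow_one (n + 1), ← cycPow_add, ← cycPow_add, ← cycPow_add]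
    congr 1
    omega
  rw [e3, ← Category.assoc, h1, Category.assoc]
  change D.cycPow (n + 1) i ≫ D.codegen n 0 ≫ _ = _
  rw [reassoc_of% h0, h2, e4]
  simp only [Category.assoc]

end Relations

section Kernel

variable {C : Type u} [Category.{v} C] [Preadditive C] [HasKernels C]

/-- The restriction of the faces, degeneracies and cyclic operators of a para-cocyclic object
to the subobjects `ker (1 - τ_n ^ (n + 1))`. -/
noncomputable def kerRestrict (D : CocyclicData C) (h : D.IsParaCocyclic) : CocyclicData C where
  X n := kernel (𝟙 (D.X n) - D.cycPow n (n + 1))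
  coface n i := kernel.map _ _ (D.coface n i) (D.coface n i) (by
    simp [h.coface_cycPow])
  codegen n i := kernel.map _ _ (D.codegen n i) (D.codegen n i) (by
    simp [h.codegen_cycPow])
  cyc n := kernel.map _ _ (D.cyc n) (D.cyc n) (by
    have : D.cycPow n (n + 1) ≫ D.cyc n = D.cyc n ≫ D.cycPow n (n + 1) := by
      rw [← cycPow_one, ← cycPow_add, ← cycPow_add, Nat.add_comm]
    simp [this])

end Kernel

section CyclicCohomology

variable {C : Type u} [Category.{v} C] [Preadditive C]

/-- The Hochschild coboundary `b = ∑_{i = 0}^{n + 1} (-1)^i δ_i`. -/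
def b (D : CocyclicData C) (n : ℕ) : D.X n ⟶ D.X (n + 1) :=
  ∑ i : Fin (n + 2), (-1 : ℤ) ^ (i : ℕ) • D.coface n i

/-- The acyclic coboundary `b' = ∑_{i = 0}^{n} (-1)^i δ_i`. -/
def b' (D : CocyclicData C) (n : ℕ) : D.X n ⟶ D.X (n + 1) :=
  ∑ i : Fin (n + 1), (-1 : ℤ) ^ (i : ℕ) • D.coface n i.castSucc

/-- `1 - λ_n` where `λ_n = (-1)^n τ_n`. -/
def oneSubLam (D : CocyclicData C) (n : ℕ) : D.X n ⟶ D.X n :=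
  𝟙 _ - (-1 : ℤ) ^ n • D.cyc n

/-- The norm operator `N_n = ∑_{j = 0}^{n} λ_n ^ j`, where `λ_n = (-1)^n τ_n`. -/
def norm (D : CocyclicData C) (n : ℕ) : D.X n ⟶ D.X n :=
  ∑ j ∈ Finset.range (n + 1), ((-1 : ℤ) ^ n) ^ j • D.cycPow n j

/-- The signed coface `(-1)^i δ_i`, indexed by natural numbers. -/
def signedCoface (D : CocyclicData C) (n i : ℕ) : D.X n ⟶ D.X (n + 1) :=
  if h : i < n + 2 then (-1 : ℤ) ^ i • D.coface n ⟨i, h⟩ else 0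

/-- The powers of `λ_n = (-1)^n τ_n`. -/
def lamPow (D : CocyclicData C) (n j : ℕ) : D.X n ⟶ D.X n :=
  ((-1 : ℤ) ^ n) ^ j • D.cycPow n j

lemma b_eq (D : CocyclicData C) (n : ℕ) :
    D.b n = ∑ i ∈ Finset.range (n + 2), D.signedCoface n i := by
  rw [b, ← Fin.sum_univ_eq_sum_range]
  simp [signedCoface]

lemma b'_eq (D : CocyclicData C) (n : ℕ) :
    D.b' n = ∑ i ∈ Finset.range (n + 1), D.signedCoface n i := by
  rw [b', ← Fin.sum_univ_eq_sum_range]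
  refine Finset.sum_congr rfl fun i _ => ?_
  rw [signedCoface, dif_pos (by omega)]
  rfl

lemma norm_eq (D : CocyclicData C) (n : ℕ) :
    D.norm n = ∑ j ∈ Finset.range (n + 1), D.lamPow n j := rfl

lemma lamPow_add (D : CocyclicData C) (n a b : ℕ) :
    D.lamPow n (a + b) = D.lamPow n a ≫ D.lamPow n b := by
  simp [lamPow, cycPow_add, pow_add, smul_smul, mul_comm]

lemma lamPow_zero (D : CocyclicData C) (n : ℕ) : D.lamPow n 0 = 𝟙 _ := by
  simp [lamPow, cycPow]

lemma oneSubLam_eq (D : CocyclicData C) (n : ℕ) : D.oneSubLam n = 𝟙 _ - D.lamPow n 1 := by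
  simp [oneSubLam, lamPow, cycPow_one]

variable {D : CocyclicData C}

lemma IsParaCocyclic.signed_signed (h : D.IsParaCocyclic) (n i j : ℕ) (hij : i ≤ j)
    (hj : j < n + 2) :
    D.signedCoface n i ≫ D.signedCoface (n + 1) (j + 1) =
      - (D.signedCoface n j ≫ D.signedCoface (n + 1) i) := by
  have := h.coface_coface n ⟨i, by omega⟩ ⟨j, hj⟩ hij
  simp only [Fin.succ_mk, Fin.castSucc_mk] at this
  rw [signedCoface, signedCoface, signedCoface, signedCoface, dif_pos (by omega),
    dif_pos (by omega), dif_pos hj, dif_pos (by omega)]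
  simp only [Preadditive.zsmul_comp, Preadditive.comp_zsmul, smul_smul, this, ← neg_smul]
  congr 1
  ring

lemma IsParaCocyclic.sum_signed_signed (h : D.IsParaCocyclic) (n m : ℕ) (hm : m ≤ n + 2) :
    (∑ i ∈ Finset.range m, D.signedCoface n i) ≫
      (∑ i ∈ Finset.range (m + 1), D.signedCoface (n + 1) i) = 0 := by
  rw [Preadditive.sum_comp]
  simp_rw [Preadditive.comp_sum]
  rw [← Finset.sum_product', ← Finset.sum_filter_add_sum_filter_not _ (fun p => p.1 < p.2),
    ← eq_neg_iff_add_eq_zero, ← Finset.sum_neg_distrib]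
  refine Finset.sum_nbij' (fun p => (p.2 - 1, p.1)) (fun p => (p.2, p.1 + 1)) ?_ ?_ ?_ ?_ ?_
  · rintro ⟨a, c⟩ hp
    simp only [Finset.mem_filter, Finset.mem_product, Finset.mem_range] at hp ⊢
    omega
  · rintro ⟨a, c⟩ hp
    simp only [Finset.mem_filter, Finset.mem_product, Finset.mem_range] at hp ⊢
    omega
  · rintro ⟨a, c⟩ hp
    simp only [Finset.mem_filter, Finset.mem_product, Finset.mem_range] at hp
    grind
  · rintro ⟨a, c⟩ hp
    rfl
  · rintro ⟨a, c⟩ hp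
    simp only [Finset.mem_filter, Finset.mem_product, Finset.mem_range] at hp
    obtain ⟨c, rfl⟩ : ∃ c', c = c' + 1 := ⟨c - 1, by omega⟩
    exact h.signed_signed n a c (by omega) (by omega)

lemma IsParaCocyclic.b_b (h : D.IsParaCocyclic) (n : ℕ) : D.b n ≫ D.b (n + 1) = 0 := by
  rw [b_eq, b_eq]
  exact h.sum_signed_signed n (n + 2) le_rfl

lemma IsParaCocyclic.b'_b' (h : D.IsParaCocyclic) (n : ℕ) : D.b' n ≫ D.b' (n + 1) = 0 := by
  rw [b'_eq, b'_eq]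
  exact h.sum_signed_signed n (n + 1) (by omega)

lemma IsParaCocyclic.signed_zero_lam (h : D.IsParaCocyclic) (n : ℕ) :
    D.signedCoface n 0 ≫ D.lamPow (n + 1) 1 = D.signedCoface n (n + 1) := by
  have := h.coface_zero_cyc n
  rw [signedCoface, signedCoface, dif_pos (by omega), dif_pos (by omega), lamPow, cycPow_one]
  simp only [Preadditive.zsmul_comp, Preadditive.comp_zsmul, smul_smul]
  change _ • D.coface n 0 ≫ _ = _ • D.coface n (Fin.last (n + 1))
  rw [this]
  congr 1
  ring

lemma IsParaCocyclic.signed_succ_lam (h : D.IsParaCocyclic) (n i : ℕ) (hi : i < n + 1) :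
    D.signedCoface n (i + 1) ≫ D.lamPow (n + 1) 1 = D.lamPow n 1 ≫ D.signedCoface n i := by
  have := h.coface_succ_cyc n ⟨i, hi⟩
  simp only [Fin.succ_mk, Fin.castSucc_mk] at this
  rw [signedCoface, signedCoface, dif_pos (by omega), dif_pos (by omega), lamPow, lamPow,
    cycPow_one, cycPow_one]
  simp only [Preadditive.zsmul_comp, Preadditive.comp_zsmul, smul_smul, this]
  congr 1
  ring

lemma IsParaCocyclic.signed_lamPow (h : D.IsParaCocyclic) (n j i : ℕ) (hi : i + j < n + 2) :
    D.signedCoface n (i + j) ≫ D.lamPow (n + 1) j = D.lamPow n j ≫ D.signedCoface n i := by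
  induction j generalizing i with
  | zero => simp [lamPow_zero]
  | succ j ih =>
    have h1 := ih (i + 1) (by omega)
    rw [show i + (j + 1) = i + 1 + j by omega, lamPow_add, ← Category.assoc, h1, Category.assoc,
      h.signed_succ_lam n i (by omega), lamPow_add, Category.assoc]

lemma IsParaCocyclic.b_oneSubLam (h : D.IsParaCocyclic) (n : ℕ) :
    D.b n ≫ D.oneSubLam (n + 1) = D.oneSubLam n ≫ D.b' n := by
  have e : D.b n ≫ D.lamPow (n + 1) 1 =
      D.lamPow n 1 ≫ D.b' n + D.signedCoface n (n + 1) := by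
    rw [b_eq, Finset.sum_range_succ', Preadditive.add_comp, Preadditive.sum_comp,
      h.signed_zero_lam, b'_eq, Preadditive.comp_sum]
    congr 1
    exact Finset.sum_congr rfl fun i hi => h.signed_succ_lam n i (Finset.mem_range.1 hi)
  rw [oneSubLam_eq, oneSubLam_eq, Preadditive.comp_sub, Preadditive.sub_comp, e,
    Category.comp_id, Category.id_comp, b_eq, Finset.sum_range_succ, ← b'_eq]
  abel

lemma IsParaCocyclic.b'_norm (h : D.IsParaCocyclic) (n : ℕ) :
    D.b' n ≫ D.norm (n + 1) = D.norm n ≫ D.b n := by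
  rw [b'_eq, norm_eq, norm_eq, b_eq]
  rw [Preadditive.sum_comp, Preadditive.sum_comp]
  simp_rw [Preadditive.comp_sum]
  rw [← Finset.sum_product', ← Finset.sum_product']
  refine Finset.sum_nbij'
    (fun p => if p.2 ≤ p.1 then (p.2, p.1 - p.2) else (p.2 - 1, n + 2 + p.1 - p.2))
    (fun p => if p.1 + p.2 ≤ n then (p.1 + p.2, p.1) else (p.1 + p.2 - (n + 1), p.1 + 1))
    ?_ ?_ ?_ ?_ ?_
  all_goals
    rintro ⟨a, c⟩ hp
    simp only [Finset.mem_product, Finset.mem_range] at hp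
  · simp only; split_ifs <;> simp only [Finset.mem_product, Finset.mem_range] <;> omega
  · simp only; split_ifs <;> simp only [Finset.mem_product, Finset.mem_range] <;> omega
  · by_cases hc : c ≤ a
    · simp only [if_pos hc]
      rw [if_pos (by omega)]
      grind
    · simp only [if_neg hc]
      rw [if_neg (by omega)]
      grind
  · by_cases hc : a + c ≤ n
    · simp only [if_pos hc]
      rw [if_pos (by omega)]
      grind
    · simp only [if_neg hc]
      rw [if_neg (by omega)]
      grind
  · by_cases hc : c ≤ a
    · have := h.signed_lamPow n c (a - c) (by omega)
      simp only [show a - c + c = a by omega] at this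
      simpa only [if_pos hc] using this
    · obtain ⟨d, rfl⟩ : ∃ d, c = a + (1 + d) := ⟨c - a - 1, by omega⟩
      have h1 := h.signed_lamPow n a 0 (by omega)
      have h2 := h.signed_lamPow n d (n + 1 - d) (by omega)
      rw [Nat.zero_add] at h1
      rw [show n + 1 - d + d = n + 1 by omega] at h2
      simp only [if_neg hc]
      rw [show n + 2 + a - (a + (1 + d)) = n + 1 - d by omega,
        show a + (1 + d) - 1 = a + d by omega, lamPow_add, lamPow_add, ← Category.assoc, h1,
        Category.assoc, ← Category.assoc (D.signedCoface n 0), h.signed_zero_lam, h2, lamPow_add,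
        Category.assoc]

lemma IsCocyclic.lamPow_eq_id (h : D.IsCocyclic) (n : ℕ) : D.lamPow n (n + 1) = 𝟙 _ := by
  rw [lamPow, h.cycPow_eq_id, ← pow_mul, (Nat.even_mul_succ_self n).neg_one_pow, one_smul]

lemma IsCocyclic.oneSubLam_norm (h : D.IsCocyclic) (n : ℕ) : D.oneSubLam n ≫ D.norm n = 0 := by
  rw [oneSubLam_eq, norm_eq, Preadditive.sub_comp, Category.id_comp, Preadditive.comp_sum]
  simp only [← lamPow_add]
  rw [Finset.sum_range_succ', lamPow_zero, Finset.sum_range_succ, Nat.add_comm 1 n,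
    h.lamPow_eq_id]
  simp only [Nat.add_comm 1]
  abel

lemma IsCocyclic.norm_oneSubLam (h : D.IsCocyclic) (n : ℕ) : D.norm n ≫ D.oneSubLam n = 0 := by
  rw [oneSubLam_eq, norm_eq, Preadditive.comp_sub, Category.comp_id, Preadditive.sum_comp]
  simp only [← lamPow_add]
  rw [Finset.sum_range_succ', lamPow_zero, Finset.sum_range_succ, h.lamPow_eq_id]
  abel

/-- The columns of the cyclic bicomplex: `(D, b)` in even degrees, `(D, b')` in odd degrees. -/
def cyclicColumn (D : CocyclicData C) (h : D.IsCocyclic) : ℕ → CochainComplex C ℕ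
  | 0 => CochainComplex.of D.X D.b h.b_b
  | 1 => CochainComplex.of D.X D.b' h.b'_b'
  | p + 2 => D.cyclicColumn h p

/-- The horizontal maps of the cyclic bicomplex: `1 - λ` from even to odd columns,
`N` from odd to even columns. -/
def cyclicHorizontal (D : CocyclicData C) (h : D.IsCocyclic) :
    (p : ℕ) → (D.cyclicColumn h p ⟶ D.cyclicColumn h (p + 1))
  | 0 => CochainComplex.ofHom (X := CochainComplex.of D.X D.b h.b_b)
      (Y := CochainComplex.of D.X D.b' h.b'_b') D.oneSubLam fun n => by
        simpa using (h.b_oneSubLam n).symm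
  | 1 => CochainComplex.ofHom (X := CochainComplex.of D.X D.b' h.b'_b')
      (Y := CochainComplex.of D.X D.b h.b_b) D.norm fun n => by
        simpa using (h.b'_norm n).symm
  | p + 2 => D.cyclicHorizontal h p

lemma cyclicHorizontal_comp (D : CocyclicData C) (h : D.IsCocyclic) :
    (p : ℕ) → D.cyclicHorizontal h p ≫ D.cyclicHorizontal h (p + 1) = 0
  | 0 => by ext n; exact h.oneSubLam_norm n
  | 1 => by ext n; exact h.norm_oneSubLam n
  | p + 2 => D.cyclicHorizontal_comp h p

/-- The (first quadrant) cyclic bicomplex of a cocyclic object. -/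
def cyclicBicomplex (D : CocyclicData C) (h : D.IsCocyclic) :
    HomologicalComplex₂ C (ComplexShape.up ℕ) (ComplexShape.up ℕ) :=
  CochainComplex.of (D.cyclicColumn h) (D.cyclicHorizontal h) (D.cyclicHorizontal_comp h)

end CyclicCohomology

end CocyclicData

/-- The sign conventions for the total complex of a first quadrant cohomological bicomplex:
on the column `p` the vertical differential receives the sign `(-1)^p`. -/
instance tensorSignsUpNat : (ComplexShape.up ℕ).TensorSigns where
  ε' := MonoidHom.mk' (fun i : ℕ => (-1 : ℤˣ) ^ i) (pow_add (-1 : ℤˣ))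
  rel_add p q r (hpq : p + 1 = q) := by change p + r + 1 = q + r; omega
  add_rel p q r (hpq : p + 1 = q) := by change r + p + 1 = r + q; omega
  ε'_succ := by
    rintro p _ rfl
    change (-1 : ℤˣ) ^ (p + 1) = - (-1 : ℤˣ) ^ p
    rw [pow_succ, mul_neg, mul_one]

lemma hasTotalUpNat {C : Type u} [Category.{v} C] [Preadditive C] [HasFiniteCoproducts C]
    (K : HomologicalComplex₂ C (ComplexShape.up ℕ) (ComplexShape.up ℕ)) :
    K.HasTotal (ComplexShape.up ℕ) := by
  intro n
  have : Finite ((ComplexShape.π (ComplexShape.up ℕ) (ComplexShape.up ℕ)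
      (ComplexShape.up ℕ)) ⁻¹' {n}) := by
    refine Set.Finite.subset (Finset.finite_toSet (Finset.HasAntidiagonal.antidiagonal n)) ?_
    rintro ⟨p, q⟩ hpq
    simpa using hpq
  infer_instance

/-- The cyclic cohomology of a cocyclic object in an abelian category: the cohomology of the
total complex of its cyclic bicomplex. -/
noncomputable def CocyclicData.cyclicCohomology {C : Type u} [Category.{v} C] [Abelian C]
    (D : CocyclicData C) (h : D.IsCocyclic) (n : ℕ) : C :=
  haveI := hasTotalUpNat (D.cyclicBicomplex h)
  ((D.cyclicBicomplex h).total (ComplexShape.up ℕ)).homology n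

/-! ### Braided modular pairs in involution and the Connes–Moscovici operators -/

namespace BraidedHopf

open MonoidalCategory

section Monoidal

variable {C : Type u} [Category.{v} C] [MonoidalCategory C]

/-- The tensor powers `H ⊗ (H ⊗ (⋯ ⊗ (H ⊗ 𝟙)))` of an object. -/
def tensorPow (H : C) : ℕ → C
  | 0 => 𝟙_ C
  | n + 1 => H ⊗ tensorPow H n

/-- Inserting `f : 𝟙 ⟶ H` in the first position. -/
def insertFirst {H : C} (f : 𝟙_ C ⟶ H) (n : ℕ) : tensorPow H n ⟶ tensorPow H (n + 1) :=
  (λ_ (tensorPow H n)).inv ≫ f ▷ tensorPow H n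

/-- Inserting `f : 𝟙 ⟶ H` in the last position. -/
def insertLast {H : C} (f : 𝟙_ C ⟶ H) : (n : ℕ) → (tensorPow H n ⟶ tensorPow H (n + 1))
  | 0 => insertFirst f 0
  | n + 1 => H ◁ insertLast f n

/-- Applying `f : H ⟶ H ⊗ H` to the `(i + 1)`-st tensor factor of the `n`-th tensor power. -/
def splitAt {H : C} (f : H ⟶ H ⊗ H) :
    (n : ℕ) → (i : Fin n) → (tensorPow H n ⟶ tensorPow H (n + 1))
  | n + 1, ⟨0, _⟩ => f ▷ tensorPow H n ≫ (α_ H H (tensorPow H n)).hom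
  | n + 1, ⟨i + 1, hi⟩ => H ◁ splitAt f n ⟨i, Nat.lt_of_succ_lt_succ hi⟩

/-- Applying `f : H ⟶ 𝟙` to the `(i + 1)`-st tensor factor of the `(n + 1)`-st tensor power. -/
def dropAt {H : C} (f : H ⟶ 𝟙_ C) :
    (n : ℕ) → (i : Fin (n + 1)) → (tensorPow H (n + 1) ⟶ tensorPow H n)
  | n, ⟨0, _⟩ => f ▷ tensorPow H n ≫ (λ_ (tensorPow H n)).hom
  | n + 1, ⟨i + 1, hi⟩ => H ◁ dropAt f n ⟨i, Nat.lt_of_succ_lt_succ hi⟩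

/-- The iterated comultiplication `Δ^n : H ⟶ H^(n + 1)`. -/
def iterComul (H : C) [ComonObj H] : (n : ℕ) → (H ⟶ tensorPow H (n + 1))
  | 0 => (ρ_ H).inv
  | n + 1 => ComonObj.comul ≫ H ◁ iterComul H n

/-- The condition that `δ : H ⟶ 𝟙` is a morphism of algebras. -/
structure IsCharacter {H : C} [MonObj H] (δ : H ⟶ 𝟙_ C) : Prop where
  mul : MonObj.mul ≫ δ = (δ ⊗ₘ δ) ≫ (λ_ (𝟙_ C)).hom
  one : MonObj.one ≫ δ = 𝟙 (𝟙_ C)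

/-- The condition that `σ : 𝟙 ⟶ H` is a morphism of coalgebras. -/
structure IsCocharacter {H : C} [ComonObj H] (σ : 𝟙_ C ⟶ H) : Prop where
  comul : σ ≫ ComonObj.comul = (λ_ (𝟙_ C)).inv ≫ (σ ⊗ₘ σ)
  counit : σ ≫ ComonObj.counit = 𝟙 (𝟙_ C)

end Monoidal

section Braided

variable {C : Type u} [Category.{v} C] [MonoidalCategory C] [BraidedCategory C]

/-- The multiplication of the `n`-th tensor power of the algebra `H` in a braided category:
the factors are interleaved by means of the braiding and then multiplied pairwise. -/
def mulPow (H : C) [MonObj H] : (n : ℕ) → (tensorPow H n ⊗ tensorPow H n ⟶ tensorPow H n)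
  | 0 => (λ_ (𝟙_ C)).hom
  | n + 1 => tensorμ H (tensorPow H n) H (tensorPow H n) ≫ (MonObj.mul ⊗ₘ mulPow H n)

/-- The twisted antipode `(δ ⊗ S) Δ`. -/
def twistedAntipode {H : C} [HopfObj H] (δ : H ⟶ 𝟙_ C) : H ⟶ H :=
  ComonObj.comul ≫ (δ ⊗ₘ HopfObj.antipode) ≫ (λ_ H).hom

/-- Braided modular pairs in involution `(δ, σ)`: `δ` is a character, `σ` is a co-character,
`δ σ = 1`, and `m (m ⊗ 1) (S σ ⊗ S_δ² ⊗ σ) = 1` where `S_δ` is the twisted antipode. -/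
structure IsModularPairInInvolution {H : C} [HopfObj H] (δ : H ⟶ 𝟙_ C) (σ : 𝟙_ C ⟶ H) :
    Prop where
  isCharacter : IsCharacter δ
  isCocharacter : IsCocharacter σ
  modular : σ ≫ δ = 𝟙 (𝟙_ C)
  involution :
    (λ_ H).inv ≫ ((σ ≫ HopfObj.antipode) ⊗ₘ (twistedAntipode δ ≫ twistedAntipode δ)) ≫
      MonObj.mul ≫ (ρ_ H).inv ≫ H ◁ σ ≫ MonObj.mul = 𝟙 H

/-- The faces `δ_i : H^n ⟶ H^(n + 1)`: insertion of the unit for `i = 0`, comultiplication of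
the `i`-th factor for `1 ≤ i ≤ n`, insertion of `σ` in the last place for `i = n + 1`. -/
def hopfCoface {H : C} [HopfObj H] (σ : 𝟙_ C ⟶ H) (n : ℕ) (i : Fin (n + 2)) :
    tensorPow H n ⟶ tensorPow H (n + 1) :=
  if i.1 = 0 then insertFirst MonObj.one n
  else if h : i.1 - 1 < n then splitAt ComonObj.comul n ⟨i.1 - 1, h⟩
  else insertLast σ n

/-- The cyclic operators: `τ_0 = 1` and `τ_n = m_n (Δ^(n - 1) S_δ ⊗ 1 ⊗ σ)` for `n ≥ 1`. -/
def hopfCyc {H : C} [HopfObj H] (δ : H ⟶ 𝟙_ C) (σ : 𝟙_ C ⟶ H) :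
    (n : ℕ) → (tensorPow H n ⟶ tensorPow H n)
  | 0 => 𝟙 _
  | n + 1 => ((twistedAntipode δ ≫ iterComul H n) ⊗ₘ insertLast σ n) ≫ mulPow H (n + 1)

/-- The Connes–Moscovici operators attached to a Hopf algebra `H` in a braided monoidal category,
a morphism `δ : H ⟶ 𝟙` and a morphism `σ : 𝟙 ⟶ H`. -/
def hopfCyclicData {H : C} [HopfObj H] (δ : H ⟶ 𝟙_ C) (σ : 𝟙_ C ⟶ H) : CocyclicData C where
  X n := tensorPow H n
  coface n i := hopfCoface σ n i
  codegen n i := dropAt ComonObj.counit n i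
  cyc n := hopfCyc δ σ n

end Braided

end BraidedHopf

/-! ### Quasitriangular quasi-Hopf algebras -/

section QuasiHopf

open scoped TensorProduct

/-- Quasi-Hopf algebras over a field `k`, on a given `k`-algebra `H`. -/
structure QuasiHopfAlgebra (k H : Type u) [Field k] [Ring H] [Algebra k H] where
  comul : H →ₐ[k] H ⊗[k] H
  counit : H →ₐ[k] k
  /-- The associator `Φ`, an invertible element of `H ⊗ H ⊗ H`. -/
  Φ : (H ⊗[k] (H ⊗[k] H))ˣ
  /-- The (bijective) antipode `S`. -/
  S : H ≃ₗ[k] H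
  α : H
  β : H
  counit_left (h : H) :
    Algebra.TensorProduct.map counit (AlgHom.id k H) (comul h) = 1 ⊗ₜ[k] h
  counit_right (h : H) :
    Algebra.TensorProduct.map (AlgHom.id k H) counit (comul h) = h ⊗ₜ[k] 1
  /-- `(1 ⊗ Δ)(Δ h) Φ = Φ (Δ ⊗ 1)(Δ h)` -/
  quasi_coassoc (h : H) :
    Algebra.TensorProduct.map (AlgHom.id k H) comul (comul h) * Φ =
      Φ * Algebra.TensorProduct.assoc k k k H H H
        (Algebra.TensorProduct.map comul (AlgHom.id k H) (comul h))
  /-- `(1 ⊗ Φ) (1 ⊗ Δ ⊗ 1)(Φ) (Φ ⊗ 1) = (1 ⊗ 1 ⊗ Δ)(Φ) (Δ ⊗ 1 ⊗ 1)(Φ)` in `H ⊗ H ⊗ H ⊗ H` -/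
  pentagon :
    ((1 : H) ⊗ₜ[k] (Φ : H ⊗[k] (H ⊗[k] H))) *
      Algebra.TensorProduct.map (AlgHom.id k H)
        ((Algebra.TensorProduct.assoc k k k H H H).toAlgHom.comp
          (Algebra.TensorProduct.map comul (AlgHom.id k H))) Φ *
      Algebra.TensorProduct.map (AlgHom.id k H)
        (Algebra.TensorProduct.assoc k k k H H H).toAlgHom
        (Algebra.TensorProduct.assoc k k k H (H ⊗[k] H) H
          ((Φ : H ⊗[k] (H ⊗[k] H)) ⊗ₜ[k] (1 : H))) =
    Algebra.TensorProduct.map (AlgHom.id k H)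
        (Algebra.TensorProduct.map (AlgHom.id k H) comul) Φ *
      Algebra.TensorProduct.assoc k k k H H (H ⊗[k] H)
        (Algebra.TensorProduct.map comul (AlgHom.id k (H ⊗[k] H)) Φ)
  /-- `(1 ⊗ ε ⊗ 1)(Φ) = 1` -/
  counit_Φ :
    Algebra.TensorProduct.map (AlgHom.id k H)
      (Algebra.TensorProduct.map counit (AlgHom.id k H)) (Φ : H ⊗[k] (H ⊗[k] H)) = 1
  S_one : S 1 = 1
  S_mul (a b : H) : S (a * b) = S b * S a
  /-- `S(h₁) α h₂ = ε(h) α` -/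
  S_left (h : H) :
    TensorProduct.lift ((LinearMap.mul k H).compl₁₂ S.toLinearMap (LinearMap.mulLeft k α))
      (comul h) = counit h • α
  /-- `h₁ β S(h₂) = ε(h) β` -/
  S_right (h : H) :
    TensorProduct.lift ((LinearMap.mul k H).compl₁₂ (LinearMap.mulRight k β) S.toLinearMap)
      (comul h) = counit h • β
  /-- `X₁ β S(X₂) α X₃ = 1`, where `Φ = X₁ ⊗ X₂ ⊗ X₃` -/
  S_Φ :
    TensorProduct.lift ((LinearMap.mul k H).compl₁₂ (LinearMap.mulRight k β)
      (TensorProduct.lift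
        ((LinearMap.mul k H).compl₁₂ S.toLinearMap (LinearMap.mulLeft k α))))
      (Φ : H ⊗[k] (H ⊗[k] H)) = 1
  /-- `S(x₁) α x₂ β S(x₃) = 1`, where `Φ⁻¹ = x₁ ⊗ x₂ ⊗ x₃` -/
  S_Φ_inv :
    TensorProduct.lift ((LinearMap.mul k H).compl₁₂ S.toLinearMap
      (LinearMap.mulLeft k α ∘ₗ TensorProduct.lift
        ((LinearMap.mul k H).compl₁₂ (LinearMap.mulRight k β) S.toLinearMap)))
      ((Φ⁻¹ : (H ⊗[k] (H ⊗[k] H))ˣ) : H ⊗[k] (H ⊗[k] H)) = 1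

section Legs

variable (k H : Type u) [Field k] [Ring H] [Algebra k H]

/-- `a ⊗ b ⊗ c ↦ b ⊗ a ⊗ c` -/
noncomputable def legSwap₁₂ : H ⊗[k] (H ⊗[k] H) ≃ₐ[k] H ⊗[k] (H ⊗[k] H) :=
  Algebra.TensorProduct.leftComm k H H H

/-- `a ⊗ b ⊗ c ↦ a ⊗ c ⊗ b` -/
noncomputable def legSwap₂₃ : H ⊗[k] (H ⊗[k] H) ≃ₐ[k] H ⊗[k] (H ⊗[k] H) :=
  Algebra.TensorProduct.congr AlgEquiv.refl (Algebra.TensorProduct.comm k H H)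

variable {k H}

/-- `a ⊗ b ↦ a ⊗ b ⊗ 1` -/
noncomputable def leg₁₂ (t : H ⊗[k] H) : H ⊗[k] (H ⊗[k] H) :=
  Algebra.TensorProduct.assoc k k k H H H (t ⊗ₜ[k] (1 : H))

/-- `a ⊗ b ↦ 1 ⊗ a ⊗ b` -/
def leg₂₃ (t : H ⊗[k] H) : H ⊗[k] (H ⊗[k] H) := (1 : H) ⊗ₜ[k] t

/-- `a ⊗ b ↦ a ⊗ 1 ⊗ b` -/
noncomputable def leg₁₃ (t : H ⊗[k] H) : H ⊗[k] (H ⊗[k] H) := legSwap₂₃ k H (leg₁₂ t)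

end Legs

/-- Quasitriangular quasi-Hopf algebras `(H, R, Φ, α, β)` over a field `k`. -/
structure QuasitriangularQuasiHopfAlgebra (k H : Type u) [Field k] [Ring H] [Algebra k H]
    extends QuasiHopfAlgebra k H where
  /-- The universal R-matrix, an invertible element of `H ⊗ H`. -/
  R : (H ⊗[k] H)ˣ
  /-- `Δ^op(h) R = R Δ(h)` -/
  comul_op (h : H) :
    Algebra.TensorProduct.comm k H H (comul h) * R = R * comul h
  /-- `(Δ ⊗ 1)(R) = (X₂ ⊗ X₃ ⊗ X₁) R₁₃ (x₁ ⊗ x₃ ⊗ x₂) R₂₃ Φ`,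
  where `Φ = X₁ ⊗ X₂ ⊗ X₃` and `Φ⁻¹ = x₁ ⊗ x₂ ⊗ x₃` -/
  comul_left_R :
    Algebra.TensorProduct.assoc k k k H H H
      (Algebra.TensorProduct.map comul (AlgHom.id k H) (R : H ⊗[k] H)) =
    legSwap₂₃ k H (legSwap₁₂ k H Φ) * leg₁₃ (R : H ⊗[k] H) *
      legSwap₂₃ k H ((Φ⁻¹ : (H ⊗[k] (H ⊗[k] H))ˣ) : H ⊗[k] (H ⊗[k] H)) *
      leg₂₃ (R : H ⊗[k] H) * Φ
  /-- `(1 ⊗ Δ)(R) = (x₃ ⊗ x₁ ⊗ x₂) R₁₃ (X₂ ⊗ X₁ ⊗ X₃) R₁₂ Φ⁻¹`,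
  where `Φ = X₁ ⊗ X₂ ⊗ X₃` and `Φ⁻¹ = x₁ ⊗ x₂ ⊗ x₃` -/
  comul_right_R :
    Algebra.TensorProduct.map (AlgHom.id k H) comul (R : H ⊗[k] H) =
    legSwap₁₂ k H (legSwap₂₃ k H
        ((Φ⁻¹ : (H ⊗[k] (H ⊗[k] H))ˣ) : H ⊗[k] (H ⊗[k] H))) * leg₁₃ (R : H ⊗[k] H) *
      legSwap₁₂ k H Φ * leg₁₂ (R : H ⊗[k] H) *
      ((Φ⁻¹ : (H ⊗[k] (H ⊗[k] H))ˣ) : H ⊗[k] (H ⊗[k] H))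

end QuasiHopf

/-! ### The braided monoidal category of modules -/

section TensorAction

open scoped TensorProduct

variable {k : Type*} [Field k] {A B D E U V W : Type*} [Ring A] [Ring B] [Ring D] [Ring E]
  [Algebra k A] [Algebra k B] [Algebra k D] [Algebra k E]
  [AddCommGroup U] [Module k U] [AddCommGroup V] [Module k V] [AddCommGroup W] [Module k W]

/-- The action of `A ⊗ B` on `U ⊗ V` given by actions of `A` on `U` and of `B` on `V`. -/
noncomputable def tensorAction (f : A →ₐ[k] Module.End k U) (g : B →ₐ[k] Module.End k V) :
    A ⊗[k] B →ₐ[k] Module.End k (U ⊗[k] V) :=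
  Module.endTensorEndAlgHom.comp (Algebra.TensorProduct.map f g)

@[simp]
lemma tensorAction_tmul (f : A →ₐ[k] Module.End k U) (g : B →ₐ[k] Module.End k V)
    (a : A) (b : B) (u : U) (v : V) :
    tensorAction f g (a ⊗ₜ b) (u ⊗ₜ v) = f a u ⊗ₜ g b v := rfl

lemma tensorAction_map (f : A →ₐ[k] Module.End k U) (g : B →ₐ[k] Module.End k V)
    (p : D →ₐ[k] A) (q : E →ₐ[k] B) (t : D ⊗[k] E) :
    tensorAction (f.comp p) (g.comp q) t = tensorAction f g (Algebra.TensorProduct.map p q t) := by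
  induction t with
  | zero => simp
  | add x y hx hy => simp [hx, hy]
  | tmul d e =>
    refine TensorProduct.ext' fun u v => ?_
    simp

lemma tensorAction_assoc (f : A →ₐ[k] Module.End k U) (g : B →ₐ[k] Module.End k V)
    (h : D →ₐ[k] Module.End k W) (t : (A ⊗[k] B) ⊗[k] D) (x : (U ⊗[k] V) ⊗[k] W) :
    TensorProduct.assoc k U V W (tensorAction (tensorAction f g) h t x) =
      tensorAction f (tensorAction g h) (Algebra.TensorProduct.assoc k k k A B D t)
        (TensorProduct.assoc k U V W x) := by
  induction t with
  | zero => simp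
  | add x y hx hy => simp [hx, hy]
  | tmul s d =>
    induction s with
    | zero => simp
    | add x y hx hy => simp [hx, hy, TensorProduct.add_tmul]
    | tmul a b =>
      induction x with
      | zero => simp
      | add x y hx hy => simp only [map_add, hx, hy]
      | tmul y w =>
        induction y with
        | zero => simp
        | add x y hx hy => simp only [map_add, hx, hy, TensorProduct.add_tmul]
        | tmul u v => simp

lemma tensorAction_comm (f : A →ₐ[k] Module.End k U) (g : B →ₐ[k] Module.End k V)
    (t : A ⊗[k] B) (x : U ⊗[k] V) :
    TensorProduct.comm k U V (tensorAction f g t x) =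
      tensorAction g f (Algebra.TensorProduct.comm k A B t) (TensorProduct.comm k U V x) := by
  induction t with
  | zero => simp
  | add x y hx hy => simp [hx, hy]
  | tmul a b =>
    induction x with
    | zero => simp
    | add x y hx hy => simp only [map_add, hx, hy]
    | tmul u v => simp

/-- Intertwiners for the actions of `A` and `B` are intertwiners for the action of `A ⊗ B`. -/
lemma tensorAction_intertwine {U' V' : Type*} [AddCommGroup U'] [Module k U'] [AddCommGroup V']
    [Module k V'] (f : A →ₐ[k] Module.End k U) (g : B →ₐ[k] Module.End k V)
    (f' : A →ₐ[k] Module.End k U') (g' : B →ₐ[k] Module.End k V') (p : U →ₗ[k] U')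
    (q : V →ₗ[k] V') (hp : ∀ a u, p (f a u) = f' a (p u)) (hq : ∀ b v, q (g b v) = g' b (q v))
    (t : A ⊗[k] B) (x : U ⊗[k] V) :
    TensorProduct.map p q (tensorAction f g t x) =
      tensorAction f' g' t (TensorProduct.map p q x) := by
  induction t with
  | zero => simp
  | add x y hx hy => simp [hx, hy]
  | tmul a b =>
    induction x with
    | zero => simp
    | add x y hx hy => simp only [map_add, hx, hy]
    | tmul u v => simp [hp, hq]

/-- An invertible element of an algebra acts by a linear automorphism. -/
def unitAction (f : A →ₐ[k] Module.End k U) (t : Aˣ) : U ≃ₗ[k] U where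
  toLinearMap := f t
  invFun := f (t⁻¹ : Aˣ)
  left_inv x := by
    change f _ (f _ x) = x
    rw [← Module.End.mul_apply, ← map_mul]; simp
  right_inv x := by
    change f _ (f _ x) = x
    rw [← Module.End.mul_apply, ← map_mul]; simp

@[simp] lemma unitAction_apply (f : A →ₐ[k] Module.End k U) (t : Aˣ) (x : U) :
    unitAction f t x = f t x := rfl

/-- A version of `tensorAction_intertwine` that is semilinear along algebra homomorphisms. -/
lemma tensorAction_intertwine_map {U' V' : Type*} [AddCommGroup U'] [Module k U']
    [AddCommGroup V'] [Module k V'] (f : A →ₐ[k] Module.End k U) (g : B →ₐ[k] Module.End k V)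
    (f' : D →ₐ[k] Module.End k U') (g' : E →ₐ[k] Module.End k V') (φ : A →ₐ[k] D)
    (ψ : B →ₐ[k] E) (p : U →ₗ[k] U') (q : V →ₗ[k] V')
    (hp : ∀ a u, p (f a u) = f' (φ a) (p u)) (hq : ∀ b v, q (g b v) = g' (ψ b) (q v))
    (t : A ⊗[k] B) (x : U ⊗[k] V) :
    TensorProduct.map p q (tensorAction f g t x) =
      tensorAction f' g' (Algebra.TensorProduct.map φ ψ t) (TensorProduct.map p q x) := by
  rw [← tensorAction_map]
  exact tensorAction_intertwine f g _ _ p q hp hq t x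

end TensorAction

namespace QuasitriangularQuasiHopfAlgebra

open scoped TensorProduct

variable {k H : Type u} [Field k] [Ring H] [Algebra k H]

section Constraints

variable (A : QuasitriangularQuasiHopfAlgebra k H) {U V W X : Type*}
  [AddCommGroup U] [Module k U] [AddCommGroup V] [Module k V] [AddCommGroup W] [Module k W]
  [AddCommGroup X] [Module k X]
  (f : H →ₐ[k] Module.End k U) (g : H →ₐ[k] Module.End k V) (e : H →ₐ[k] Module.End k W)
  (d : H →ₐ[k] Module.End k X)

/-- The diagonal action of `H` on `U ⊗ V`, through `Δ`. -/
noncomputable def diagonal : H →ₐ[k] Module.End k (U ⊗[k] V) :=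
  (tensorAction f g).comp A.comul

/-- The action of `H` on the base field, through `ε`. -/
noncomputable def trivialAction : H →ₐ[k] Module.End k k :=
  (Algebra.ofId k (Module.End k k)).comp A.counit

/-- The associativity constraint `(u ⊗ v) ⊗ w ↦ X₁ u ⊗ (X₂ v ⊗ X₃ w)`,
for `Φ = X₁ ⊗ X₂ ⊗ X₃`. -/
noncomputable def assocEquiv : (U ⊗[k] V) ⊗[k] W ≃ₗ[k] U ⊗[k] (V ⊗[k] W) :=
  TensorProduct.assoc k U V W ≪≫ₗ unitAction (tensorAction f (tensorAction g e)) A.Φ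

/-- The braiding `u ⊗ v ↦ R₂ v ⊗ R₁ u`, for `R = R₁ ⊗ R₂`. -/
noncomputable def braidEquiv : U ⊗[k] V ≃ₗ[k] V ⊗[k] U :=
  unitAction (tensorAction f g) A.R ≪≫ₗ TensorProduct.comm k U V

variable {f g e d}

lemma diagonal_apply (h : H) (x : U ⊗[k] V) :
    A.diagonal f g h x = tensorAction f g (A.comul h) x := rfl

lemma assocEquiv_apply (x : (U ⊗[k] V) ⊗[k] W) :
    A.assocEquiv f g e x =
      tensorAction f (tensorAction g e) A.Φ (TensorProduct.assoc k U V W x) := rfl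

lemma braidEquiv_apply (x : U ⊗[k] V) :
    A.braidEquiv f g x = TensorProduct.comm k U V (tensorAction f g A.R x) := rfl

lemma tensorAction_diagonal_left (t : H ⊗[k] H) (x : (U ⊗[k] V) ⊗[k] W) :
    tensorAction (A.diagonal f g) e t x = tensorAction (tensorAction f g) e
      (Algebra.TensorProduct.map A.comul (AlgHom.id k H) t) x := by
  rw [← tensorAction_map]; rfl

lemma tensorAction_diagonal_right (t : H ⊗[k] H) (x : U ⊗[k] (V ⊗[k] W)) :
    tensorAction f (A.diagonal g e) t x = tensorAction f (tensorAction g e)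
      (Algebra.TensorProduct.map (AlgHom.id k H) A.comul t) x := by
  rw [← tensorAction_map]; rfl

lemma assocEquiv_comm (h : H) (x : (U ⊗[k] V) ⊗[k] W) :
    A.assocEquiv f g e (A.diagonal (A.diagonal f g) e h x) =
      A.diagonal f (A.diagonal g e) h (A.assocEquiv f g e x) := by
  rw [assocEquiv_apply, diagonal_apply, tensorAction_diagonal_left, tensorAction_assoc,
    diagonal_apply, tensorAction_diagonal_right, assocEquiv_apply, ← Module.End.mul_apply,
    ← map_mul, ← Module.End.mul_apply, ← map_mul, A.quasi_coassoc]

lemma braidEquiv_comm (h : H) (x : U ⊗[k] V) :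
    A.braidEquiv f g (A.diagonal f g h x) = A.diagonal g f h (A.braidEquiv f g x) := by
  rw [braidEquiv_apply, braidEquiv_apply, diagonal_apply, diagonal_apply, ← Module.End.mul_apply,
    ← map_mul, ← A.comul_op, map_mul, Module.End.mul_apply, tensorAction_comm]
  congr 2
  exact (Algebra.TensorProduct.comm k H H).symm_apply_apply _

lemma lid_comm (h : H) (x : k ⊗[k] V) :
    TensorProduct.lid k V (A.diagonal A.trivialAction g h x) = g h (TensorProduct.lid k V x) := by
  have : A.diagonal A.trivialAction g h x = tensorAction (Algebra.ofId k (Module.End k k)) g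
      (Algebra.TensorProduct.map A.counit (AlgHom.id k H) (A.comul h)) x := by
    rw [← tensorAction_map]; rfl
  rw [this, A.counit_left]
  clear this
  induction x with
  | zero => simp
  | add x y hx hy => simp only [map_add, hx, hy]
  | tmul c v => simp

lemma rid_comm (h : H) (x : V ⊗[k] k) :
    TensorProduct.rid k V (A.diagonal g A.trivialAction h x) = g h (TensorProduct.rid k V x) := by
  have : A.diagonal g A.trivialAction h x = tensorAction g (Algebra.ofId k (Module.End k k))
      (Algebra.TensorProduct.map (AlgHom.id k H) A.counit (A.comul h)) x := by
    rw [← tensorAction_map]; rfl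
  rw [this, A.counit_right]
  clear this
  induction x with
  | zero => simp
  | add x y hx hy => simp only [map_add, hx, hy]
  | tmul c v => simp

end Constraints

section Coherence

variable (A : QuasitriangularQuasiHopfAlgebra k H) {U V W X : Type*}
  [AddCommGroup U] [Module k U] [AddCommGroup V] [Module k V] [AddCommGroup W] [Module k W]
  [AddCommGroup X] [Module k X]
  (f : H →ₐ[k] Module.End k U) (g : H →ₐ[k] Module.End k V) (e : H →ₐ[k] Module.End k W)
  (d : H →ₐ[k] Module.End k X)

lemma pentagon_aux₁ (y : U ⊗[k] ((V ⊗[k] W) ⊗[k] X)) :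
    TensorProduct.map LinearMap.id (A.assocEquiv g e d).toLinearMap y =
      tensorAction f (tensorAction g (tensorAction e d)) ((1 : H) ⊗ₜ A.Φ)
        (TensorProduct.map LinearMap.id (TensorProduct.assoc k V W X).toLinearMap y) := by
  induction y with
  | zero => simp
  | add x y hx hy => simp only [map_add, hx, hy]
  | tmul u z =>
    rw [TensorProduct.map_tmul, TensorProduct.map_tmul, tensorAction_tmul, map_one]
    rfl

lemma pentagon_aux₂ (t : H ⊗[k] ((H ⊗[k] H) ⊗[k] H)) (z : U ⊗[k] ((V ⊗[k] W) ⊗[k] X)) :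
    TensorProduct.map LinearMap.id (TensorProduct.assoc k V W X).toLinearMap
      (tensorAction f (tensorAction (tensorAction g e) d) t z) =
    tensorAction f (tensorAction g (tensorAction e d))
      (Algebra.TensorProduct.map (AlgHom.id k H)
        (Algebra.TensorProduct.assoc k k k H H H).toAlgHom t)
      (TensorProduct.map LinearMap.id (TensorProduct.assoc k V W X).toLinearMap z) :=
  tensorAction_intertwine_map _ _ _ _ _ _ _ _ (fun _ _ => rfl)
    (fun b v => tensorAction_assoc g e d b v) t z

lemma pentagon_aux₃ (y : ((U ⊗[k] V) ⊗[k] W) ⊗[k] X) :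
    TensorProduct.map (A.assocEquiv f g e).toLinearMap LinearMap.id y =
      tensorAction (tensorAction f (tensorAction g e)) d
        ((A.Φ : H ⊗[k] (H ⊗[k] H)) ⊗ₜ (1 : H))
        (TensorProduct.map (TensorProduct.assoc k U V W).toLinearMap LinearMap.id y) := by
  induction y with
  | zero => simp
  | add x y hx hy => simp only [map_add, hx, hy]
  | tmul z u =>
    rw [TensorProduct.map_tmul, TensorProduct.map_tmul, tensorAction_tmul, map_one]
    rfl

lemma pentagon_aux₄ (x : ((U ⊗[k] V) ⊗[k] W) ⊗[k] X) :
    TensorProduct.map LinearMap.id (TensorProduct.assoc k V W X).toLinearMap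
      (TensorProduct.assoc k U (V ⊗[k] W) X
        (TensorProduct.map (TensorProduct.assoc k U V W).toLinearMap LinearMap.id x)) =
    TensorProduct.assoc k U V (W ⊗[k] X) (TensorProduct.assoc k (U ⊗[k] V) W X x) := by
  have : TensorProduct.map LinearMap.id (TensorProduct.assoc k V W X).toLinearMap ∘ₗ
      (TensorProduct.assoc k U (V ⊗[k] W) X).toLinearMap ∘ₗ
        TensorProduct.map (TensorProduct.assoc k U V W).toLinearMap LinearMap.id =
      (TensorProduct.assoc k U V (W ⊗[k] X)).toLinearMap ∘ₗ
        (TensorProduct.assoc k (U ⊗[k] V) W X).toLinearMap :=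
    TensorProduct.ext_fourfold fun _ _ _ _ => rfl
  exact LinearMap.congr_fun this x

lemma assocEquiv_pentagon (x : ((U ⊗[k] V) ⊗[k] W) ⊗[k] X) :
    TensorProduct.map LinearMap.id (A.assocEquiv g e d).toLinearMap
      (A.assocEquiv f (A.diagonal g e) d
        (TensorProduct.map (A.assocEquiv f g e).toLinearMap LinearMap.id x)) =
    A.assocEquiv f g (A.diagonal e d) (A.assocEquiv (A.diagonal f g) e d x) := by
  have h1 (t : H ⊗[k] (H ⊗[k] H)) (z : U ⊗[k] ((V ⊗[k] W) ⊗[k] X)) :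
      tensorAction f (tensorAction (A.diagonal g e) d) t z =
      tensorAction f (tensorAction (tensorAction g e) d) (Algebra.TensorProduct.map (AlgHom.id k H)
        (Algebra.TensorProduct.map A.comul (AlgHom.id k H)) t) z := by
    rw [← tensorAction_map]
    congr 2
    congr 1
    exact AlgHom.ext fun s => LinearMap.ext fun y => A.tensorAction_diagonal_left s y
  have h2 (t : H ⊗[k] (H ⊗[k] H)) (z : U ⊗[k] (V ⊗[k] (W ⊗[k] X))) :
      tensorAction f (tensorAction g (A.diagonal e d)) t z =
      tensorAction f (tensorAction g (tensorAction e d)) (Algebra.TensorProduct.map (AlgHom.id k H)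
        (Algebra.TensorProduct.map (AlgHom.id k H) A.comul) t) z := by
    rw [← tensorAction_map]
    congr 2
    congr 1
    exact AlgHom.ext fun s => LinearMap.ext fun y => A.tensorAction_diagonal_right s y
  have h3 (t : H ⊗[k] (H ⊗[k] H)) (z : (U ⊗[k] V) ⊗[k] (W ⊗[k] X)) :
      tensorAction (A.diagonal f g) (tensorAction e d) t z =
      tensorAction (tensorAction f g) (tensorAction e d)
        (Algebra.TensorProduct.map A.comul (AlgHom.id k (H ⊗[k] H)) t) z := by
    rw [← tensorAction_map]; rfl
  have h4 (t : H ⊗[k] (H ⊗[k] H)) : Algebra.TensorProduct.map (AlgHom.id k H)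
      (Algebra.TensorProduct.assoc k k k H H H).toAlgHom (Algebra.TensorProduct.map (AlgHom.id k H)
        (Algebra.TensorProduct.map A.comul (AlgHom.id k H)) t) =
      Algebra.TensorProduct.map (AlgHom.id k H)
        ((Algebra.TensorProduct.assoc k k k H H H).toAlgHom.comp
          (Algebra.TensorProduct.map A.comul (AlgHom.id k H))) t := by
    rw [← AlgHom.comp_apply, ← Algebra.TensorProduct.map_comp]
    rfl
  rw [A.pentagon_aux₁ f, assocEquiv_apply, h1, pentagon_aux₂, h4, A.pentagon_aux₃ f g e d,
    tensorAction_assoc, pentagon_aux₂, pentagon_aux₄, assocEquiv_apply, assocEquiv_apply, h2, h3,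
    tensorAction_assoc]
  simp only [← Module.End.mul_apply, ← map_mul]
  rw [← A.pentagon]
  simp only [map_mul, mul_assoc]

lemma assocEquiv_triangle (x : (U ⊗[k] k) ⊗[k] V) :
    TensorProduct.map LinearMap.id (TensorProduct.lid k V).toLinearMap
      (A.assocEquiv f A.trivialAction g x) =
    TensorProduct.map (TensorProduct.rid k U).toLinearMap LinearMap.id x := by
  have h1 (t : H ⊗[k] (H ⊗[k] H)) (z : U ⊗[k] (k ⊗[k] V)) :
      tensorAction f (tensorAction A.trivialAction g) t z =
      tensorAction f (tensorAction (Algebra.ofId k (Module.End k k)) g)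
        (Algebra.TensorProduct.map (AlgHom.id k H)
          (Algebra.TensorProduct.map A.counit (AlgHom.id k H)) t) z := by
    rw [← tensorAction_map]
    congr 2
    congr 1
    refine AlgHom.ext fun s => LinearMap.ext fun y => ?_
    rw [AlgHom.comp_apply, ← tensorAction_map]
    rfl
  rw [assocEquiv_apply, h1, A.counit_Φ, map_one, Module.End.one_apply]
  have : TensorProduct.map LinearMap.id (TensorProduct.lid k V).toLinearMap ∘ₗ
      (TensorProduct.assoc k U k V).toLinearMap =
      TensorProduct.map (TensorProduct.rid k U).toLinearMap LinearMap.id :=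
    TensorProduct.ext_threefold fun u c v => by simp [TensorProduct.smul_tmul]
  exact LinearMap.congr_fun this x

/-- `u ⊗ v ⊗ w ↦ u ⊗ w ⊗ v` -/
noncomputable def swap₂₃ : U ⊗[k] (V ⊗[k] W) →ₗ[k] U ⊗[k] (W ⊗[k] V) :=
  TensorProduct.map LinearMap.id (TensorProduct.comm k V W).toLinearMap

/-- `u ⊗ v ⊗ w ↦ v ⊗ u ⊗ w` -/
noncomputable def swap₁₂ : U ⊗[k] (V ⊗[k] W) →ₗ[k] V ⊗[k] (U ⊗[k] W) :=
  (TensorProduct.leftComm k U V W).toLinearMap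

lemma swap₂₃_action (t : H ⊗[k] (H ⊗[k] H)) (z : U ⊗[k] (V ⊗[k] W)) :
    swap₂₃ (tensorAction f (tensorAction g e) t z) =
      tensorAction f (tensorAction e g) (legSwap₂₃ k H t) (swap₂₃ z) :=
  tensorAction_intertwine_map f (tensorAction g e) f (tensorAction e g) (AlgHom.id k H)
    (Algebra.TensorProduct.comm k H H).toAlgHom _ _ (fun _ _ => rfl)
    (fun b v => tensorAction_comm g e b v) t z

lemma swap₁₂_action (t : H ⊗[k] (H ⊗[k] H)) (z : U ⊗[k] (V ⊗[k] W)) :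
    swap₁₂ (tensorAction f (tensorAction g e) t z) =
      tensorAction g (tensorAction f e) (legSwap₁₂ k H t) (swap₁₂ z) := by
  have h1 (y : (U ⊗[k] V) ⊗[k] W) : swap₁₂ (TensorProduct.assoc k U V W y) =
      TensorProduct.assoc k V U W
        (TensorProduct.map (TensorProduct.comm k U V).toLinearMap LinearMap.id y) := by
    have : swap₁₂ ∘ₗ (TensorProduct.assoc k U V W).toLinearMap =
        (TensorProduct.assoc k V U W).toLinearMap ∘ₗ
          TensorProduct.map (TensorProduct.comm k U V).toLinearMap LinearMap.id :=
      TensorProduct.ext_threefold fun u v w => rfl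
    exact LinearMap.congr_fun this y
  have h2 (s : (H ⊗[k] H) ⊗[k] H) :
      legSwap₁₂ k H (Algebra.TensorProduct.assoc k k k H H H s) =
      Algebra.TensorProduct.assoc k k k H H H (Algebra.TensorProduct.map
        (Algebra.TensorProduct.comm k H H).toAlgHom (AlgHom.id k H) s) := by
    have : ((legSwap₁₂ k H).toAlgHom.comp (Algebra.TensorProduct.assoc k k k H H H).toAlgHom) =
        (Algebra.TensorProduct.assoc k k k H H H).toAlgHom.comp (Algebra.TensorProduct.map
        (Algebra.TensorProduct.comm k H H).toAlgHom (AlgHom.id k H)) := by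
      ext <;> rfl
    exact DFunLike.congr_fun this s
  obtain ⟨t, rfl⟩ := (Algebra.TensorProduct.assoc k k k H H H).surjective t
  obtain ⟨z, rfl⟩ := (TensorProduct.assoc k U V W).surjective z
  rw [← tensorAction_assoc, h1, h1, h2, ← tensorAction_assoc]
  congr 1
  exact tensorAction_intertwine_map (tensorAction f g) e (tensorAction g f) e
    (Algebra.TensorProduct.comm k H H).toAlgHom (AlgHom.id k H) _ _
    (fun b v => tensorAction_comm f g b v) (fun _ _ => rfl) t z

lemma legSwap₁₂_invol (t : H ⊗[k] (H ⊗[k] H)) : legSwap₁₂ k H (legSwap₁₂ k H t) = t := by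
  have : (legSwap₁₂ k H).toAlgHom.comp (legSwap₁₂ k H).toAlgHom = AlgHom.id k _ := by
    ext <;> rfl
  exact DFunLike.congr_fun this t

lemma legSwap₂₃_invol (t : H ⊗[k] (H ⊗[k] H)) : legSwap₂₃ k H (legSwap₂₃ k H t) = t := by
  have : (legSwap₂₃ k H).toAlgHom.comp (legSwap₂₃ k H).toAlgHom = AlgHom.id k _ := by
    ext <;> rfl
  exact DFunLike.congr_fun this t

lemma braid_left (x : (U ⊗[k] V) ⊗[k] W) :
    TensorProduct.assoc k V U W
      (TensorProduct.map (A.braidEquiv f g).toLinearMap LinearMap.id x) =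
    swap₁₂ (tensorAction f (tensorAction g e) (leg₁₂ (A.R : H ⊗[k] H))
      (TensorProduct.assoc k U V W x)) := by
  rw [leg₁₂, ← tensorAction_assoc]
  induction x with
  | zero => simp
  | add x y hx hy => simp only [map_add, hx, hy]
  | tmul y w =>
    rw [TensorProduct.map_tmul, tensorAction_tmul, map_one]
    change TensorProduct.assoc k V U W (TensorProduct.comm k U V (tensorAction f g A.R y) ⊗ₜ w) = _
    generalize (tensorAction f g A.R y) = z
    induction z with
    | zero => simp
    | add x y hx hy =>
      simp only [map_add, TensorProduct.add_tmul] at hx hy ⊢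
      rw [hx, hy]
    | tmul u v => rfl

lemma braid_right (x : U ⊗[k] (V ⊗[k] W)) :
    TensorProduct.map LinearMap.id (A.braidEquiv g e).toLinearMap x =
    swap₂₃ (tensorAction f (tensorAction g e) (leg₂₃ (A.R : H ⊗[k] H)) x) := by
  induction x with
  | zero => simp
  | add x y hx hy => simp only [map_add, hx, hy]
  | tmul y w =>
    rw [TensorProduct.map_tmul, leg₂₃, tensorAction_tmul, map_one]
    rfl

lemma legSwap_leg₁₂ (t : H ⊗[k] H) :
    legSwap₁₂ k H (legSwap₂₃ k H (leg₁₂ t)) = leg₂₃ t := by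
  induction t with
  | zero => simp [leg₁₂, leg₂₃]
  | add x y hx hy =>
    simp only [leg₁₂, leg₂₃, TensorProduct.add_tmul, TensorProduct.tmul_add, map_add] at hx hy ⊢
    rw [hx, hy]
  | tmul x y => rfl

lemma legSwap_cancel (F : H ⊗[k] (H ⊗[k] H) ≃ₐ[k] H ⊗[k] (H ⊗[k] H))
    (G : H ⊗[k] (H ⊗[k] H) ≃ₐ[k] H ⊗[k] (H ⊗[k] H)) (t : (H ⊗[k] (H ⊗[k] H))ˣ) :
    F (G (t⁻¹ : (H ⊗[k] (H ⊗[k] H))ˣ)) * F (G t) = 1 ∧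
      F (G t) * F (G (t⁻¹ : (H ⊗[k] (H ⊗[k] H))ˣ)) = 1 := by
  simp only [← map_mul]
  simp

lemma braidEquiv_hexagon_forward (x : (U ⊗[k] V) ⊗[k] W) :
    A.assocEquiv g e f (A.braidEquiv f (A.diagonal g e) (A.assocEquiv f g e x)) =
      TensorProduct.map LinearMap.id (A.braidEquiv f e).toLinearMap
        (A.assocEquiv g f e
          (TensorProduct.map (A.braidEquiv f g).toLinearMap LinearMap.id x)) := by
  have h1 (z : U ⊗[k] (V ⊗[k] W)) : TensorProduct.assoc k V W U
      (TensorProduct.comm k U (V ⊗[k] W) z) = swap₂₃ (swap₁₂ z) := by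
    have : (TensorProduct.assoc k V W U).toLinearMap ∘ₗ
        (TensorProduct.comm k U (V ⊗[k] W)).toLinearMap = swap₂₃ ∘ₗ swap₁₂ :=
      TensorProduct.ext_threefold' fun u v w => rfl
    exact LinearMap.congr_fun this z
  rw [A.braid_right g]
  simp only [assocEquiv_apply]
  rw [A.braid_left f g e, braidEquiv_apply, tensorAction_diagonal_right, h1]
  simp only [swap₁₂_action, swap₂₃_action, ← Module.End.mul_apply, ← map_mul]
  congr 2
  rw [A.comul_right_R]
  simp only [map_mul, legSwap₁₂_invol, legSwap₂₃_invol, leg₁₃]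
  simp [mul_assoc, legSwap_leg₁₂, (legSwap_cancel _ _ A.Φ).1]

lemma assocEquiv_symm_apply (x : U ⊗[k] (V ⊗[k] W)) :
    TensorProduct.assoc k U V W ((A.assocEquiv f g e).symm x) =
      tensorAction f (tensorAction g e)
        ((A.Φ⁻¹ : (H ⊗[k] (H ⊗[k] H))ˣ) : H ⊗[k] (H ⊗[k] H)) x :=
  (TensorProduct.assoc k U V W).apply_symm_apply _

lemma braidEquiv_hexagon_reverse (x : U ⊗[k] (V ⊗[k] W)) :
    (A.assocEquiv e f g).symm (A.braidEquiv (A.diagonal f g) e ((A.assocEquiv f g e).symm x)) =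
      TensorProduct.map (A.braidEquiv f e).toLinearMap LinearMap.id
        ((A.assocEquiv f e g).symm
          (TensorProduct.map LinearMap.id (A.braidEquiv g e).toLinearMap x)) := by
  have h1 (z : (U ⊗[k] V) ⊗[k] W) : TensorProduct.comm k (U ⊗[k] V) W z =
      swap₁₂ (swap₂₃ (TensorProduct.assoc k U V W z)) := by
    have : (TensorProduct.comm k (U ⊗[k] V) W).toLinearMap =
        swap₁₂ ∘ₗ swap₂₃ ∘ₗ (TensorProduct.assoc k U V W).toLinearMap :=
      TensorProduct.ext_threefold fun u v w => rfl
    exact LinearMap.congr_fun this z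
  apply (TensorProduct.assoc k W U V).injective
  rw [assocEquiv_symm_apply, A.braid_left f e g, assocEquiv_symm_apply, A.braid_right f,
    braidEquiv_apply, tensorAction_diagonal_left, h1, tensorAction_assoc, assocEquiv_symm_apply]
  simp only [swap₁₂_action, swap₂₃_action, ← Module.End.mul_apply, ← map_mul]
  congr 2
  rw [A.comul_left_R]
  simp only [map_mul, legSwap₁₂_invol, legSwap₂₃_invol, leg₁₃]
  simp [mul_assoc, (legSwap_cancel _ _ A.Φ).2]

variable {f g e}
variable {U' V' W' : Type*} [AddCommGroup U'] [Module k U'] [AddCommGroup V'] [Module k V']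
  [AddCommGroup W'] [Module k W'] {f' : H →ₐ[k] Module.End k U'} {g' : H →ₐ[k] Module.End k V'}
  {e' : H →ₐ[k] Module.End k W'} {p : U →ₗ[k] U'} {q : V →ₗ[k] V'} {r : W →ₗ[k] W'}

lemma braidEquiv_naturality (hp : ∀ h u, p (f h u) = f' h (p u))
    (hq : ∀ h v, q (g h v) = g' h (q v)) (x : U ⊗[k] V) :
    A.braidEquiv f' g' (TensorProduct.map p q x) =
      TensorProduct.map q p (A.braidEquiv f g x) := by
  rw [braidEquiv_apply, braidEquiv_apply, ← tensorAction_intertwine f g f' g' p q hp hq]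
  exact LinearMap.congr_fun (TensorProduct.ext' fun _ _ => rfl :
    (TensorProduct.comm k U' V').toLinearMap ∘ₗ TensorProduct.map p q =
      TensorProduct.map q p ∘ₗ (TensorProduct.comm k U V).toLinearMap) _

lemma assocEquiv_naturality (hp : ∀ h u, p (f h u) = f' h (p u))
    (hq : ∀ h v, q (g h v) = g' h (q v)) (hr : ∀ h w, r (e h w) = e' h (r w))
    (x : (U ⊗[k] V) ⊗[k] W) :
    A.assocEquiv f' g' e' (TensorProduct.map (TensorProduct.map p q) r x) =
      TensorProduct.map p (TensorProduct.map q r) (A.assocEquiv f g e x) := by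
  rw [assocEquiv_apply, assocEquiv_apply, tensorAction_intertwine f (tensorAction g e) f'
    (tensorAction g' e') p _ hp (fun b v => tensorAction_intertwine g e g' e' q r hq hr b v)]
  congr 1
  exact LinearMap.congr_fun (TensorProduct.ext_threefold fun _ _ _ => rfl :
    (TensorProduct.assoc k U' V' W').toLinearMap ∘ₗ
      TensorProduct.map (TensorProduct.map p q) r =
    TensorProduct.map p (TensorProduct.map q r) ∘ₗ
      (TensorProduct.assoc k U V W).toLinearMap) x

end Coherence

end QuasitriangularQuasiHopfAlgebra

namespace QuasitriangularQuasiHopfAlgebra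

open scoped TensorProduct

variable {k H : Type u} [Field k] [Ring H] [Algebra k H]

/-- Left `H`-modules, as `k`-vector spaces with an algebra homomorphism from `H` to the
endomorphisms. -/
structure Rep (A : QuasitriangularQuasiHopfAlgebra k H) : Type (u + 1) where
  V : Type u
  [addCommGroup : AddCommGroup V]
  [module : Module k V]
  ρ : H →ₐ[k] Module.End k V

namespace Rep

attribute [instance] addCommGroup module

variable {A : QuasitriangularQuasiHopfAlgebra k H}

/-- Morphisms of left `H`-modules. -/
@[ext]
structure Hom (M N : A.Rep) where
  lin : M.V →ₗ[k] N.V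
  comm (h : H) (v : M.V) : lin (M.ρ h v) = N.ρ h (lin v)

instance : Category A.Rep where
  Hom := Hom
  id M := ⟨LinearMap.id, fun _ _ => rfl⟩
  comp f g := ⟨g.lin ∘ₗ f.lin, fun h v => by simp [f.comm, g.comm]⟩

/-- The underlying linear map of a morphism. -/
def lin {M N : A.Rep} (f : M ⟶ N) : M.V →ₗ[k] N.V := Hom.lin f

/-- The morphism with a given underlying linear map. -/
def mkHom {M N : A.Rep} (f : M.V →ₗ[k] N.V) (hf : ∀ (h : H) (v : M.V), f (M.ρ h v) = N.ρ h (f v)) :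
    M ⟶ N := (⟨f, hf⟩ : Hom M N)

lemma lin_comm {M N : A.Rep} (f : M ⟶ N) (h : H) (v : M.V) :
    lin f (M.ρ h v) = N.ρ h (lin f v) := Hom.comm f h v

lemma hom_ext {M N : A.Rep} {f g : M ⟶ N} (h : ∀ v, lin f v = lin g v) : f = g :=
  Hom.ext (LinearMap.ext h)

@[simp] lemma lin_id (M : A.Rep) (v : M.V) : lin (𝟙 M) v = v := rfl

@[simp] lemma lin_comp {M N P : A.Rep} (f : M ⟶ N) (g : N ⟶ P) (v : M.V) :
    lin (f ≫ g) v = lin g (lin f v) := rfl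

/-- An `H`-linear isomorphism of vector spaces is an isomorphism of modules. -/
def mkIso {M N : A.Rep} (e : M.V ≃ₗ[k] N.V) (h : ∀ (a : H) (v : M.V), e (M.ρ a v) = N.ρ a (e v)) :
    M ≅ N where
  hom := mkHom e.toLinearMap h
  inv := mkHom e.symm.toLinearMap fun a v => by
    apply e.injective
    simp [h]
  hom_inv_id := hom_ext fun v => e.symm_apply_apply v
  inv_hom_id := hom_ext fun v => e.apply_symm_apply v

/-! #### The abelian structure -/

section Abelian

instance {M N : A.Rep} : Zero (M ⟶ N) := ⟨mkHom 0 fun _ _ => by simp⟩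
instance {M N : A.Rep} : Add (M ⟶ N) :=
  ⟨fun f g => mkHom (lin f + lin g) fun h v => by simp [lin_comm]⟩
instance {M N : A.Rep} : Neg (M ⟶ N) :=
  ⟨fun f => mkHom (- lin f) fun h v => by simp [lin_comm]⟩
instance {M N : A.Rep} : Sub (M ⟶ N) :=
  ⟨fun f g => mkHom (lin f - lin g) fun h v => by simp [lin_comm]⟩
instance {M N : A.Rep} : SMul ℕ (M ⟶ N) :=
  ⟨fun n f => mkHom (n • lin f) fun h v => by simp [lin_comm]⟩
instance {M N : A.Rep} : SMul ℤ (M ⟶ N) :=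
  ⟨fun n f => mkHom (n • lin f) fun h v => by simp [lin_comm]⟩

lemma lin_injective {M N : A.Rep} : Function.Injective (lin : (M ⟶ N) → (M.V →ₗ[k] N.V)) :=
  fun _ _ h => Hom.ext h

instance {M N : A.Rep} : AddCommGroup (M ⟶ N) :=
  lin_injective.addCommGroup lin rfl (fun _ _ => rfl) (fun _ => rfl) (fun _ _ => rfl)
    (fun _ _ => rfl) (fun _ _ => rfl)

instance : Preadditive A.Rep where
  add_comp _ _ _ f f' g := hom_ext fun v => by
    change lin g (lin f v + lin f' v) = lin g (lin f v) + lin g (lin f' v)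
    exact map_add _ _ _
  comp_add _ _ _ _ _ _ := hom_ext fun _ => rfl

/-- The functor to Mathlib's category of modules over the ring `H`. -/
def toModuleCat (A : QuasitriangularQuasiHopfAlgebra k H) : A.Rep ⥤ ModuleCat.{u} H where
  obj M :=
    letI := Module.compHom M.V M.ρ.toRingHom
    ModuleCat.of H M.V
  map {M N} f :=
    letI := Module.compHom M.V M.ρ.toRingHom
    letI := Module.compHom N.V N.ρ.toRingHom
    ModuleCat.ofHom
      { toFun := lin f
        map_add' := map_add (lin f)
        map_smul' := lin_comm f }

/-- A module over the ring `H`, as an object of `A.Rep`. -/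
def ofModuleCat (A : QuasitriangularQuasiHopfAlgebra k H) (M : ModuleCat.{u} H) : A.Rep :=
  letI := Module.compHom M (algebraMap k H)
  haveI : IsScalarTower k H M := IsScalarTower.of_algebraMap_smul fun _ _ => rfl
  { V := M
    ρ := Algebra.lsmul k k M }

instance : (toModuleCat A).Faithful where
  map_injective {M N} f g h := hom_ext fun v => by
    have := congrArg (fun e => ModuleCat.Hom.hom e) h
    exact DFunLike.congr_fun this v

instance : (toModuleCat A).Full where
  map_surjective {M N} f := by
    refine ⟨mkHom
      { toFun := fun v => f.hom v
        map_add' := fun v w => map_add f.hom v w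
        map_smul' := fun c v => ?_ } fun h v => f.hom.map_smul h v, rfl⟩
    have := f.hom.map_smul (algebraMap k H c) v
    change f.hom (M.ρ (algebraMap k H c) v) = N.ρ (algebraMap k H c) (f.hom v) at this
    rw [AlgHom.commutes, AlgHom.commutes] at this
    exact this

instance : (toModuleCat A).EssSurj where
  mem_essImage M := by
    let := Module.compHom (ofModuleCat A M).V (ofModuleCat A M).ρ.toRingHom
    let e : (ofModuleCat A M).V ≃ₗ[H] M :=
      { toFun := fun v => v
        invFun := fun v => v
        map_add' := fun _ _ => rfl
        map_smul' := fun _ _ => rfl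
        left_inv := fun _ => rfl
        right_inv := fun _ => rfl }
    exact ⟨ofModuleCat A M, ⟨e.toModuleIso⟩⟩

instance : (toModuleCat A).IsEquivalence where

instance : (toModuleCat A).Additive where

instance : HasFiniteProducts A.Rep where
  out _ := Adjunction.hasLimitsOfShape_of_equivalence (toModuleCat A)

noncomputable instance : Abelian A.Rep := abelianOfEquivalence (toModuleCat A)

end Abelian

/-! #### The braided monoidal structure -/

/-- The tensor product over `k`, with the diagonal action through `Δ`. -/
noncomputable def tensorObj (M N : A.Rep) : A.Rep where
  V := M.V ⊗[k] N.V
  ρ := A.diagonal M.ρ N.ρ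

/-- The base field, with the action through `ε`. -/
noncomputable def unitObj : A.Rep where
  V := k
  ρ := A.trivialAction

/-- The tensor product of morphisms. -/
noncomputable def tensorHom {M N M' N' : A.Rep} (f : M ⟶ M') (g : N ⟶ N') :
    tensorObj M N ⟶ tensorObj M' N' :=
  mkHom (M := tensorObj M N) (N := tensorObj M' N') (TensorProduct.map (lin f) (lin g)) fun h v =>
    tensorAction_intertwine M.ρ N.ρ M'.ρ N'.ρ _ _ (lin_comm f) (lin_comm g) (A.comul h) v

noncomputable instance : MonoidalCategoryStruct A.Rep where
  tensorObj := tensorObj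
  tensorHom f g := tensorHom f g
  whiskerLeft M _ _ f := tensorHom (𝟙 M) f
  whiskerRight f N := tensorHom f (𝟙 N)
  tensorUnit := unitObj
  associator M N P := mkIso (M := tensorObj (tensorObj M N) P) (N := tensorObj M (tensorObj N P))
    (A.assocEquiv M.ρ N.ρ P.ρ) (fun h x => A.assocEquiv_comm h x)
  leftUnitor M := mkIso (M := tensorObj unitObj M) (N := M) (TensorProduct.lid k M.V)
    (fun h x => A.lid_comm h x)
  rightUnitor M := mkIso (M := tensorObj M unitObj) (N := M) (TensorProduct.rid k M.V)
    (fun h x => A.rid_comm h x)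

noncomputable instance : MonoidalCategory A.Rep where
  tensorHom_def f g := hom_ext fun x =>
    (LinearMap.congr_fun (TensorProduct.ext' fun _ _ => rfl :
      TensorProduct.map (lin f) (lin g) = TensorProduct.map LinearMap.id (lin g) ∘ₗ
        TensorProduct.map (lin f) LinearMap.id) x)
  id_tensorHom_id M N := hom_ext fun x => LinearMap.congr_fun TensorProduct.map_id x
  tensorHom_comp_tensorHom f g f' g' := hom_ext fun x =>
    (LinearMap.congr_fun (TensorProduct.map_comp (lin f') (lin g') (lin f) (lin g)) x).symm
  whiskerLeft_id M N := hom_ext fun x => LinearMap.congr_fun TensorProduct.map_id x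
  id_whiskerRight M N := hom_ext fun x => LinearMap.congr_fun TensorProduct.map_id x
  associator_naturality f g e := hom_ext fun x => A.assocEquiv_naturality
    (lin_comm f) (lin_comm g) (lin_comm e) x
  leftUnitor_naturality {M N} f := hom_ext fun x =>
    (LinearMap.congr_fun (TensorProduct.ext' fun c v => by simp :
      (TensorProduct.lid k N.V).toLinearMap ∘ₗ TensorProduct.map LinearMap.id (lin f) =
        lin f ∘ₗ (TensorProduct.lid k M.V).toLinearMap) x)
  rightUnitor_naturality {M N} f := hom_ext fun x =>
    (LinearMap.congr_fun (TensorProduct.ext' fun v c => by simp :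
      (TensorProduct.rid k N.V).toLinearMap ∘ₗ TensorProduct.map (lin f) LinearMap.id =
        lin f ∘ₗ (TensorProduct.rid k M.V).toLinearMap) x)
  pentagon M N P Q := hom_ext fun x => A.assocEquiv_pentagon M.ρ N.ρ P.ρ Q.ρ x
  triangle M N := hom_ext fun x => A.assocEquiv_triangle M.ρ N.ρ x

noncomputable instance : BraidedCategory A.Rep where
  braiding M N := mkIso (M := tensorObj M N) (N := tensorObj N M) (A.braidEquiv M.ρ N.ρ)
    (fun h x => A.braidEquiv_comm h x)
  braiding_naturality_right M _ _ f := hom_ext fun x => A.braidEquiv_naturality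
    (lin_comm (𝟙 M)) (lin_comm f) x
  braiding_naturality_left f M := hom_ext fun x => A.braidEquiv_naturality
    (lin_comm f) (lin_comm (𝟙 M)) x
  hexagon_forward M N P := hom_ext fun x => A.braidEquiv_hexagon_forward M.ρ N.ρ P.ρ x
  hexagon_reverse M N P := hom_ext fun x => A.braidEquiv_hexagon_reverse M.ρ N.ρ P.ρ x

end Rep

end QuasitriangularQuasiHopfAlgebra

/-! ### The transmuted braided Hopf algebra -/

section Sweedler

open scoped TensorProduct

variable {k U V W X M : Type*} [Field k] [AddCommGroup U] [Module k U] [AddCommGroup V]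
  [Module k V] [AddCommGroup W] [Module k W] [AddCommGroup X] [Module k X]
  [AddCommGroup M] [Module k M]

/-- Sweedler notation: the sum `∑ f v w`, where `t = ∑ v ⊗ w`. It is computed from a chosen
presentation of `t`, and does not depend on it if `f` is bilinear, see `sweedler₂_eq_lift`. -/
noncomputable def sweedler₂ (t : V ⊗[k] W) (f : V → W → M) : M :=
  ((TensorProduct.exists_multiset t).choose.map fun p => f p.1 p.2).sum

lemma sweedler₂_eq_lift (t : V ⊗[k] W) (f : V → W → M) (F : V →ₗ[k] W →ₗ[k] M)
    (h : ∀ v w, F v w = f v w) : sweedler₂ t f = TensorProduct.lift F t := by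
  conv_rhs => rw [(TensorProduct.exists_multiset t).choose_spec]
  rw [map_multiset_sum, Multiset.map_map]
  exact congrArg Multiset.sum (Multiset.map_congr rfl fun p _ => (h p.1 p.2).symm)

/-- Sweedler notation: the sum `∑ f u v w`, where `t = ∑ u ⊗ v ⊗ w`. -/
noncomputable def sweedler₃ (t : U ⊗[k] (V ⊗[k] W)) (f : U → V → W → M) : M :=
  sweedler₂ t fun u s => sweedler₂ s fun v w => f u v w

/-- Sweedler notation: the sum `∑ f u v w x`, where `t = ∑ u ⊗ v ⊗ w ⊗ x`. -/
noncomputable def sweedler₄ (t : U ⊗[k] (V ⊗[k] (W ⊗[k] X))) (f : U → V → W → X → M) : M :=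
  sweedler₂ t fun u s => sweedler₃ s fun v w x => f u v w x

end Sweedler

namespace QuasitriangularQuasiHopfAlgebra

open scoped TensorProduct

variable {k H : Type u} [Field k] [Ring H] [Algebra k H] (A : QuasitriangularQuasiHopfAlgebra k H)

/-- The algebra homomorphism `H → End H`, `y ↦ (a ↦ a S(y))`. -/
def mulRightAntipode : H →ₐ[k] Module.End k H :=
  AlgHom.ofLinearMap ((LinearMap.mul k H).flip ∘ₗ A.S.toLinearMap)
    (LinearMap.ext fun a => by simp [A.S_one])
    (fun x y => LinearMap.ext fun a => by simp [A.S_mul, mul_assoc])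

/-- The adjoint action `a ▷ h = a₁ h S(a₂)`, as an algebra homomorphism. -/
noncomputable def adjoint : H →ₐ[k] Module.End k H :=
  (Algebra.TensorProduct.lift (Algebra.lmul k H) A.mulRightAntipode fun x y =>
    LinearMap.ext fun a => by simp [mulRightAntipode, mul_assoc]).comp A.comul

lemma adjoint_apply (a h : H) :
    A.adjoint a h = sweedler₂ (A.comul a) fun a₁ a₂ => a₁ * h * A.S a₂ := by
  rw [sweedler₂_eq_lift (A.comul a) _
    ((LinearMap.mul k H).compl₁₂ (LinearMap.mulRight k h) A.S.toLinearMap) fun v w => by simp]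
  simp only [adjoint, AlgHom.comp_apply]
  generalize A.comul a = t
  induction t with
  | zero => simp
  | add x y hx hy => simp only [map_add, LinearMap.add_apply, hx, hy]
  | tmul x y => simp [mulRightAntipode, mul_assoc]

/-- The object `H` of the category of `H`-modules, with the adjoint action. -/
noncomputable def transmuted : A.Rep where
  V := H
  ρ := A.adjoint

/-- The inverse associator `Φ⁻¹`. -/
def Φinv : H ⊗[k] (H ⊗[k] H) := ((A.Φ⁻¹ : (H ⊗[k] (H ⊗[k] H))ˣ) : H ⊗[k] (H ⊗[k] H))

/-- `p = x₁ ⊗ x₂ β S(x₃)` -/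
noncomputable def p : H ⊗[k] H :=
  sweedler₃ A.Φinv fun x₁ x₂ x₃ => x₁ ⊗ₜ[k] (x₂ * A.β * A.S x₃)

/-- `q = X₁ ⊗ S⁻¹(α X₃) X₂` -/
noncomputable def q : H ⊗[k] H :=
  sweedler₃ (A.Φ : H ⊗[k] (H ⊗[k] H)) fun X₁ X₂ X₃ => X₁ ⊗ₜ[k] (A.S.symm (A.α * X₃) * X₂)

/-- `B = (Δ ⊗ 1 ⊗ 1)(Φ) (Φ⁻¹ ⊗ 1)` -/
noncomputable def B : H ⊗[k] (H ⊗[k] (H ⊗[k] H)) :=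
  Algebra.TensorProduct.assoc k k k H H (H ⊗[k] H)
      (Algebra.TensorProduct.map A.comul (AlgHom.id k (H ⊗[k] H)) A.Φ) *
    Algebra.TensorProduct.map (AlgHom.id k H)
      (Algebra.TensorProduct.assoc k k k H H H).toAlgHom
      (Algebra.TensorProduct.assoc k k k H (H ⊗[k] H) H (A.Φinv ⊗ₜ[k] (1 : H)))

/-- `ξ = B₁ β S(B₄) ⊗ B₂ β S(B₃)` -/
noncomputable def ξ : H ⊗[k] H :=
  sweedler₄ A.B fun B₁ B₂ B₃ B₄ => (B₁ * A.β * A.S B₄) ⊗ₜ[k] (B₂ * A.β * A.S B₃)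

/-- `g = Δ(S(x₁) α x₂) ξ (S ⊗ S)(Δ^op(x₃))` -/
noncomputable def g : H ⊗[k] H :=
  sweedler₃ A.Φinv fun x₁ x₂ x₃ =>
    A.comul (A.S x₁ * A.α * x₂) * A.ξ *
      TensorProduct.map A.S.toLinearMap A.S.toLinearMap (TensorProduct.comm k H H (A.comul x₃))

/-- The transmuted multiplication `a ⊗ b ↦ X₁ a S(x₁ X₂) α x₂ X₃' b S(x₃ X₃'')`. -/
noncomputable def transMul (a b : H) : H :=
  sweedler₃ (A.Φ : H ⊗[k] (H ⊗[k] H)) fun X₁ X₂ X₃ =>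
  sweedler₃ A.Φinv fun x₁ x₂ x₃ =>
  sweedler₂ (A.comul X₃) fun X₃' X₃'' =>
    X₁ * a * A.S (x₁ * X₂) * A.α * x₂ * X₃' * b * A.S (x₃ * X₃'')

/-- The transmuted comultiplication
`h ↦ x₁ X₁ h₁ g₁ S(x₂ R₂ y₃ X₃'') ⊗ x₃ R₁ ▷ (y₁ X₂ h₂ g₂ S(y₂ X₃'))`, where `Φ⁻¹ = x = y`. -/
noncomputable def transComul (h : H) : H ⊗[k] H :=
  sweedler₃ A.Φinv fun x₁ x₂ x₃ =>
  sweedler₃ A.Φinv fun y₁ y₂ y₃ =>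
  sweedler₃ (A.Φ : H ⊗[k] (H ⊗[k] H)) fun X₁ X₂ X₃ =>
  sweedler₂ (A.comul X₃) fun X₃' X₃'' =>
  sweedler₂ (A.R : H ⊗[k] H) fun R₁ R₂ =>
  sweedler₂ (A.comul h) fun h₁ h₂ =>
  sweedler₂ A.g fun g₁ g₂ =>
    (x₁ * X₁ * h₁ * g₁ * A.S (x₂ * R₂ * y₃ * X₃'')) ⊗ₜ[k]
      A.adjoint (x₃ * R₁) (y₁ * X₂ * h₂ * g₂ * A.S (y₂ * X₃'))

/-- The transmuted antipode `h ↦ X₁ R₂ p₂ S(q₁ (X₂ R₁ p₁ ▷ h) S(q₂) X₃)`. -/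
noncomputable def transAntipode (h : H) : H :=
  sweedler₃ (A.Φ : H ⊗[k] (H ⊗[k] H)) fun X₁ X₂ X₃ =>
  sweedler₂ (A.R : H ⊗[k] H) fun R₁ R₂ =>
  sweedler₂ A.p fun p₁ p₂ =>
  sweedler₂ A.q fun q₁ q₂ =>
    X₁ * R₂ * p₂ * A.S (q₁ * A.adjoint (X₂ * R₁ * p₁) h * A.S q₂ * X₃)

/-- The condition that the structure maps of a Hopf algebra structure on the object `A.transmuted`
of the braided category of `H`-modules are the transmuted ones. -/
structure IsTransmutedHopf (hopf : HopfObj A.transmuted) : Prop where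
  mul (a b : H) :
    Rep.lin (M := Rep.tensorObj A.transmuted A.transmuted) (N := A.transmuted)
      hopf.mul (a ⊗ₜ[k] b : H ⊗[k] H) = A.transMul a b
  one : Rep.lin (M := Rep.unitObj) (N := A.transmuted) hopf.one (1 : k) = A.β
  comul (h : H) :
    Rep.lin (M := A.transmuted) (N := Rep.tensorObj A.transmuted A.transmuted)
      hopf.comul (h : H) = A.transComul h
  counit (h : H) :
    Rep.lin (M := A.transmuted) (N := Rep.unitObj) hopf.counit (h : H) =
      A.counit A.α * A.counit h
  antipode (h : H) :
    Rep.lin (M := A.transmuted) (N := A.transmuted) hopf.antipode (h : H) = A.transAntipode h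

end QuasitriangularQuasiHopfAlgebra

open scoped MonoidalCategory

namespace BraidedHopf

open MonoidalCategory

/-! ### Cosimplicial relations on tensor powers -/

section Cosimplicial

variable {C : Type u} [Category.{v} C] [MonoidalCategory C] {H : C}

/-! The Hopf structure comes from reconstruction. An element `x` of the transmuted algebra acts on
every module through `θ x = X₁ x S(X₂) α X₃`, and this action `ev` is natural in the module.
Multiplication is composition of actions, comultiplication is the action on a tensor product, the
counit is the action on the tensor unit. Since the action on the regular module separates morphisms
into the transmuted object, even next to further tensor factors (`Separates`, `Separates.tensor`),
each bialgebra axiom becomes the comparison of two ways of acting on `G`, `G ⊗ G`, `G ⊗ (G ⊗ G)` or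
the unit, and follows from coherence of the braided category (`NaturalAction.bimonObj`).

What makes this usable is a small system of modules resembling a Morita context: `G` is `H` with
left multiplication, `K` is `H` with `y ▷ a = a S(y)`, `T` is `H` with trivial action.
Multiplication gives a surjection `μ : G ⊗ K ⟶ H`, and `x ⊗ m ↦ x α m` gives a pairing `e : K ⊗ G ⟶
T`. Every element of `G ⊗ K` acts on `G` by pairing with `K` and then multiplying by the resulting
scalar in `T`. Morphisms out of the transmuted object are defined by descent along `μ` from
composites of known module morphisms, so that their equivariance costs nothing. The antipode is
characterised by `K` being dual to `G`: acting on `K` is acting on `G` through `S` inside the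
pairing (`TransmutationData.ev_antipode`). One antipode axiom is then naturality of the action at
`e`, the other is naturality at `μ` and at the unit. For the comultiplication, `H` acts on a
quotient `E` of `(G ⊗ G) ⊗ (K ⊗ K)`, and `Δ(h)` is the image of `h · ξ` for an invariant `ξ` mapping
to `1 ⊗ 1`.

The explicit formulas are read off afterwards by evaluating these morphisms on elements. The
delicate point is the comultiplication: the element `ξ` defined through `B` has to be recognised as
the invariant element of `E`, which uses the pentagon solved for `B` (`ξ_eq`), and `g` appears as
the result of pairing with `ξ` (`lin_mul₂_ξ`).

The para-cocyclic relations hold for a Hopf algebra in any braided category. The inner faces and the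
degeneracies are algebra maps of tensor powers, so they pass through the product that defines `τ`;
this settles all relations with `τ` that do not touch the first factor. The remaining two reduce to
identities in two tensor factors, `comul_comulMul` and `IsCharacter.comulMul_twistedAntipode`, which
are braided forms of `S(h₂) h₃ ⊗ S_δ(h₁) = 1 ⊗ S_δ(h)` and `S_δ(z₁ y) z₂ = δ(z) S_δ(y)`. Finally
`τ_n ^ (n + 1)` commutes with all operators, so they restrict to the kernels of `1 - τ_n ^ (n + 1)`,
where the missing relation holds by construction; the cyclic cohomology is that of the resulting
cocyclic object. -/

lemma insert_comp_whiskerLeft (f : 𝟙_ C ⟶ H) {X Y : C} (g : X ⟶ Y) :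
    ((λ_ X).inv ≫ f ▷ X) ≫ H ◁ g = g ≫ (λ_ Y).inv ≫ f ▷ Y := by
  rw [Category.assoc, ← whisker_exchange, leftUnitor_inv_naturality_assoc]

lemma drop_comp (c : H ⟶ 𝟙_ C) {X Y : C} (g : X ⟶ Y) :
    (c ▷ X ≫ (λ_ X).hom) ≫ g = H ◁ g ≫ c ▷ Y ≫ (λ_ Y).hom := by
  rw [whisker_exchange_assoc, Category.assoc, leftUnitor_naturality]

lemma split_comp_whiskerLeft (d : H ⟶ H ⊗ H) {X Y : C} (g : X ⟶ Y) :
    (d ▷ X ≫ (α_ H H X).hom) ≫ H ◁ H ◁ g = H ◁ g ≫ d ▷ Y ≫ (α_ H H Y).hom := by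
  rw [whisker_exchange_assoc]
  simp

lemma whiskerLeft_comp_congr {X Y Y' Z : C} {f : X ⟶ Y} {g : Y ⟶ Z} {f' : X ⟶ Y'} {g' : Y' ⟶ Z}
    (h : f ≫ g = f' ≫ g') : H ◁ f ≫ H ◁ g = H ◁ f' ≫ H ◁ g' := by
  rw [← whiskerLeft_comp, h, whiskerLeft_comp]

lemma whiskerLeft_comp_eq_id {X Y : C} {f : X ⟶ Y} {g : Y ⟶ X} (h : f ≫ g = 𝟙 _) :
    H ◁ f ≫ H ◁ g = 𝟙 _ := by
  rw [← whiskerLeft_comp, h, whiskerLeft_id]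

section Comon

variable [ComonObj H]

/-- Applied both to the unit and to `σ`: group-likeness is what makes the two outer faces compatible
with the inner ones. -/
lemma insert_comul {f : 𝟙_ C ⟶ H} (h : f ≫ ComonObj.comul = (λ_ (𝟙_ C)).inv ≫ (f ⊗ₘ f)) (X : C) :
    ((λ_ X).inv ≫ f ▷ X) ≫ ComonObj.comul ▷ X ≫ (α_ H H X).hom =
      ((λ_ X).inv ≫ f ▷ X) ≫ (λ_ (H ⊗ X)).inv ≫ f ▷ (H ⊗ X) := by
  simp only [Category.assoc]
  rw [← comp_whiskerRight_assoc, h, leftUnitor_inv_naturality_assoc, whisker_exchange,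
    MonoidalCategory.tensorHom_def]
  monoidal

lemma insert_counit {f : 𝟙_ C ⟶ H} (h : f ≫ ComonObj.counit = 𝟙 (𝟙_ C)) (X : C) :
    ((λ_ X).inv ≫ f ▷ X) ≫ ComonObj.counit ▷ X ≫ (λ_ X).hom = 𝟙 _ := by
  rw [Category.assoc, ← comp_whiskerRight_assoc, h]
  simp

lemma split_split (X : C) :
    (ComonObj.comul ▷ X ≫ (α_ H H X).hom) ≫ H ◁ (ComonObj.comul ▷ X ≫ (α_ H H X).hom) =
      (ComonObj.comul ▷ X ≫ (α_ H H X).hom) ≫ ComonObj.comul ▷ (H ⊗ X) ≫ (α_ H H (H ⊗ X)).hom := by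
  have := congrArg (· ▷ X) (ComonObj.comul_assoc H)
  simp only [comp_whiskerRight] at this
  calc
    _ = (ComonObj.comul ▷ X ≫ (H ◁ ComonObj.comul) ▷ X) ⊗≫ 𝟙 _ := by monoidal
    _ = _ := by rw [this]; monoidal

lemma split_drop (X : C) :
    (ComonObj.comul ▷ X ≫ (α_ H H X).hom) ≫ ComonObj.counit ▷ (H ⊗ X) ≫ (λ_ (H ⊗ X)).hom = 𝟙 _ := by
  have := congrArg (· ▷ X) (ComonObj.counit_comul H)
  simp only [comp_whiskerRight] at this
  rw [Category.assoc, ← associator_naturality_left_assoc, reassoc_of% this]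
  monoidal

lemma split_whiskerLeft_drop (X : C) :
    (ComonObj.comul ▷ X ≫ (α_ H H X).hom) ≫ H ◁ (ComonObj.counit ▷ X ≫ (λ_ X).hom) = 𝟙 _ := by
  have := congrArg (· ▷ X) (ComonObj.comul_counit H)
  simp only [comp_whiskerRight] at this
  rw [Category.assoc, whiskerLeft_comp, ← associator_naturality_middle_assoc, reassoc_of% this]
  monoidal

end Comon

/-- The faces of `hopfCyclicData`, indexed by natural numbers. -/
def natCoface (u : 𝟙_ C ⟶ H) (d : H ⟶ H ⊗ H) (σ : 𝟙_ C ⟶ H) :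
    (n : ℕ) → ℕ → (tensorPow H n ⟶ tensorPow H (n + 1))
  | n, 0 => insertFirst u n
  -- The recursion reaches this case with index `1` exactly for the last face, so `σ` ends up in the
  -- last place. Larger indices carry the same value as a default.
  | 0, _ + 1 => insertFirst σ 0
  | n + 1, 1 => d ▷ tensorPow H n ≫ (α_ H H (tensorPow H n)).hom
  | n + 1, i + 2 => H ◁ natCoface u d σ n (i + 1)

/-- The degeneracies of `hopfCyclicData`, indexed by natural numbers. -/
def natCodegen (c : H ⟶ 𝟙_ C) :
    (n : ℕ) → ℕ → (tensorPow H (n + 1) ⟶ tensorPow H n)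
  | n, 0 => c ▷ tensorPow H n ≫ (λ_ (tensorPow H n)).hom
  -- Out of range; a default value only.
  | 0, _ + 1 => c ▷ tensorPow H 0 ≫ (λ_ (tensorPow H 0)).hom
  | n + 1, i + 1 => H ◁ natCodegen c n i

lemma dropAt_eq_natCodegen (c : H ⟶ 𝟙_ C) (n : ℕ) (i : Fin (n + 1)) :
    dropAt c n i = natCodegen c n i := by
  induction n with
  | zero =>
    obtain ⟨i, hi⟩ := i
    obtain rfl : i = 0 := by omega
    rfl
  | succ n ih =>
    obtain ⟨_ | i, hi⟩ := i
    · rfl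
    · exact congrArg (H ◁ ·) (ih ⟨i, by omega⟩)

lemma natCoface_eq_splitAt (u : 𝟙_ C ⟶ H) (d : H ⟶ H ⊗ H) (σ : 𝟙_ C ⟶ H) (n : ℕ)
    (i : ℕ) (hi : i < n) : natCoface u d σ n (i + 1) = splitAt d n ⟨i, hi⟩ := by
  induction n generalizing i with
  | zero => omega
  | succ n ih =>
    obtain _ | i := i
    · rfl
    · exact congrArg (H ◁ ·) (ih i (by omega))

lemma natCoface_eq_insertLast (u : 𝟙_ C ⟶ H) (d : H ⟶ H ⊗ H) (σ : 𝟙_ C ⟶ H) (n : ℕ) :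
    natCoface u d σ n (n + 1) = insertLast σ n := by
  induction n with
  | zero => rfl
  | succ n ih => exact congrArg (H ◁ ·) ih

lemma natCodegen_comp (c : H ⟶ 𝟙_ C) (n : ℕ) {i j : ℕ} (h : i ≤ j) (hj : j < n + 1) :
    natCodegen c (n + 1) i ≫ natCodegen c n j =
      natCodegen c (n + 1) (j + 1) ≫ natCodegen c n i := by
  induction n generalizing i j with
  | zero =>
    obtain rfl : j = 0 := by omega
    obtain rfl : i = 0 := by omega
    exact drop_comp c (natCodegen c 0 0)
  | succ n ih =>
    obtain _ | i := i
    · exact drop_comp c (natCodegen c (n + 1) j)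
    · obtain _ | j := j
      · omega
      · exact whiskerLeft_comp_congr (ih (i := i) (j := j) (by omega) (by omega))

section Relations

variable [ComonObj H] {u σ : 𝟙_ C ⟶ H}

/-- Common leading factors are stripped until one of the two faces meets the first factor. There
either the faces act on disjoint factors and the interchange law applies, or both meet the same
factor and the reason is coassociativity or group-likeness. -/
lemma natCoface_comp (hu : u ≫ ComonObj.comul = (λ_ (𝟙_ C)).inv ≫ (u ⊗ₘ u))
    (hσ : σ ≫ ComonObj.comul = (λ_ (𝟙_ C)).inv ≫ (σ ⊗ₘ σ)) (n : ℕ) {i j : ℕ} (h : i ≤ j)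
    (hj : j < n + 2) :
    natCoface u ComonObj.comul σ n i ≫ natCoface u ComonObj.comul σ (n + 1) (j + 1) =
      natCoface u ComonObj.comul σ n j ≫ natCoface u ComonObj.comul σ (n + 1) i := by
  induction n generalizing i j with
  | zero =>
    obtain rfl | rfl : j = 0 ∨ j = 1 := by omega
    · obtain rfl : i = 0 := by omega
      exact insert_comul hu _
    · obtain rfl | rfl : i = 0 ∨ i = 1 := by omega
      · exact insert_comp_whiskerLeft u _
      -- In degree `0` the last face inserts `σ` first; both sides insert `σ` twice.
      · exact (insert_comp_whiskerLeft σ _).trans (insert_comul hσ _).symm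
  | succ n ih =>
    obtain _ | _ | i := i
    · obtain _ | j := j
      · exact insert_comul hu _
      · exact insert_comp_whiskerLeft u _
    · obtain _ | _ | j := j
      · omega
      · exact split_split (tensorPow H n)
      · exact split_comp_whiskerLeft ComonObj.comul (natCoface u ComonObj.comul σ n (j + 1))
    · obtain _ | _ | j := j
      · omega
      · omega
      · exact whiskerLeft_comp_congr (ih (i := i + 1) (j := j + 1) (by omega) (by omega))

lemma natCoface_natCodegen_of_le (c : H ⟶ 𝟙_ C) (n : ℕ) {i j : ℕ} (h : i ≤ j) (hj : j < n + 1) :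
    natCoface u ComonObj.comul σ (n + 1) i ≫ natCodegen c (n + 1) (j + 1) =
      natCodegen c n j ≫ natCoface u ComonObj.comul σ n i := by
  induction n generalizing i j with
  | zero =>
    obtain rfl : j = 0 := by omega
    obtain rfl : i = 0 := by omega
    exact insert_comp_whiskerLeft u (natCodegen c 0 0)
  | succ n ih =>
    obtain _ | _ | i := i
    · exact insert_comp_whiskerLeft u (natCodegen c (n + 1) j)
    · obtain _ | j := j
      · omega
      · exact split_comp_whiskerLeft ComonObj.comul (natCodegen c n j)
    · obtain _ | j := j
      · omega
      · exact whiskerLeft_comp_congr (ih (i := i + 1) (j := j) (by omega) (by omega))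

lemma natCoface_natCodegen_self (hu : u ≫ ComonObj.counit = 𝟙 (𝟙_ C)) (n : ℕ) {i : ℕ}
    (hi : i < n + 1) :
    natCoface u ComonObj.comul σ n i ≫ natCodegen ComonObj.counit n i = 𝟙 _ := by
  induction n generalizing i with
  | zero =>
    obtain rfl : i = 0 := by omega
    exact insert_counit hu _
  | succ n ih =>
    obtain _ | _ | i := i
    · exact insert_counit hu _
    · obtain _ | n := n
      · exact split_whiskerLeft_drop (tensorPow H 0)
      · exact split_whiskerLeft_drop (tensorPow H (n + 1))
    · exact whiskerLeft_comp_eq_id (ih (i := i + 1) (by omega))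

lemma natCoface_natCodegen_succ (hσ : σ ≫ ComonObj.counit = 𝟙 (𝟙_ C)) (n : ℕ) {i : ℕ}
    (hi : i < n + 1) :
    natCoface u ComonObj.comul σ n (i + 1) ≫ natCodegen ComonObj.counit n i = 𝟙 _ := by
  induction n generalizing i with
  | zero =>
    obtain rfl : i = 0 := by omega
    exact insert_counit hσ _
  | succ n ih =>
    obtain _ | i := i
    · exact split_drop (tensorPow H n)
    · exact whiskerLeft_comp_eq_id (ih (i := i) (by omega))

lemma natCoface_natCodegen_of_gt (c : H ⟶ 𝟙_ C) (n : ℕ) {i j : ℕ} (h : j < i) (hi : i < n + 2) :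
    natCoface u ComonObj.comul σ (n + 1) (i + 1) ≫ natCodegen c (n + 1) j =
      natCodegen c n j ≫ natCoface u ComonObj.comul σ n i := by
  induction n generalizing i j with
  | zero =>
    obtain rfl : i = 1 := by omega
    obtain rfl : j = 0 := by omega
    exact (drop_comp c (natCoface u ComonObj.comul σ 0 1)).symm
  | succ n ih =>
    obtain _ | i := i
    · omega
    obtain _ | j := j
    · exact (drop_comp c (natCoface u ComonObj.comul σ (n + 1) (i + 1))).symm
    · obtain _ | i := i
      · omega
      · exact whiskerLeft_comp_congr (ih (i := i + 1) (j := j) (by omega) (by omega))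

end Relations

end Cosimplicial

/-! ### Faces and degeneracies as algebra maps of tensor powers -/

section Bimon

variable {C : Type u} [Category.{v} C] [MonoidalCategory C] [BraidedCategory C] {H : C}

/-- The tensor power algebras, with the multiplication `mulPow`. -/
instance tensorPowMon (H : C) [MonObj H] : (n : ℕ) → MonObj (tensorPow H n)
  | 0 => inferInstanceAs (MonObj (𝟙_ C))
  | n + 1 =>
    letI := tensorPowMon H n
    inferInstanceAs (MonObj (H ⊗ tensorPow H n))

lemma mulPow_eq (H : C) [MonObj H] (n : ℕ) : mulPow H n = MonObj.mul := by
  induction n with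
  | zero => rfl
  | succ n ih =>
    exact congrArg (fun f => tensorμ H (tensorPow H n) H (tensorPow H n) ≫ (MonObj.mul ⊗ₘ f)) ih

variable [BimonObj H]

instance isMonHom_comul : IsMonHom (ComonObj.comul : H ⟶ H ⊗ H) where
  one_hom := BimonObj.one_comul H
  mul_hom := BimonObj.mul_comul H

instance isMonHom_counit : IsMonHom (ComonObj.counit : H ⟶ 𝟙_ C) where
  one_hom := BimonObj.one_counit H
  mul_hom := Bimon.mul_counit H

lemma isMonHom_whiskerLeft {X Y Z : C} [MonObj X] [MonObj Y] [MonObj Z] (f : Y ⟶ Z) [IsMonHom f] :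
    IsMonHom (X ◁ f) := by
  rw [← id_tensorHom]
  infer_instance

lemma isMonHom_whiskerRight {X Y Z : C} [MonObj X] [MonObj Y] [MonObj Z] (f : Y ⟶ Z) [IsMonHom f] :
    IsMonHom (f ▷ X) := by
  rw [← tensorHom_id]
  infer_instance

lemma isMonHom_split (X : C) [MonObj X] :
    IsMonHom (ComonObj.comul ▷ X ≫ (α_ H H X).hom) := by
  have := isMonHom_whiskerRight (X := X) (ComonObj.comul : H ⟶ H ⊗ H)
  infer_instance

lemma isMonHom_drop (X : C) [MonObj X] :
    IsMonHom (ComonObj.counit (X := H) ▷ X ≫ (λ_ X).hom) := by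
  have := isMonHom_whiskerRight (X := X) (ComonObj.counit : H ⟶ 𝟙_ C)
  infer_instance

/-- Restricted to the inner faces, which only involve the algebra map `Δ`; they may therefore be
moved through the product in the definition of `τ`. -/
lemma isMonHom_natCoface (u σ : 𝟙_ C ⟶ H) (n : ℕ) {i : ℕ} (hi : i < n) :
    IsMonHom (natCoface u ComonObj.comul σ n (i + 1)) := by
  induction n generalizing i with
  | zero => omega
  | succ n ih =>
    obtain _ | i := i
    · exact isMonHom_split (tensorPow H n)
    · have := ih (i := i) (by omega)
      exact isMonHom_whiskerLeft (X := H) (natCoface u ComonObj.comul σ n (i + 1))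

lemma isMonHom_natCodegen (n : ℕ) {i : ℕ} (hi : i < n + 1) :
    IsMonHom (natCodegen (H := H) ComonObj.counit n i) := by
  induction n generalizing i with
  | zero =>
    obtain rfl : i = 0 := by omega
    exact isMonHom_drop (tensorPow H 0)
  | succ n ih =>
    obtain _ | i := i
    · exact isMonHom_drop (tensorPow H (n + 1))
    · have := ih (i := i) (by omega)
      exact isMonHom_whiskerLeft (X := H) (natCodegen ComonObj.counit n i)

/-- Needed when two cyclic operators are composed: the second one applies `Δ^n S_δ` to a product. -/
lemma isMonHom_iterComul (n : ℕ) : IsMonHom (iterComul H n) := by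
  induction n with
  | zero => exact inferInstanceAs (IsMonHom (ρ_ H).inv)
  | succ n ih =>
    have := isMonHom_whiskerLeft (X := H) (iterComul H n)
    exact inferInstanceAs (IsMonHom (ComonObj.comul ≫ H ◁ iterComul H n))

end Bimon

end BraidedHopf

/-! ### Iterated comultiplication and passage of algebra maps through products -/

namespace BraidedHopf

open MonoidalCategory

variable {C : Type u} [Category.{v} C] [MonoidalCategory C]

section IterComul

variable {H : C} [ComonObj H]

/-- Generalised coassociativity: all ways of splitting one factor of `Δ^n` agree. The induction
starts with the unit constraint, since the tensor powers end in the tensor unit. -/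
lemma iterComul_natCoface (u σ : 𝟙_ C ⟶ H) (n : ℕ) {j : ℕ} (hj : j < n + 1) :
    iterComul H n ≫ natCoface u ComonObj.comul σ (n + 1) (j + 1) = iterComul H (n + 1) := by
  have key {X : C} (f : H ⟶ X) :
      (ComonObj.comul ≫ H ◁ f) ≫ ComonObj.comul ▷ X ≫ (α_ H H X).hom =
        ComonObj.comul ≫ H ◁ (ComonObj.comul ≫ H ◁ f) := by
    rw [Category.assoc, whisker_exchange_assoc, whiskerLeft_comp, ComonObj.comul_assoc_assoc]
    simp
  induction n generalizing j with
  | zero =>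
    obtain rfl : j = 0 := by omega
    change (ρ_ H).inv ≫ ComonObj.comul ▷ 𝟙_ C ≫ (α_ H H (𝟙_ C)).hom =
      ComonObj.comul ≫ H ◁ (ρ_ H).inv
    rw [← rightUnitor_inv_naturality_assoc]
    simp
  | succ n ih =>
    obtain _ | j := j
    · exact key (iterComul H n)
    · have := ih (j := j) (by omega)
      change (ComonObj.comul ≫ H ◁ iterComul H n) ≫
        H ◁ natCoface u ComonObj.comul σ (n + 1) (j + 1) =
        ComonObj.comul ≫ H ◁ iterComul H (n + 1)
      rw [Category.assoc, ← whiskerLeft_comp, this]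

lemma iterComul_natCodegen (n : ℕ) {j : ℕ} (hj : j < n + 2) :
    iterComul H (n + 1) ≫ natCodegen ComonObj.counit (n + 1) j = iterComul H n := by
  have key {X : C} (f : H ⟶ X) :
      (ComonObj.comul ≫ H ◁ f) ≫ ComonObj.counit ▷ X ≫ (λ_ X).hom = f := by
    rw [Category.assoc, whisker_exchange_assoc, ComonObj.counit_comul_assoc]
    simp
  induction n generalizing j with
  | zero =>
    obtain rfl | rfl : j = 0 ∨ j = 1 := by omega
    · exact key (iterComul H 0)
    · change (ComonObj.comul ≫ H ◁ (ρ_ H).inv) ≫ H ◁ (ComonObj.counit ▷ 𝟙_ C ≫ (λ_ (𝟙_ C)).hom) =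
        (ρ_ H).inv
      rw [Category.assoc, ← whiskerLeft_comp, ← rightUnitor_inv_naturality_assoc]
      simp [unitors_equal]
  | succ n ih =>
    obtain _ | j := j
    · exact key (iterComul H (n + 1))
    · have := ih (j := j) (by omega)
      change (ComonObj.comul ≫ H ◁ iterComul H (n + 1)) ≫ H ◁ natCodegen ComonObj.counit (n + 1) j =
        ComonObj.comul ≫ H ◁ iterComul H n
      rw [Category.assoc, ← whiskerLeft_comp, this]

end IterComul

lemma tensorHom_mul_comp {X Y A B : C} [MonObj A] [MonObj B] (f : X ⟶ A) (g : Y ⟶ A) (h : A ⟶ B)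
    [IsMonHom h] : (f ⊗ₘ g) ≫ MonObj.mul ≫ h = ((f ≫ h) ⊗ₘ (g ≫ h)) ≫ MonObj.mul := by
  rw [IsMonHom.mul_hom, tensorHom_comp_tensorHom_assoc]

/-- The common shape of the relations between `τ` and an operator `X ◁ c` that leaves the first
factor alone: the algebra map `p` on the target passes through the product and changes the two
factors separately. -/
lemma whiskerLeft_comp_tensorHom_mul {A B X Y Z : C} [MonObj A] [MonObj B] {f : X ⟶ A} {g : Y ⟶ A}
    {p : A ⟶ B} [IsMonHom p] {f' : X ⟶ B} {c : Y ⟶ Z} {g' : Z ⟶ B} (h : f ≫ p = f')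
    (h' : g ≫ p = c ≫ g') :
    X ◁ c ≫ (f' ⊗ₘ g') ≫ MonObj.mul = ((f ⊗ₘ g) ≫ MonObj.mul) ≫ p := by
  rw [Category.assoc, tensorHom_mul_comp, h, h', ← id_tensorHom, tensorHom_comp_tensorHom_assoc,
    Category.id_comp]

lemma tensorHom_mul_comp_eq {A B X Y : C} [MonObj A] [MonObj B] {f : X ⟶ A} {g : Y ⟶ A}
    {p : A ⟶ B} [IsMonHom p] {f' : X ⟶ B} {g' : Y ⟶ B} (h : f ≫ p = f') (h' : g ≫ p = g') :
    ((f ⊗ₘ g) ≫ MonObj.mul) ≫ p = (f' ⊗ₘ g') ≫ MonObj.mul := by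
  rw [Category.assoc, tensorHom_mul_comp, h, h']

/-! ### The twisted antipode -/

section Cyclic

open scoped MonObj ComonObj HopfObj

variable [BraidedCategory C] {H : C} [HopfObj H]

/-- Convolution of the identity with a character. -/
def charShift (δ : H ⟶ 𝟙_ C) : H ⟶ H := ComonObj.comul ≫ δ ▷ H ≫ (λ_ H).hom

lemma twistedAntipode_eq (δ : H ⟶ 𝟙_ C) :
    twistedAntipode δ = charShift δ ≫ HopfObj.antipode := by
  simp [twistedAntipode, charShift, MonoidalCategory.tensorHom_def]

/-- Coassociativity: `δ(h₁) h₂ ⊗ h₃` arises in both orders, so the shift only touches the first leg.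
-/
lemma charShift_comul (δ : H ⟶ 𝟙_ C) :
    charShift δ ≫ ComonObj.comul = ComonObj.comul ≫ charShift δ ▷ H := by
  have := ComonObj.comul_assoc H
  simp only [charShift, Category.assoc, comp_whiskerRight]
  rw [← leftUnitor_naturality, ← whisker_exchange_assoc, reassoc_of% this]
  simp

/-- The antipode reverses the comultiplication and `charShift δ` touches only the first leg before
the reversal; hence the character survives only in the second leg after it, `Δ S_δ(h) = S(h₂) ⊗
S_δ(h₁)` up to braiding. -/
lemma twistedAntipode_comul (δ : H ⟶ 𝟙_ C) :
    twistedAntipode δ ≫ ComonObj.comul =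
      ComonObj.comul ≫ (β_ H H).hom ≫ (HopfObj.antipode ⊗ₘ twistedAntipode δ) := by
  have h : ((HopfObj.antipode : H ⟶ H) ⊗ₘ twistedAntipode δ) =
      H ◁ charShift δ ≫ (HopfObj.antipode ⊗ₘ HopfObj.antipode) := by
    rw [twistedAntipode_eq]
    simp [MonoidalCategory.tensorHom_def, ← whisker_exchange_assoc]
  rw [h, ← BraidedCategory.braiding_naturality_left_assoc, ← Category.assoc,
    ← charShift_comul, Category.assoc, twistedAntipode_eq, Category.assoc, HopfObj.antipode_comul]

lemma charShift_counit (δ : H ⟶ 𝟙_ C) : charShift δ ≫ ComonObj.counit = δ := by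
  rw [charShift, Category.assoc, Category.assoc, ← leftUnitor_naturality, ← whisker_exchange_assoc,
    ComonObj.comul_counit_assoc, ← rightUnitor_inv_naturality_assoc]
  simp [unitors_equal]

/-- By colinearity of `charShift δ`, the sum `S_δ(h₁) h₂` is the ordinary antipode axiom applied to
the shifted element, whose counit is `δ(h)`. -/
lemma comul_twistedAntipode_mul (δ : H ⟶ 𝟙_ C) :
    ComonObj.comul ≫ twistedAntipode δ ▷ H ≫ MonObj.mul = δ ≫ MonObj.one := by
  rw [twistedAntipode_eq, comp_whiskerRight, Category.assoc, ← Category.assoc,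
    ← charShift_comul, Category.assoc, HopfObj.antipode_left, ← Category.assoc, charShift_counit]

variable {δ : H ⟶ 𝟙_ C}

lemma IsCharacter.isMonHom (h : IsCharacter δ) : IsMonHom δ := ⟨h.one, h.mul⟩

lemma IsCharacter.isMonHom_charShift (h : IsCharacter δ) : IsMonHom (charShift δ) := by
  have := h.isMonHom
  have := isMonHom_whiskerRight (X := H) δ
  unfold charShift
  infer_instance

lemma IsCharacter.one_twistedAntipode (h : IsCharacter δ) :
    MonObj.one ≫ twistedAntipode δ = MonObj.one := by
  have := h.isMonHom_charShift
  rw [twistedAntipode_eq, IsMonHom.one_hom_assoc, HopfObj.one_antipode]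

/-- `S_δ` is the algebra map `charShift δ` followed by the braided anti-multiplicative antipode. -/
lemma IsCharacter.mul_twistedAntipode (h : IsCharacter δ) :
    MonObj.mul ≫ twistedAntipode δ =
      (β_ H H).hom ≫ (twistedAntipode δ ⊗ₘ twistedAntipode δ) ≫ MonObj.mul := by
  have := h.isMonHom_charShift
  rw [twistedAntipode_eq, IsMonHom.mul_hom_assoc, HopfObj.mul_antipode]
  simp

/-- `δ(h₁) δ(S h₂) = δ(h₁ S(h₂)) = ε(h)`, because `δ` is multiplicative. -/
lemma IsCharacter.twistedAntipode_comp (h : IsCharacter δ) :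
    twistedAntipode δ ≫ δ = ComonObj.counit := by
  have := h.isMonHom
  have e : twistedAntipode δ ≫ δ = Δ[H] ≫ H ◁ 𝒮[H] ≫ μ[H] ≫ δ := by
    rw [h.mul, twistedAntipode, Category.assoc, Category.assoc, ← leftUnitor_naturality,
      MonoidalCategory.tensorHom_def, MonoidalCategory.tensorHom_def]
    simp only [Category.assoc, whisker_exchange_assoc]
  rw [e, HopfObj.antipode_right_assoc, h.one, Category.comp_id]

lemma twistedAntipode_counit (δ : H ⟶ 𝟙_ C) : twistedAntipode δ ≫ ComonObj.counit = δ := by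
  rw [twistedAntipode_eq, Category.assoc, HopfObj.antipode_counit, charShift_counit]

/-- `z ⊗ y ↦ z₁ y ⊗ z₂`, where `z₂` is moved past `y` by the braiding. -/
def comulMul (H : C) [BimonObj H] : H ⊗ H ⟶ H ⊗ H :=
  ComonObj.comul ▷ H ≫ (α_ H H H).hom ≫ H ◁ (β_ H H).hom ≫ (α_ H H H).inv ≫ MonObj.mul ▷ H

/-- After reversing the comultiplication of `S_δ(h₁)`, the first leg becomes `S(h₂) h₃`, which the
antipode axiom collapses; `S_δ(h₁)` is left in the second leg. This is the core of the relation
between `δ_1`, `τ` and `δ_0`. -/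
lemma comul_comulMul (δ : H ⟶ 𝟙_ C) :
    ComonObj.comul ≫ twistedAntipode δ ▷ H ≫ comulMul H =
      twistedAntipode δ ≫ (λ_ H).inv ≫ MonObj.one ▷ H := by
  have h1 : ComonObj.comul ≫ twistedAntipode δ ▷ H ≫ comulMul H =
      ComonObj.comul ≫ H ◁ ComonObj.comul ≫ (β_ H (H ⊗ H)).hom ≫
        (HopfObj.antipode ▷ H) ▷ H ≫ MonObj.mul ▷ H ≫ H ◁ twistedAntipode δ := by
    rw [comulMul, ← comp_whiskerRight_assoc, twistedAntipode_comul,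
      BraidedCategory.braiding_tensor_right_hom, ComonObj.comul_assoc_assoc]
    simp only [MonoidalCategory.tensorHom_def, comp_whiskerRight, Category.assoc,
      Iso.hom_inv_id_assoc]
    calc
      _ = Δ[H] ⊗≫ Δ[H] ▷ H ⊗≫ (β_ H H).hom ▷ H ⊗≫
          𝒮[H] ▷ H ▷ H ⊗≫ H ◁ (twistedAntipode δ ▷ H ≫ (β_ H H).hom) ⊗≫ μ[H] ▷ H := by monoidal
      _ = Δ[H] ⊗≫ Δ[H] ▷ H ⊗≫ (β_ H H).hom ▷ H ⊗≫
          (𝒮[H] ▷ (H ⊗ H) ≫ H ◁ (β_ H H).hom) ⊗≫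
            ((H ⊗ H) ◁ twistedAntipode δ ≫ μ[H] ▷ H) := by
        rw [BraidedCategory.braiding_naturality_left]; monoidal
      _ = _ := by
        rw [← whisker_exchange 𝒮[H], whisker_exchange μ[H]]; monoidal
  -- The two legs that are to cancel cross the remaining one together, so naturality of the braiding
  -- lets the antipode axiom act before the crossing.
  have h2 : H ◁ Δ[H] ≫ (β_ H (H ⊗ H)).hom ≫ (𝒮[H] ▷ H) ▷ H ≫ μ[H] ▷ H =
      H ◁ (Δ[H] ≫ 𝒮[H] ▷ H ≫ μ[H]) ≫ (β_ H H).hom := by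
    simp only [whiskerLeft_comp, Category.assoc, BraidedCategory.braiding_naturality_right]
    simp only [BraidedCategory.braiding_naturality_right_assoc]
  rw [h1, reassoc_of% h2, HopfObj.antipode_left, whiskerLeft_comp, Category.assoc,
    ComonObj.comul_counit_assoc, BraidedCategory.braiding_naturality_right_assoc,
    braiding_tensorUnit_right, ← whisker_exchange]
  simp

/-- For any `z`, anti-multiplicativity gives `S_δ(z₁ y) z₂ = S_δ(y) S_δ(z₁) z₂ = S_δ(y) δ(z)` up to
braiding; for `z = S_δ(x)` the scalar is `δ(S_δ x) = ε(x)`. This is the core of the relation for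
`τ²` and the last degeneracy. -/
lemma IsCharacter.comulMul_twistedAntipode (h : IsCharacter δ) :
    twistedAntipode δ ▷ H ≫ comulMul H ≫ twistedAntipode δ ▷ H ≫ MonObj.mul =
      (ComonObj.counit ⊗ₘ twistedAntipode δ) ≫ (λ_ H).hom := by
  have h1 : comulMul H ≫ twistedAntipode δ ▷ H ≫ μ[H] =
      (β_ H H).hom ≫ H ◁ (Δ[H] ≫ twistedAntipode δ ▷ H ≫ μ[H]) ≫ twistedAntipode δ ▷ H ≫ μ[H] := by
    have e := congrArg (· ▷ H) h.mul_twistedAntipode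
    simp only [comp_whiskerRight] at e
    simp only [comulMul, Category.assoc, whiskerLeft_comp]
    rw [reassoc_of% e, ← BraidedCategory.braiding_naturality_left_assoc,
      BraidedCategory.braiding_tensor_left_hom]
    calc
      _ = Δ[H] ▷ H ⊗≫ H ◁ (β_ H H).hom ⊗≫ (β_ H H).hom ▷ H ⊗≫
          (twistedAntipode δ ⊗ₘ twistedAntipode δ) ▷ H ⊗≫ (μ[H] ▷ H ≫ μ[H]) := by monoidal
      _ = Δ[H] ▷ H ⊗≫ H ◁ (β_ H H).hom ⊗≫ (β_ H H).hom ▷ H ⊗≫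
          twistedAntipode δ ▷ (H ⊗ H) ⊗≫ H ◁ twistedAntipode δ ▷ H ⊗≫ H ◁ μ[H] ≫ μ[H] := by
        rw [MonObj.mul_assoc, MonoidalCategory.tensorHom_def]; monoidal
      _ = Δ[H] ▷ H ⊗≫ H ◁ (β_ H H).hom ⊗≫ (β_ H H).hom ▷ H ⊗≫
          (twistedAntipode δ ▷ (H ⊗ H) ≫ H ◁ (twistedAntipode δ ▷ H ≫ μ[H])) ⊗≫ μ[H] := by
        monoidal
      _ = _ := by
        rw [← whisker_exchange]; monoidal
  rw [h1, comul_twistedAntipode_mul, whiskerLeft_comp, Category.assoc, whisker_exchange_assoc,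
    MonObj.mul_one, BraidedCategory.braiding_naturality_left_assoc, ← whiskerLeft_comp_assoc,
    h.twistedAntipode_comp, ← BraidedCategory.braiding_naturality_left_assoc,
    braiding_tensorUnit_left, MonoidalCategory.tensorHom_def]
  simp

/-! ### The cyclic operator on the first two factors -/

section Operators

variable {T T' : C} [MonObj T'] (D : H ⟶ T') (s : T ⟶ T')

/-- Naturality of the braiding moves `D` past the second factor. The effect of a cyclic operator on
the first two factors is thereby isolated in `comulMul`; `D` plays the role of `Δ^n` and `s` that of
inserting `σ` last. -/
lemma comulMul_tensor (f : H ⟶ H) :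
    ((f ≫ Δ[H] ≫ H ◁ D) ⊗ₘ H ◁ s) ≫ μ[H ⊗ T'] =
      (α_ H H T).inv ≫ (f ▷ H ≫ comulMul H) ▷ T ≫ (α_ H H T).hom ≫ H ◁ ((D ⊗ₘ s) ≫ μ[T']) := by
  simp only [MonObj.tensorObj.mul_def, tensorμ, comulMul]
  calc
    _ = f ▷ (H ⊗ T) ≫ Δ[H] ▷ (H ⊗ T) ⊗≫ H ◁ D ▷ (H ⊗ T) ⊗≫
        H ◁ ((T' ⊗ H) ◁ s ≫ (β_ T' H).hom ▷ T') ⊗≫ μ[H] ▷ (T' ⊗ T') ≫ H ◁ μ[T'] := by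
      rw [MonoidalCategory.tensorHom_def, MonoidalCategory.tensorHom_def]; monoidal
    _ = f ▷ (H ⊗ T) ≫ Δ[H] ▷ (H ⊗ T) ⊗≫ H ◁ (D ▷ H ≫ (β_ T' H).hom) ▷ T ⊗≫
        ((H ⊗ H) ◁ (T' ◁ s) ≫ μ[H] ▷ (T' ⊗ T')) ≫ H ◁ μ[T'] := by
      rw [whisker_exchange (β_ T' H).hom s]; monoidal
    _ = f ▷ (H ⊗ T) ≫ Δ[H] ▷ (H ⊗ T) ⊗≫ H ◁ (β_ H H).hom ▷ T ⊗≫ ((H ⊗ H) ◁ D ≫ μ[H] ▷ T') ▷ T ⊗≫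
        H ◁ T' ◁ s ≫ H ◁ μ[T'] := by
      rw [whisker_exchange μ[H], BraidedCategory.braiding_naturality_left]; monoidal
    _ = _ := by
      rw [whisker_exchange μ[H] D, MonoidalCategory.tensorHom_def]; monoidal

/-- With the first two factors isolated, `comul_comulMul` produces a unit in the first place and
leaves a cyclic operator one degree lower. -/
lemma split_comp_cyclic (δ : H ⟶ 𝟙_ C) :
    (Δ[H] ▷ T ≫ (α_ H H T).hom) ≫ ((twistedAntipode δ ≫ Δ[H] ≫ H ◁ D) ⊗ₘ H ◁ s) ≫ μ[H ⊗ T'] =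
      ((twistedAntipode δ ≫ D) ⊗ₘ s) ≫ μ[T'] ≫ (λ_ T').inv ≫ η[H] ▷ T' := by
  have e := congrArg (· ▷ T) (comul_comulMul δ)
  simp only [comp_whiskerRight] at e
  rw [comulMul_tensor]
  simp only [Category.assoc, Iso.hom_inv_id_assoc, comp_whiskerRight]
  rw [reassoc_of% e, associator_naturality_left_assoc, ← whisker_exchange,
    leftUnitor_inv_naturality_assoc, leftUnitor_inv_naturality_assoc]
  simp [MonoidalCategory.tensorHom_def]

/-- Because `D` and the product are multiplicative and associative, the second operator meets the
first only through `S_δ(z₁ y) z₂` inside `D`, so `comulMul_twistedAntipode` applies. The second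
factor carries no `σ`, as it has been removed by the last degeneracy. -/
lemma IsCharacter.cyclic_comp_cyclic (h : IsCharacter δ) [IsMonHom D] :
    (((twistedAntipode δ ≫ Δ[H] ≫ H ◁ D) ⊗ₘ H ◁ s) ≫ μ[H ⊗ T']) ≫
        ((twistedAntipode δ ≫ D) ⊗ₘ 𝟙 T') ≫ μ[T'] =
      (ε[H] ▷ (H ⊗ T) ≫ (λ_ (H ⊗ T)).hom) ≫ ((twistedAntipode δ ≫ D) ⊗ₘ s) ≫ μ[T'] := by
  have e : ((twistedAntipode δ ≫ D) ⊗ₘ D) ≫ μ[T'] = twistedAntipode δ ▷ H ≫ μ[H] ≫ D := by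
    rw [IsMonHom.mul_hom, ← tensorHom_id, tensorHom_comp_tensorHom_assoc, Category.id_comp]
  have e' : H ◁ ((D ⊗ₘ s) ≫ μ[T']) ≫ ((twistedAntipode δ ≫ D) ⊗ₘ 𝟙 T') ≫ μ[T'] =
      (α_ H H T).inv ≫ ((((twistedAntipode δ ≫ D) ⊗ₘ D) ≫ μ[T']) ⊗ₘ s) ≫ μ[T'] := by
    rw [← id_tensorHom, tensorHom_comp_tensorHom_assoc, Category.id_comp, Category.comp_id]
    have e'' : ((((twistedAntipode δ ≫ D) ⊗ₘ D) ≫ μ[T']) ⊗ₘ s) ≫ μ[T'] =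
        (((twistedAntipode δ ≫ D) ⊗ₘ D) ⊗ₘ s) ≫ μ[T'] ▷ T' ≫ μ[T'] := by
      rw [← tensorHom_id, tensorHom_comp_tensorHom_assoc, Category.comp_id]
    rw [e'', MonObj.mul_assoc, associator_naturality_assoc, Iso.inv_hom_id_assoc, ← id_tensorHom,
      tensorHom_comp_tensorHom_assoc, Category.comp_id]
  have e3 : ((twistedAntipode δ ▷ H ≫ comulMul H) ▷ T) ≫
        ((((twistedAntipode δ ≫ D) ⊗ₘ D) ≫ μ[T']) ⊗ₘ s) =
      ((ε[H] ⊗ₘ twistedAntipode δ) ≫ (λ_ H).hom ≫ D) ⊗ₘ s := by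
    rw [← tensorHom_id, tensorHom_comp_tensorHom, Category.id_comp, e, Category.assoc,
      ← Category.assoc (twistedAntipode δ ▷ H) μ[H] D, ← Category.assoc (comulMul H),
      ← Category.assoc (twistedAntipode δ ▷ H) _ D, h.comulMul_twistedAntipode, Category.assoc]
  rw [comulMul_tensor]
  simp only [Category.assoc]
  rw [e', Iso.hom_inv_id_assoc, reassoc_of% e3]
  simp only [MonoidalCategory.tensorHom_def, comp_whiskerRight, Category.assoc]
  monoidal

lemma one_comp_cyclic (h : IsCharacter δ) [IsMonHom D] :
    ((λ_ T).inv ≫ η[H] ▷ T) ≫ ((twistedAntipode δ ≫ D) ⊗ₘ s) ≫ μ[T'] = s := by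
  rw [Category.assoc, ← tensorHom_id, tensorHom_comp_tensorHom_assoc, Category.id_comp,
    reassoc_of% h.one_twistedAntipode, IsMonHom.one_hom, MonoidalCategory.tensorHom_def',
    Category.assoc, MonObj.one_mul]
  simp

end Operators

/-! ### Relations between `τ` and the faces and degeneracies -/

section CyclicOperators

variable {σ : 𝟙_ C ⟶ H}

lemma hopfCyc_succ (n : ℕ) :
    hopfCyc δ σ (n + 1) = ((twistedAntipode δ ≫ iterComul H n) ⊗ₘ insertLast σ n) ≫
      (μ : tensorPow H (n + 1) ⊗ tensorPow H (n + 1) ⟶ tensorPow H (n + 1)) := by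
  rw [← mulPow_eq]
  rfl

lemma hopfCoface_eq (n : ℕ) (i : Fin (n + 2)) :
    hopfCoface σ n i = natCoface η[H] Δ[H] σ n i := by
  obtain ⟨i, hi⟩ := i
  obtain _ | i := i
  · cases n <;> rfl
  · rw [hopfCoface, if_neg (by simp)]
    by_cases h : i < n
    · rw [dif_pos (by simpa using h)]
      exact (natCoface_eq_splitAt _ _ _ n i h).symm
    · rw [dif_neg (by simpa using h)]
      obtain rfl : i = n := by omega
      exact (natCoface_eq_insertLast _ _ _ i).symm

/-- Faces beyond the first factor: on the target the shifted face is an algebra map, absorbed by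
`Δ^n` in one factor and moved past `σ` in the other. -/
lemma natCoface_hopfCyc (n : ℕ) {i : ℕ} (hi : i < n + 1)
    (hσ : σ ≫ Δ[H] = (λ_ (𝟙_ C)).inv ≫ (σ ⊗ₘ σ)) :
    natCoface η[H] Δ[H] σ (n + 1) (i + 2) ≫ hopfCyc δ σ (n + 2) =
      hopfCyc δ σ (n + 1) ≫ natCoface η[H] Δ[H] σ (n + 1) (i + 1) := by
  have := isMonHom_natCoface η σ (n + 1) hi
  rw [hopfCyc_succ, hopfCyc_succ]
  refine whiskerLeft_comp_tensorHom_mul (p := natCoface η[H] Δ[H] σ (n + 1) (i + 1)) ?_ ?_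
  · rw [Category.assoc, iterComul_natCoface _ _ _ hi]
  · rw [← natCoface_eq_insertLast η[H] Δ[H], ← natCoface_eq_insertLast η[H] Δ[H]]
    -- A cosimplicial relation with the last face. For `i = n` it says that splitting `σ` inserts it
    -- twice, so the outer face `δ_{n+2}` is covered as well.
    exact (natCoface_comp (Bimon.one_comul H) hσ n (by omega) (by omega)).symm

lemma natCodegen_hopfCyc (n : ℕ) {i : ℕ} (hi : i < n + 1) :
    natCodegen ε[H] (n + 1) (i + 1) ≫ hopfCyc δ σ (n + 1) =
      hopfCyc δ σ (n + 2) ≫ natCodegen ε[H] (n + 1) i := by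
  have := isMonHom_natCodegen (H := H) (n + 1) (i := i) (by omega)
  rw [hopfCyc_succ, hopfCyc_succ]
  refine whiskerLeft_comp_tensorHom_mul (p := natCodegen ε[H] (n + 1) i) ?_ ?_
  · rw [Category.assoc, iterComul_natCodegen _ (by omega)]
  · rw [← natCoface_eq_insertLast η[H] Δ[H], ← natCoface_eq_insertLast η[H] Δ[H]]
    exact natCoface_natCodegen_of_gt _ n (by omega) (by omega)

lemma insertFirst_hopfCyc (h : IsCharacter δ) (n : ℕ) :
    insertFirst η[H] n ≫ hopfCyc δ σ (n + 1) = insertLast σ n := by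
  have := isMonHom_iterComul (H := H) n
  rw [hopfCyc_succ]
  exact one_comp_cyclic (iterComul H n) (insertLast σ n) h

lemma natCoface_one_hopfCyc (n : ℕ) :
    natCoface η[H] Δ[H] σ (n + 1) 1 ≫ hopfCyc δ σ (n + 2) =
      hopfCyc δ σ (n + 1) ≫ natCoface η[H] Δ[H] σ (n + 1) 0 := by
  rw [hopfCyc_succ, hopfCyc_succ]
  exact (split_comp_cyclic (iterComul H n) (insertLast σ n) δ).trans (Category.assoc _ _ _).symm

lemma natCodegen_zero_hopfCyc (h : IsCharacter δ) (hσ : σ ≫ ε[H] = 𝟙 (𝟙_ C)) (n : ℕ) :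
    natCodegen ε[H] (n + 1) 0 ≫ hopfCyc δ σ (n + 1) =
      hopfCyc δ σ (n + 2) ≫ hopfCyc δ σ (n + 2) ≫ natCodegen ε[H] (n + 1) (n + 1) := by
  have := isMonHom_iterComul (H := H) n
  have := isMonHom_natCodegen (H := H) (n + 1) (i := n + 1) (by omega)
  -- The last degeneracy passes through the product and cancels the inserted `σ` through `ε σ = 1`,
  -- leaving the identity as second factor.
  have e : hopfCyc δ σ (n + 2) ≫ natCodegen ε[H] (n + 1) (n + 1) =
      ((twistedAntipode δ ≫ iterComul H n) ⊗ₘ 𝟙 (tensorPow H (n + 1))) ≫ μ := by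
    rw [hopfCyc_succ]
    refine tensorHom_mul_comp_eq (p := natCodegen ε[H] (n + 1) (n + 1)) ?_ ?_
    · rw [Category.assoc, iterComul_natCodegen _ (by omega)]
    · rw [← natCoface_eq_insertLast η[H] Δ[H]]
      exact natCoface_natCodegen_succ hσ (n + 1) (by omega)
  rw [e, hopfCyc_succ, hopfCyc_succ]
  exact (h.cyclic_comp_cyclic (iterComul H n) (insertLast σ n)).symm

lemma hopfCyc_one : hopfCyc δ σ 1 =
    (twistedAntipode δ ⊗ₘ σ) ≫ μ[H] ≫ (ρ_ H).inv := by
  have e : insertLast σ 0 = σ ≫ (ρ_ H).inv := by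
    change (λ_ (𝟙_ C)).inv ≫ σ ▷ (𝟙_ C) = _
    simp [unitors_inv_equal]
  rw [hopfCyc_succ, e]
  exact (tensorHom_mul_comp (twistedAntipode δ) σ (ρ_ H).inv).symm

/-- `S_δ(σ) σ = δ(σ) 1 = 1`, by group-likeness of `σ` and `δ σ = 1`. -/
lemma IsCocharacter.insertFirst_hopfCyc_one (h : IsCocharacter σ) (hδ : σ ≫ δ = 𝟙 (𝟙_ C)) :
    insertFirst σ 0 ≫ hopfCyc δ σ 1 = insertFirst η[H] 0 := by
  have e : (λ_ (𝟙_ C)).inv ≫ σ ▷ 𝟙_ C ≫ (twistedAntipode δ ⊗ₘ σ) ≫ μ[H] = η[H] := by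
    rw [← Category.id_comp η[H], ← hδ, Category.assoc, ← comul_twistedAntipode_mul,
      reassoc_of% h.comul, ← tensorHom_id, ← tensorHom_id, tensorHom_comp_tensorHom_assoc,
      tensorHom_comp_tensorHom_assoc, Category.id_comp, Category.comp_id]
  rw [hopfCyc_one]
  change ((λ_ (𝟙_ C)).inv ≫ σ ▷ 𝟙_ C) ≫ _ = (λ_ (𝟙_ C)).inv ≫ η ▷ 𝟙_ C
  simp only [Category.assoc]
  rw [reassoc_of% e, unitors_inv_equal, rightUnitor_inv_naturality]

/-- In degree one `τ` exchanges the two characters: `ε τ = ε S_δ = δ`, since `ε σ = 1`, and `δ τ = δ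
S_δ = ε`, since `δ σ = 1`. -/
lemma IsCharacter.natCodegen_zero_hopfCyc_one (h : IsCharacter δ) (h' : σ ≫ ε[H] = 𝟙 (𝟙_ C))
    (hδ : σ ≫ δ = 𝟙 (𝟙_ C)) :
    natCodegen ε[H] 0 0 = hopfCyc δ σ 1 ≫ hopfCyc δ σ 1 ≫ natCodegen ε[H] 0 0 := by
  have := h.isMonHom
  have e : natCodegen ε[H] 0 0 = (ρ_ H).hom ≫ ε[H] := by
    change ε[H] ▷ 𝟙_ C ≫ (λ_ (𝟙_ C)).hom = _
    rw [unitors_equal, rightUnitor_naturality]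
  have key (f : H ⟶ 𝟙_ C) [IsMonHom f] (hf : σ ≫ f = 𝟙 (𝟙_ C)) :
      ((twistedAntipode δ ⊗ₘ σ) ≫ μ[H] ≫ (ρ_ H).inv) ≫ (ρ_ H).hom ≫ f =
        (ρ_ H).hom ≫ twistedAntipode δ ≫ f := by
    simp only [Category.assoc, Iso.inv_hom_id_assoc]
    rw [tensorHom_mul_comp, hf, MonoidalCategory.tensorHom_def]
    simp [unitors_equal]
  have : IsMonHom (ε[H]) := isMonHom_counit
  have e1 := key ε[H] h'
  have e2 := key δ hδ
  rw [twistedAntipode_counit] at e1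
  rw [h.twistedAntipode_comp] at e2
  rw [hopfCyc_one, e]
  exact ((congrArg (((twistedAntipode δ ⊗ₘ σ) ≫ μ[H] ≫ (ρ_ H).inv) ≫ ·) e1).trans e2).symm

/-- The Connes–Moscovici operators of a braided modular pair form a para-cocyclic object. -/
theorem IsModularPairInInvolution.isParaCocyclic (h : IsModularPairInInvolution δ σ) :
    (hopfCyclicData δ σ).IsParaCocyclic where
  coface_coface n i j hij := by
    simp only [hopfCyclicData, hopfCoface_eq]
    exact natCoface_comp (Bimon.one_comul H) h.isCocharacter.comul n (by simpa using hij) j.2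
  codegen_codegen n i j hij := by
    simp only [hopfCyclicData, dropAt_eq_natCodegen]
    exact natCodegen_comp _ n (by simpa using hij) j.2
  coface_codegen_of_le n i j hij := by
    simp only [hopfCyclicData, hopfCoface_eq, dropAt_eq_natCodegen]
    exact natCoface_natCodegen_of_le _ n (by simpa [Fin.le_def] using hij) j.2
  coface_codegen_self n i := by
    simp only [hopfCyclicData, hopfCoface_eq, dropAt_eq_natCodegen]
    exact natCoface_natCodegen_self (BimonObj.one_counit H) n i.2
  coface_codegen_succ n i := by
    simp only [hopfCyclicData, hopfCoface_eq, dropAt_eq_natCodegen]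
    exact natCoface_natCodegen_succ h.isCocharacter.counit n i.2
  coface_codegen_of_gt n i j hij := by
    simp only [hopfCyclicData, hopfCoface_eq, dropAt_eq_natCodegen]
    exact natCoface_natCodegen_of_gt _ n (by simpa [Fin.lt_def] using hij) i.2
  coface_succ_cyc n i := by
    simp only [hopfCyclicData, hopfCoface_eq]
    obtain ⟨i, hi⟩ := i
    -- The operator `τ_0` is the identity and not of product form, so degree `0` is separate; there
    -- the relation is the modularity `δ σ = 1`.
    obtain _ | n := n
    · obtain rfl : i = 0 := by omega
      exact (h.isCocharacter.insertFirst_hopfCyc_one h.modular).trans (Category.id_comp _).symm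
    · obtain _ | i := i
      · exact natCoface_one_hopfCyc n
      · exact natCoface_hopfCyc n (by omega) h.isCocharacter.comul
  coface_zero_cyc n := by
    simp only [hopfCyclicData, hopfCoface_eq]
    refine Eq.trans ?_ ((insertFirst_hopfCyc h.isCharacter n).trans
      (natCoface_eq_insertLast η Δ σ n).symm)
    cases n <;> rfl
  codegen_succ_cyc n i := by
    simp only [hopfCyclicData, dropAt_eq_natCodegen]
    obtain ⟨i, hi⟩ := i
    obtain _ | n := n
    · omega
    · exact natCodegen_hopfCyc n (by omega)
  codegen_zero_cyc n := by
    simp only [hopfCyclicData, dropAt_eq_natCodegen]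
    obtain _ | n := n
    · exact (Category.comp_id _).trans (h.isCharacter.natCodegen_zero_hopfCyc_one
        h.isCocharacter.counit h.modular)
    · exact natCodegen_zero_hopfCyc h.isCharacter h.isCocharacter.counit n

end CyclicOperators

end Cyclic

end BraidedHopf

/-! ### Restriction to the kernels of `1 - τ ^ (n + 1)` -/

namespace CocyclicData

variable {C : Type u} [Category.{v} C]

/-- A subobject of a para-cocyclic object on which `τ_n ^ (n + 1)` is the identity is cocyclic. -/
lemma IsParaCocyclic.isCocyclic_of_mono {D D' : CocyclicData C} (h : D.IsParaCocyclic)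
    (ι : ∀ n, D'.X n ⟶ D.X n) [∀ n, Mono (ι n)]
    (hco : ∀ n i, D'.coface n i ≫ ι (n + 1) = ι n ≫ D.coface n i)
    (hdeg : ∀ n i, D'.codegen n i ≫ ι n = ι (n + 1) ≫ D.codegen n i)
    (hcyc : ∀ n, D'.cyc n ≫ ι n = ι n ≫ D.cyc n)
    (hid : ∀ n, ι n ≫ D.cycPow n (n + 1) = ι n) : D'.IsCocyclic := by
  have hpow (n m : ℕ) : D'.cycPow n m ≫ ι n = ι n ≫ D.cycPow n m := by
    induction m with
    | zero => simp [cycPow]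
    | succ m ih => rw [cycPow, cycPow, Category.assoc, hcyc, reassoc_of% ih]
  have hco' (n : ℕ) (i) {Z : C} (f : _ ⟶ Z) :
      D'.coface n i ≫ ι (n + 1) ≫ f = ι n ≫ D.coface n i ≫ f := by
    rw [← Category.assoc, hco, Category.assoc]
  have hdeg' (n : ℕ) (i) {Z : C} (f : _ ⟶ Z) :
      D'.codegen n i ≫ ι n ≫ f = ι (n + 1) ≫ D.codegen n i ≫ f := by
    rw [← Category.assoc, hdeg, Category.assoc]
  have hcyc' (n : ℕ) {Z : C} (f : _ ⟶ Z) :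
      D'.cyc n ≫ ι n ≫ f = ι n ≫ D.cyc n ≫ f := by
    rw [← Category.assoc, hcyc, Category.assoc]
  refine { coface_coface := fun n i j hij => (cancel_mono (ι _)).1 ?_
           codegen_codegen := fun n i j hij => (cancel_mono (ι _)).1 ?_
           coface_codegen_of_le := fun n i j hij => (cancel_mono (ι _)).1 ?_
           coface_codegen_self := fun n i => (cancel_mono (ι _)).1 ?_
           coface_codegen_succ := fun n i => (cancel_mono (ι _)).1 ?_
           coface_codegen_of_gt := fun n i j hij => (cancel_mono (ι _)).1 ?_
           coface_succ_cyc := fun n i => (cancel_mono (ι _)).1 ?_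
           coface_zero_cyc := fun n => (cancel_mono (ι _)).1 ?_
           codegen_succ_cyc := fun n i => (cancel_mono (ι _)).1 ?_
           codegen_zero_cyc := fun n => (cancel_mono (ι _)).1 ?_
           cycPow_eq_id := fun n => (cancel_mono (ι _)).1 ?_ }
  · simp only [Category.assoc, hco, hco', h.coface_coface n i j hij]
  · simp only [Category.assoc, hdeg, hdeg', h.codegen_codegen n i j hij]
  · simp only [Category.assoc, hco, hdeg, hco', hdeg', h.coface_codegen_of_le n i j hij]
  · rw [Category.assoc, hdeg, hco', h.coface_codegen_self, Category.comp_id, Category.id_comp]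
  · rw [Category.assoc, hdeg, hco', h.coface_codegen_succ, Category.comp_id, Category.id_comp]
  · simp only [Category.assoc, hco, hdeg, hco', hdeg', h.coface_codegen_of_gt n i j hij]
  · simp only [Category.assoc, hco, hcyc, hco', hcyc', h.coface_succ_cyc]
  · rw [Category.assoc, hcyc, hco', hco, h.coface_zero_cyc]
  · simp only [Category.assoc, hcyc, hdeg, hcyc', hdeg', h.codegen_succ_cyc]
  · simp only [Category.assoc, hcyc, hdeg, hcyc', hdeg', h.codegen_zero_cyc]
  · rw [hpow, Category.id_comp, hid]

/-- The kernel inclusions are monic and intertwine all operators by construction; the kernel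
condition says precisely that `τ_n ^ (n + 1)` is the identity after inclusion. -/
lemma IsParaCocyclic.kerRestrict_isCocyclic [Preadditive C] [HasKernels C] {D : CocyclicData C}
    (h : D.IsParaCocyclic) : (D.kerRestrict h).IsCocyclic := by
  have (n : ℕ) : Mono (show (D.kerRestrict h).X n ⟶ D.X n from
      kernel.ι (𝟙 (D.X n) - D.cycPow n (n + 1))) :=
    inferInstanceAs (Mono (kernel.ι (𝟙 (D.X n) - D.cycPow n (n + 1))))
  refine h.isCocyclic_of_mono (fun n => kernel.ι (𝟙 (D.X n) - D.cycPow n (n + 1)))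
    (fun n i => kernel.lift_ι _ _ _) (fun n i => kernel.lift_ι _ _ _)
    (fun n => kernel.lift_ι _ _ _) fun n => ?_
  have := kernel.condition (𝟙 (D.X n) - D.cycPow n (n + 1))
  rw [Preadditive.comp_sub, Category.comp_id, sub_eq_zero] at this
  exact this.symm

end CocyclicData

/-! ### Reconstruction of a bialgebra from a natural separating action -/

namespace BraidedHopf

open MonoidalCategory

variable {C : Type u} [Category.{v} C] [MonoidalCategory C]

section Separates

/-- A morphism `Z ⊗ Q ⟶ Q'` separates the morphisms with values in `Z`, also in the presence
of a further tensor factor on the left. -/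
def Separates {Z Q Q' : C} (a : Z ⊗ Q ⟶ Q') : Prop :=
  ∀ ⦃X Y : C⦄ ⦃f g : X ⟶ Y ⊗ Z⦄,
    f ▷ Q ≫ (α_ Y Z Q).hom ≫ Y ◁ a = g ▷ Q ≫ (α_ Y Z Q).hom ≫ Y ◁ a → f = g

lemma Separates.ext {Z Q Q' : C} {a : Z ⊗ Q ⟶ Q'} (h : Separates a) {X : C} {f g : X ⟶ Z}
    (w : f ▷ Q ≫ a = g ▷ Q ≫ a) : f = g := by
  have key (f : X ⟶ Z) : (f ≫ (λ_ Z).inv) ▷ Q ≫ (α_ (𝟙_ C) Z Q).hom ≫ 𝟙_ C ◁ a =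
      (f ▷ Q ≫ a) ≫ (λ_ Q').inv := by
    rw [comp_whiskerRight, Category.assoc, Category.assoc, leftUnitor_inv_naturality]
    simp
  have := h ((key f).trans ((congrArg (· ≫ (λ_ Q').inv) w).trans (key g).symm))
  exact (cancel_mono _).1 this

variable [BraidedCategory C]

/-- The two actions are removed one after the other: first `b`, with `Y ⊗ Q'` as left factor, then
`a`, after `W` has been braided into the left factor. This is why separation is required in the
presence of a left factor. -/
lemma Separates.tensor {Z Q Q' W P P' : C} {a : Z ⊗ Q ⟶ Q'} {b : W ⊗ P ⟶ P'}
    (ha : Separates a) (hb : Separates b) :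
    Separates (tensorμ Z W Q P ≫ (a ⊗ₘ b)) := by
  intro X Y f g w
  have h1 (f : X ⟶ Y ⊗ (Z ⊗ W)) :
      f ▷ (Q ⊗ P) ≫ (α_ Y (Z ⊗ W) (Q ⊗ P)).hom ≫ Y ◁ (tensorμ Z W Q P ≫ (a ⊗ₘ b)) =
        (α_ X Q P).inv ≫ (f ▷ Q ⊗≫ (Y ⊗ Z) ◁ (β_ W Q).hom ⊗≫ Y ◁ a ▷ W ⊗≫
          𝟙 ((Y ⊗ Q') ⊗ W)) ▷ P ≫ (α_ (Y ⊗ Q') W P).hom ≫ (Y ⊗ Q') ◁ b ≫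
          (α_ Y Q' P').hom := by
    rw [tensorμ, MonoidalCategory.tensorHom_def]
    monoidal
  rw [h1, h1, cancel_epi] at w
  have w1 := hb (by simpa only [← Category.assoc, cancel_mono] using w)
  -- Carrying `W` back to the left by the inverse braiding undoes its crossing with `Q`, and what
  -- remains is the action `a` alone.
  have h2 (f : X ⟶ Y ⊗ (Z ⊗ W)) :
      (f ▷ Q ⊗≫ (Y ⊗ Z) ◁ (β_ W Q).hom ⊗≫ Y ◁ a ▷ W ⊗≫ 𝟙 ((Y ⊗ Q') ⊗ W)) ≫
        (α_ Y Q' W).hom ≫ Y ◁ (β_ W Q').inv ≫ (α_ Y W Q').inv =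
      (f ≫ Y ◁ (β_ W Z).inv ≫ (α_ Y W Z).inv) ▷ Q ≫ (α_ (Y ⊗ W) Z Q).hom ≫ (Y ⊗ W) ◁ a := by
    have e1 : Z ◁ (β_ W Q).hom ≫ (α_ Z Q W).inv ≫ a ▷ W ≫ (β_ W Q').inv =
        (α_ Z W Q).inv ≫ (β_ W Z).inv ▷ Q ≫ (α_ W Z Q).hom ≫ W ◁ a := by
      rw [← cancel_mono (β_ W Q').hom]
      simp only [Category.assoc, Iso.inv_hom_id, Category.comp_id]
      rw [BraidedCategory.braiding_naturality_right, BraidedCategory.braiding_tensor_right_hom]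
      simp [← comp_whiskerRight_assoc]
    calc
      _ = f ▷ Q ⊗≫ Y ◁ (Z ◁ (β_ W Q).hom ≫ (α_ Z Q W).inv ≫ a ▷ W ≫ (β_ W Q').inv) ⊗≫
          𝟙 _ := by monoidal
      _ = _ := by
        rw [e1]
        monoidal
  have w2 := congrArg (· ≫ (α_ Y Q' W).hom ≫ Y ◁ (β_ W Q').inv ≫ (α_ Y W Q').inv) w1
  simp only [h2] at w2
  have w3 := ha w2
  simpa only [← Category.assoc, cancel_mono] using w3

end Separates

section Reconstruction

variable [BraidedCategory C]

/-- An object `H` with multiplication, unit, comultiplication and counit, acting naturally on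
all objects such that the multiplication and the unit give the composition and the identity, the
comultiplication and the counit give the action on tensor products and on the tensor unit,
and the action on some object separates morphisms with values in `H`. -/
structure NaturalAction (H : C) where
  mul : H ⊗ H ⟶ H
  one : 𝟙_ C ⟶ H
  comul : H ⟶ H ⊗ H
  counit : H ⟶ 𝟙_ C
  ev (M : C) : H ⊗ M ⟶ M
  naturality {M N : C} (f : M ⟶ N) : H ◁ f ≫ ev N = ev M ≫ f
  mul_ev (M : C) : mul ▷ M ≫ ev M = (α_ H H M).hom ≫ H ◁ ev M ≫ ev M
  one_ev (M : C) : one ▷ M ≫ ev M = (λ_ M).hom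
  ev_tensor (M N : C) :
    ev (M ⊗ N) = comul ▷ (M ⊗ N) ≫ tensorμ H H M N ≫ (ev M ⊗ₘ ev N)
  ev_unit : ev (𝟙_ C) = (ρ_ H).hom ≫ counit
  G : C
  separates : Separates (ev G)

namespace NaturalAction

variable {H : C} (A : NaturalAction H)

lemma ext {X : C} {f g : X ⟶ H} (w : f ▷ A.G ≫ A.ev A.G = g ▷ A.G ≫ A.ev A.G) : f = g :=
  A.separates.ext w

lemma ext₂ {X : C} {f g : X ⟶ H ⊗ H}
    (w : f ▷ (A.G ⊗ A.G) ≫ tensorμ H H A.G A.G ≫ (A.ev A.G ⊗ₘ A.ev A.G) =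
      g ▷ (A.G ⊗ A.G) ≫ tensorμ H H A.G A.G ≫ (A.ev A.G ⊗ₘ A.ev A.G)) : f = g :=
  (A.separates.tensor A.separates).ext w

/-- The monoid structure. -/
@[reducible]
def monObj : MonObj H where
  one := A.one
  mul := A.mul
  one_mul := A.ext <| by
    rw [comp_whiskerRight, Category.assoc, A.mul_ev, associator_naturality_left_assoc,
      ← whisker_exchange_assoc, A.one_ev]
    simp
  mul_one := A.ext <| by
    rw [comp_whiskerRight, Category.assoc, A.mul_ev, associator_naturality_middle_assoc,
      ← whiskerLeft_comp_assoc, A.one_ev]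
    simp
  mul_assoc := A.ext <| by
    have h1 : (A.mul ▷ H ≫ A.mul) ▷ A.G ≫ A.ev A.G =
        A.mul ▷ H ▷ A.G ≫ (α_ H H A.G).hom ≫ H ◁ A.ev A.G ≫ A.ev A.G := by
      rw [comp_whiskerRight, Category.assoc, A.mul_ev]
    have h2 : ((α_ H H H).hom ≫ H ◁ A.mul ≫ A.mul) ▷ A.G ≫ A.ev A.G =
        (α_ H H H).hom ▷ A.G ≫ (α_ H (H ⊗ H) A.G).hom ≫ H ◁ A.mul ▷ A.G ≫ H ◁ A.ev A.G ≫
          A.ev A.G := by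
      simp only [comp_whiskerRight, Category.assoc]
      rw [A.mul_ev, associator_naturality_middle_assoc]
    rw [h1, h2, associator_naturality_left_assoc, ← whisker_exchange_assoc,
      ← whiskerLeft_comp_assoc, A.mul_ev, whiskerLeft_comp, whiskerLeft_comp]
    monoidal

/-- The comonoid structure. -/
@[reducible]
def comonObj : ComonObj H where
  counit := A.counit
  comul := A.comul
  counit_comul := by
    rw [← cancel_mono (λ_ H).hom, Iso.inv_hom_id, Category.assoc]
    refine A.ext ?_
    -- Left counitality is naturality of the action at `𝟙 ⊗ G ≅ G`, where the unit is acted on by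
    -- the counit.
    have h1 := A.naturality (λ_ A.G).hom
    have e : tensorμ H H (𝟙_ C) A.G ≫ (A.ev (𝟙_ C) ⊗ₘ A.ev A.G) ≫ (λ_ A.G).hom =
        (H ⊗ H) ◁ (λ_ A.G).hom ≫ (A.counit ▷ H ≫ (λ_ H).hom) ▷ A.G ≫ A.ev A.G := by
      rw [A.ev_unit, tensorμ, braiding_tensorUnit_right, MonoidalCategory.tensorHom_def]
      calc
        _ = 𝟙 _ ⊗≫ A.counit ▷ (H ⊗ A.G) ≫ 𝟙_ C ◁ A.ev A.G ⊗≫ 𝟙 _ := by monoidal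
        _ = _ := by monoidal
    rw [A.ev_tensor, Category.assoc, Category.assoc, e, ← whisker_exchange_assoc,
      cancel_epi] at h1
    rw [comp_whiskerRight, Category.assoc, id_whiskerRight, Category.id_comp]
    exact h1.symm
  comul_counit := by
    rw [← cancel_mono (ρ_ H).hom, Iso.inv_hom_id, Category.assoc]
    refine A.ext ?_
    have h1 := A.naturality (ρ_ A.G).hom
    have e : tensorμ H H A.G (𝟙_ C) ≫ (A.ev A.G ⊗ₘ A.ev (𝟙_ C)) ≫ (ρ_ A.G).hom =
        (H ⊗ H) ◁ (ρ_ A.G).hom ≫ (H ◁ A.counit ≫ (ρ_ H).hom) ▷ A.G ≫ A.ev A.G := by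
      rw [A.ev_unit, tensorμ, MonoidalCategory.tensorHom_def']
      calc
        _ = 𝟙 _ ⊗≫ H ◁ ((β_ H A.G).hom ≫ A.G ◁ A.counit) ⊗≫ A.ev A.G ⊗≫ 𝟙 _ := by monoidal
        _ = _ := by
          rw [← BraidedCategory.braiding_naturality_left, braiding_tensorUnit_left]
          monoidal
    rw [A.ev_tensor, Category.assoc, Category.assoc, e, ← whisker_exchange_assoc,
      cancel_epi] at h1
    rw [comp_whiskerRight, Category.assoc, id_whiskerRight, Category.id_comp]
    exact h1.symm
  comul_assoc := by
    -- Both iterated comultiplications describe the action on a threefold tensor power of `G`, with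
    -- the two bracketings; naturality at the associator identifies them.
    refine (A.separates.tensor (A.separates.tensor A.separates)).ext ?_
    have h1 : (A.comul ≫ H ◁ A.comul) ▷ (A.G ⊗ (A.G ⊗ A.G)) ≫ tensorμ H (H ⊗ H) A.G (A.G ⊗ A.G) ≫
        (A.ev A.G ⊗ₘ (tensorμ H H A.G A.G ≫ (A.ev A.G ⊗ₘ A.ev A.G))) =
        A.ev (A.G ⊗ (A.G ⊗ A.G)) := by
      have e := tensorμ_natural_left_assoc (𝟙 H) A.comul A.G (A.G ⊗ A.G)
        (A.ev A.G ⊗ₘ (tensorμ H H A.G A.G ≫ (A.ev A.G ⊗ₘ A.ev A.G)))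
      rw [id_tensorHom, tensorHom_comp_tensorHom, id_whiskerRight, Category.id_comp,
        ← A.ev_tensor] at e
      rw [comp_whiskerRight, Category.assoc, e, A.ev_tensor A.G (A.G ⊗ A.G)]
    rw [h1, ← cancel_epi (H ◁ (α_ A.G A.G A.G).hom), A.naturality, A.ev_tensor (A.G ⊗ A.G)]
    have h2 := associator_monoidal_assoc H H H A.G A.G A.G
      (A.ev A.G ⊗ₘ (A.ev A.G ⊗ₘ A.ev A.G))
    have h3 := tensorμ_natural_left_assoc A.comul (𝟙 H) (A.G ⊗ A.G) A.G
        ((tensorμ H H A.G A.G ≫ (A.ev A.G ⊗ₘ A.ev A.G)) ⊗ₘ A.ev A.G)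
    rw [tensorHom_id, tensorHom_comp_tensorHom, id_whiskerRight, Category.id_comp,
      ← A.ev_tensor] at h3
    rw [← associator_naturality, ← tensorHom_id, tensorHom_comp_tensorHom_assoc,
      Category.id_comp, ← id_tensorHom (H ⊗ A.G), tensorHom_comp_tensorHom, Category.id_comp] at h2
    simp only [comp_whiskerRight, Category.assoc]
    rw [whisker_exchange_assoc, whisker_exchange_assoc,
      ← MonoidalCategory.tensorHom_def'_assoc, ← h2, reassoc_of% h3]

/-- The bimonoid structure. -/
@[reducible]
def bimonObj : BimonObj H where
  __ := A.monObj
  __ := A.comonObj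
  mul_comul := A.ext₂ <| by
    -- Both sides act on `G ⊗ G` as two successive actions; on the right this uses that the action
    -- on tensor products is componentwise.
    have h1 : (A.mul ≫ A.comul) ▷ (A.G ⊗ A.G) ≫ tensorμ H H A.G A.G ≫ (A.ev A.G ⊗ₘ A.ev A.G) =
        (α_ _ _ _).hom ≫ H ◁ A.ev (A.G ⊗ A.G) ≫ A.ev (A.G ⊗ A.G) := by
      rw [← A.mul_ev, A.ev_tensor, comp_whiskerRight, Category.assoc]
    have h2 : (tensorμ H H H H ≫ (A.mul ⊗ₘ A.mul)) ▷ (A.G ⊗ A.G) ≫ tensorμ H H A.G A.G ≫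
        (A.ev A.G ⊗ₘ A.ev A.G) = (α_ (H ⊗ H) (H ⊗ H) (A.G ⊗ A.G)).hom ≫
          (H ⊗ H) ◁ (tensorμ H H A.G A.G ≫ (A.ev A.G ⊗ₘ A.ev A.G)) ≫ tensorμ H H A.G A.G ≫
            (A.ev A.G ⊗ₘ A.ev A.G) := by
      rw [comp_whiskerRight, Category.assoc, tensorμ_natural_left_assoc, tensorHom_comp_tensorHom,
        A.mul_ev, ← tensorHom_comp_tensorHom, ← tensorHom_comp_tensorHom,
        reassoc_of% (tensor_associativity H H H H A.G A.G), whiskerLeft_comp, Category.assoc,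
        tensorμ_natural_right_assoc]
    change (A.mul ≫ A.comul) ▷ _ ≫ _ =
      ((A.comul ⊗ₘ A.comul) ≫ tensorμ H H H H ≫ (A.mul ⊗ₘ A.mul)) ▷ _ ≫ _
    rw [h1, comp_whiskerRight, Category.assoc, h2, A.ev_tensor,
      MonoidalCategory.tensorHom_def' A.comul, comp_whiskerRight, Category.assoc,
      associator_naturality_left_assoc,
      associator_naturality_middle_assoc, ← whisker_exchange_assoc A.comul]
    monoidal
  one_comul := A.ext₂ <| by
    have h1 : (A.one ≫ A.comul) ▷ (A.G ⊗ A.G) ≫ tensorμ H H A.G A.G ≫ (A.ev A.G ⊗ₘ A.ev A.G) =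
        (λ_ (A.G ⊗ A.G)).hom := by
      rw [← A.one_ev, A.ev_tensor, comp_whiskerRight, Category.assoc]
    change (A.one ≫ A.comul) ▷ _ ≫ _ = ((λ_ (𝟙_ C)).inv ≫ (A.one ⊗ₘ A.one)) ▷ _ ≫ _
    rw [h1, comp_whiskerRight, Category.assoc,
      tensorμ_natural_left_assoc, tensorHom_comp_tensorHom, A.one_ev]
    exact tensor_left_unitality _ _
  mul_counit := by
    -- Multiplicativity of the counit is composition of actions on the tensor unit.
    have h := A.mul_ev (𝟙_ C)
    rw [A.ev_unit] at h
    rw [← cancel_epi (ρ_ (H ⊗ H)).hom, ← rightUnitor_naturality_assoc]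
    refine h.trans ?_
    change _ = (ρ_ (H ⊗ H)).hom ≫ (A.counit ⊗ₘ A.counit) ≫ (λ_ (𝟙_ C)).hom
    rw [MonoidalCategory.tensorHom_def', unitors_equal]
    simp
  one_counit := by
    have h := A.one_ev (𝟙_ C)
    rw [A.ev_unit, rightUnitor_naturality_assoc, unitors_equal] at h
    exact (cancel_epi (ρ_ (𝟙_ C)).hom).1 (h.trans (Category.comp_id _).symm)

end NaturalAction

end Reconstruction

end BraidedHopf

/-! ### Objects generated by points, and natural families of actions -/

namespace BraidedHopf

open MonoidalCategory

variable {C : Type u} [Category.{v} C] [MonoidalCategory C]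

/-- An object that is generated by the morphisms from the tensor unit, also in the presence of
further tensor factors. -/
def UnitGenerated (Q : C) : Prop :=
  ∀ ⦃X Y Z : C⦄ ⦃f g : X ⊗ (Q ⊗ Y) ⟶ Z⦄,
    (∀ t : 𝟙_ C ⟶ Q, X ◁ t ▷ Y ≫ f = X ◁ t ▷ Y ≫ g) → f = g

lemma UnitGenerated.ext {Q : C} (hQ : UnitGenerated Q) {X Z : C} {f g : X ⊗ Q ⟶ Z}
    (h : ∀ t : 𝟙_ C ⟶ Q, X ◁ t ≫ f = X ◁ t ≫ g) : f = g := by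
  rw [← cancel_epi (X ◁ (ρ_ Q).hom)]
  refine hQ fun t => ?_
  rw [← whiskerLeft_comp_assoc, ← whiskerLeft_comp_assoc, rightUnitor_naturality,
    whiskerLeft_comp, Category.assoc, h, Category.assoc]

lemma UnitGenerated.tensor {P Q : C} (hP : UnitGenerated P) (hQ : UnitGenerated Q) :
    UnitGenerated (P ⊗ Q) := by
  intro X Y Z f g h
  rw [← cancel_epi (X ◁ (α_ P Q Y).inv)]
  refine hP fun s => ?_
  rw [← cancel_epi (α_ X (𝟙_ C) (Q ⊗ Y)).hom]
  refine hQ fun t => ?_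
  have key (f : X ⊗ ((P ⊗ Q) ⊗ Y) ⟶ Z) : (X ⊗ 𝟙_ C) ◁ t ▷ Y ≫ (α_ X (𝟙_ C) (Q ⊗ Y)).hom ≫
      X ◁ s ▷ (Q ⊗ Y) ≫ X ◁ (α_ P Q Y).inv ≫ f =
      (ρ_ X).hom ▷ (𝟙_ C ⊗ Y) ≫ X ◁ ((λ_ (𝟙_ C)).inv ≫ (s ⊗ₘ t)) ▷ Y ≫ f := by
    rw [MonoidalCategory.tensorHom_def']
    monoidal
  rw [key, key, h]

section NaturalFamily

variable {H : C} {ev : ∀ M : C, H ⊗ M ⟶ M}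
  (nat : ∀ {M N : C} (f : M ⟶ N), H ◁ f ≫ ev N = ev M ≫ f)
include nat

/-- Each point of `Q` turns `a` into a genuine morphism `M ⟶ N`, to which naturality applies; the
points are jointly epimorphic. So a natural action commutes with multiplication by `Q` from the
right. -/
lemma UnitGenerated.whiskerLeft_comp_ev {Q M N : C} (hQ : UnitGenerated Q) (a : M ⊗ Q ⟶ N) :
    H ◁ a ≫ ev N = (α_ H M Q).inv ≫ ev M ▷ Q ≫ a := by
  rw [← cancel_epi (α_ H M Q).hom, Iso.hom_inv_id_assoc]
  refine hQ.ext fun t => ?_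
  have h := nat ((ρ_ M).inv ≫ M ◁ t ≫ a)
  have e : (H ⊗ M) ◁ t ≫ (α_ H M Q).hom ≫ H ◁ a =
      (ρ_ (H ⊗ M)).hom ≫ H ◁ ((ρ_ M).inv ≫ M ◁ t ≫ a) := by monoidal
  rw [reassoc_of% e, h, whisker_exchange_assoc, ← rightUnitor_naturality_assoc]
  simp

/-- Same argument for multiplication from the left; `H` now has to be braided past `Q`. -/
lemma UnitGenerated.whiskerLeft_comp_ev' [BraidedCategory C] {Q M N : C} (hQ : UnitGenerated Q)
    (b : Q ⊗ M ⟶ N) :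
    H ◁ b ≫ ev N =
      (α_ H Q M).inv ≫ (β_ H Q).hom ▷ M ≫ (α_ Q H M).hom ≫ Q ◁ ev M ≫ b := by
  refine hQ fun t => ?_
  have h := nat ((λ_ M).inv ≫ t ▷ M ≫ b)
  have e : H ◁ t ▷ M ≫ H ◁ b = H ◁ (λ_ M).hom ≫ H ◁ ((λ_ M).inv ≫ t ▷ M ≫ b) := by
    rw [← whiskerLeft_comp, ← whiskerLeft_comp, Iso.hom_inv_id_assoc]
  have e' := congrArg (· ▷ M) (BraidedCategory.braiding_naturality_right H t)
  simp only [comp_whiskerRight] at e'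
  rw [reassoc_of% e, h, associator_inv_naturality_middle_assoc, reassoc_of% e',
    associator_naturality_left_assoc, ← whisker_exchange_assoc, braiding_tensorUnit_right]
  monoidal

/-- By naturality at the points of `Q`, the action on `Q` is determined by the action on the tensor
unit, that is, by the counit. -/
lemma UnitGenerated.ev_eq {Q : C} (hQ : UnitGenerated Q) :
    ev Q = ((ρ_ H).inv ≫ ev (𝟙_ C)) ▷ Q ≫ (λ_ Q).hom := by
  refine hQ.ext fun t => ?_
  rw [nat, whisker_exchange_assoc, leftUnitor_naturality]
  monoidal

/-- Elements of `E` act as `g ⊗ k : x ↦ g · e(k, x)`, and `m` lets `H` act on the `g`. Since the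
action of `H` on `G` commutes with right multiplication by `T`, acting with the product is acting
twice. It is used for `H` itself and for the nested version on `G ⊗ G`. -/
lemma mul_ev_of_epi {G K T E : C} (hT : UnitGenerated T) {μ : G ⊗ K ⟶ E} {e : K ⊗ G ⟶ T}
    {a : G ⊗ T ⟶ G} {act : E ⊗ G ⟶ G} {m : H ⊗ E ⟶ E} [Epi (H ◁ μ ▷ G)]
    (h1 : μ ▷ G ≫ act = (α_ G K G).hom ≫ G ◁ e ≫ a)
    (h2 : H ◁ μ ≫ m = (α_ H G K).inv ≫ ev G ▷ K ≫ μ) :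
    m ▷ G ≫ act = (α_ H E G).hom ≫ H ◁ act ≫ ev G := by
  rw [← cancel_epi (α_ H E G).inv, ← cancel_epi (H ◁ μ ▷ G), Iso.inv_hom_id_assoc]
  calc
    _ = (α_ H (G ⊗ K) G).inv ≫ (H ◁ μ ≫ m) ▷ G ≫ act := by monoidal
    _ = (α_ H (G ⊗ K) G).inv ≫ (α_ H G K).inv ▷ G ≫ ev G ▷ K ▷ G ≫ μ ▷ G ≫ act := by
      rw [h2]
      monoidal
    _ = 𝟙 _ ⊗≫ (ev G ▷ (K ⊗ G) ≫ G ◁ e) ⊗≫ a := by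
      rw [h1]
      monoidal
    _ = H ◁ (α_ G K G).hom ≫ H ◁ G ◁ e ≫ (α_ H G T).inv ≫ ev G ▷ T ≫ a := by
      rw [← whisker_exchange]
      monoidal
    _ = H ◁ ((α_ G K G).hom ≫ G ◁ e ≫ a) ≫ ev G := by
      rw [← hT.whiskerLeft_comp_ev nat]
      simp
    _ = _ := by
      rw [← h1]
      simp

end NaturalFamily

/-! ### Consequences of the pairing between `K` and `G` -/

section Antipode

variable {G K T H : C} {μ : G ⊗ K ⟶ H} {e : K ⊗ G ⟶ T} {a : G ⊗ T ⟶ G} {b : T ⊗ K ⟶ K}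
  {m : T ⊗ T ⟶ T} {ν : K ⊗ H ⟶ K} {mul : H ⊗ H ⟶ H} {one : 𝟙_ C ⟶ H} {evG : H ⊗ G ⟶ G}

/-- The action on `G` determines right multiplication by every `μ (g ⊗ k)`, hence by everything,
since `μ` is epimorphic; multiplying by the unit then recovers the morphism itself. -/
lemma separates_of_epi [∀ X : C, Epi (X ◁ μ)]
    (mul_eq : H ◁ μ ≫ mul = (α_ H G K).inv ≫ evG ▷ K ≫ μ)
    (mul_one : H ◁ one ≫ mul = (ρ_ H).hom) : Separates evG := by
  intro X Y f g w
  have h1 (f : X ⟶ Y ⊗ H) : X ◁ μ ≫ f ▷ H ≫ (α_ Y H H).hom ≫ Y ◁ mul =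
      (α_ X G K).inv ≫ (f ▷ G ≫ (α_ Y H G).hom ≫ Y ◁ evG) ▷ K ≫ (α_ Y G K).hom ≫ Y ◁ μ := by
    calc
      _ = f ▷ (G ⊗ K) ≫ (α_ Y H (G ⊗ K)).hom ≫ Y ◁ (H ◁ μ ≫ mul) := by
        rw [whisker_exchange_assoc]
        monoidal
      _ = _ := by
        rw [mul_eq]
        monoidal
  have h2 : f ▷ H ≫ (α_ Y H H).hom ≫ Y ◁ mul = g ▷ H ≫ (α_ Y H H).hom ≫ Y ◁ mul := by
    rw [← cancel_epi (X ◁ μ), h1, h1, w]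
  have h3 (f : X ⟶ Y ⊗ H) : X ◁ one ≫ f ▷ H ≫ (α_ Y H H).hom ≫ Y ◁ mul = (ρ_ X).hom ≫ f := by
    calc
      _ = f ▷ 𝟙_ C ≫ (α_ Y H (𝟙_ C)).hom ≫ Y ◁ (H ◁ one ≫ mul) := by
        rw [whisker_exchange_assoc]
        monoidal
      _ = _ := by
        rw [mul_one]
        monoidal
  rw [← cancel_epi (ρ_ X).hom, ← h3, ← h3, h2]

/-- The associativity `(g k)(g' k') = g (e(k, g') k')`: a product defined through the left action on
`G` can equally be computed through the right action `ν'` on `K`. -/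
lemma whiskerRight_comp_act {K' E : C} {μ' : G ⊗ K' ⟶ E} {b' : T ⊗ K' ⟶ K'} {ν' : K ⊗ E ⟶ K'}
    {act : H ⊗ E ⟶ E} [∀ X : C, Epi (X ◁ μ')]
    (ev_eq : μ ▷ G ≫ evG = (α_ G K G).hom ≫ G ◁ e ≫ a)
    (a_mul : a ▷ K' ≫ μ' = (α_ G T K').hom ≫ G ◁ b' ≫ μ')
    (act_eq : H ◁ μ' ≫ act = (α_ H G K').inv ≫ evG ▷ K' ≫ μ')
    (ν_eq : K ◁ μ' ≫ ν' = (α_ K G K').inv ≫ e ▷ K' ≫ b') :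
    μ ▷ E ≫ act = (α_ G K E).hom ≫ G ◁ ν' ≫ μ' := by
  rw [← cancel_epi ((G ⊗ K) ◁ μ')]
  calc
    _ = μ ▷ (G ⊗ K') ≫ H ◁ μ' ≫ act := by rw [whisker_exchange_assoc]
    _ = (α_ (G ⊗ K) G K').inv ≫ (μ ▷ G ≫ evG) ▷ K' ≫ μ' := by
      rw [act_eq]
      monoidal
    _ = (α_ (G ⊗ K) G K').inv ≫ ((α_ G K G).hom ≫ G ◁ e) ▷ K' ≫ a ▷ K' ≫ μ' := by
      rw [ev_eq]
      monoidal
    _ = (α_ G K (G ⊗ K')).hom ≫ G ◁ ((α_ K G K').inv ≫ e ▷ K' ≫ b') ≫ μ' := by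
      rw [a_mul]
      monoidal
    _ = _ := by
      rw [← ν_eq]
      monoidal

/-- In the description through `ν` the right unit law only concerns `K`: `(g k) 1 = g (k 1)`. -/
lemma whiskerLeft_one_comp_mul [Epi (μ ▷ 𝟙_ C)]
    (mul_eq : μ ▷ H ≫ mul = (α_ G K H).hom ≫ G ◁ ν ≫ μ)
    (one_ν : K ◁ one ≫ ν = (ρ_ K).hom) : H ◁ one ≫ mul = (ρ_ H).hom := by
  rw [← cancel_epi (μ ▷ 𝟙_ C)]
  calc
    _ = (G ⊗ K) ◁ one ≫ μ ▷ H ≫ mul := by rw [whisker_exchange_assoc]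
    _ = (α_ G K (𝟙_ C)).hom ≫ G ◁ (K ◁ one ≫ ν) ≫ μ := by
      rw [mul_eq]
      monoidal
    _ = _ := by
      rw [one_ν]
      monoidal

/-- The pairing determines the action of `H` on the values of `f`, as `g k` acts by `g · e(k, -)`.
By naturality this action is the one on `X` followed by `f`, and inserting the unit leaves `f`. -/
lemma eq_of_whiskerLeft_comp_eq [Epi (μ ▷ G)] [∀ X : C, Epi (μ ▷ X)]
    {ev : ∀ M : C, H ⊗ M ⟶ M} (nat : ∀ {M N : C} (f : M ⟶ N), H ◁ f ≫ ev N = ev M ≫ f)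
    (one_ev : ∀ M, one ▷ M ≫ ev M = (λ_ M).hom)
    (ev_eq : μ ▷ G ≫ ev G = (α_ G K G).hom ≫ G ◁ e ≫ a) {X : C} {f g : X ⟶ G}
    (h : K ◁ f ≫ e = K ◁ g ≫ e) : f = g := by
  have h1 (f : X ⟶ G) : μ ▷ X ≫ H ◁ f ≫ ev G = (α_ G K X).hom ≫ G ◁ (K ◁ f ≫ e) ≫ a := by
    rw [← whisker_exchange_assoc, ev_eq]
    monoidal
  have h2 : H ◁ f ≫ ev G = H ◁ g ≫ ev G := by
    rw [← cancel_epi (μ ▷ X), h1, h1, h]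
  rw [nat, nat] at h2
  have h3 := congrArg (one ▷ X ≫ ·) h2
  simp only [← Category.assoc, one_ev] at h3
  exact (cancel_epi _).1 h3

end Antipode

end BraidedHopf

/-! ### The antipode: duality of `K` and `G` -/

namespace BraidedHopf

open MonoidalCategory

variable {C : Type u} [Category.{v} C] [MonoidalCategory C] [BraidedCategory C]

section Antipode

variable {G K T H : C} {μ : G ⊗ K ⟶ H} {e : K ⊗ G ⟶ T} {a : G ⊗ T ⟶ G} {b : T ⊗ K ⟶ K}
  {m : T ⊗ T ⟶ T} {ν : K ⊗ H ⟶ K} {ψ : H ⊗ H ⟶ H} {one : 𝟙_ C ⟶ H} {ev : ∀ M : C, H ⊗ M ⟶ M}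

/-- It suffices to take the second factor of the form `g' k'`. Both sides are then `e(k, g') e(h k',
g)` up to braiding: on the left because `H` commutes with the scalar `e(k, g')`, on the right
because `ψ` sends `h ⊗ g' k'` to `g' (h k')`. -/
lemma ev_whiskerRight_comp_of_epi (hT : UnitGenerated T) [∀ X Y : C, Epi (X ◁ μ ▷ Y)]
    (nat : ∀ {M N : C} (f : M ⟶ N), H ◁ f ≫ ev N = ev M ≫ f)
    (a_e : K ◁ a ≫ e = (α_ K G T).inv ≫ e ▷ T ≫ m)
    (b_e : b ▷ G ≫ e = (α_ T K G).hom ≫ T ◁ e ≫ m)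
    (ev_eq : μ ▷ G ≫ ev G = (α_ G K G).hom ≫ G ◁ e ≫ a)
    (ν_eq : K ◁ μ ≫ ν = (α_ K G K).inv ≫ e ▷ K ≫ b)
    (ψ_eq : H ◁ μ ≫ ψ = (α_ H G K).inv ≫ (β_ H G).hom ▷ K ≫ (α_ G H K).hom ≫ G ◁ ev K ≫ μ) :
    ((α_ H K H).hom ≫ H ◁ ν ≫ ev K) ▷ G ≫ e =
      ((β_ H K).hom ▷ H ≫ (α_ K H H).hom) ▷ G ≫ (α_ K (H ⊗ H) G).hom ≫
        K ◁ (ψ ▷ G ≫ ev G) ≫ e := by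
  rw [← cancel_epi (α_ (H ⊗ K) H G).inv, ← cancel_epi ((H ⊗ K) ◁ μ ▷ G),
    ← cancel_epi (α_ (H ⊗ K) (G ⊗ K) G).hom]
  calc
    _ = ((α_ H K (G ⊗ K)).hom ≫ H ◁ (K ◁ μ ≫ ν) ≫ ev K) ▷ G ≫ e := by monoidal
    _ = ((α_ H K (G ⊗ K)).hom ≫ H ◁ ((α_ K G K).inv ≫ e ▷ K) ≫ H ◁ b ≫ ev K) ▷ G ≫ e := by
      rw [ν_eq]
      monoidal
    _ = ((α_ H K (G ⊗ K)).hom ≫ H ◁ ((α_ K G K).inv ≫ e ▷ K) ≫ (α_ H T K).inv ≫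
        (β_ H T).hom ▷ K ≫ (α_ T H K).hom ≫ T ◁ ev K) ▷ G ≫ b ▷ G ≫ e := by
      rw [hT.whiskerLeft_comp_ev' nat]
      monoidal
    _ = 𝟙 _ ⊗≫ (H ◁ e ≫ (β_ H T).hom) ▷ (K ⊗ G) ⊗≫ T ◁ ev K ▷ G ⊗≫ T ◁ e ≫ m := by
      rw [b_e]
      monoidal
    _ = 𝟙 _ ⊗≫ ((β_ H (K ⊗ G)).hom ≫ e ▷ H) ▷ (K ⊗ G) ⊗≫ T ◁ ev K ▷ G ⊗≫ T ◁ e ≫ m := by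
      rw [BraidedCategory.braiding_naturality_right]
    _ = 𝟙 _ ⊗≫ (β_ H (K ⊗ G)).hom ▷ (K ⊗ G) ⊗≫
        (e ▷ ((H ⊗ K) ⊗ G) ≫ T ◁ (ev K ▷ G ≫ e)) ⊗≫ m := by monoidal
    _ = 𝟙 _ ⊗≫ (β_ H K).hom ▷ (G ⊗ K ⊗ G) ⊗≫ K ◁ (β_ H G).hom ▷ (K ⊗ G) ⊗≫
        (K ⊗ G) ◁ (ev K ▷ G ≫ e) ⊗≫ e ▷ T ≫ m := by
      rw [← whisker_exchange, BraidedCategory.braiding_tensor_right_hom]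
      monoidal
    _ = 𝟙 _ ⊗≫ (β_ H K).hom ▷ (G ⊗ K ⊗ G) ⊗≫ K ◁ (β_ H G).hom ▷ (K ⊗ G) ⊗≫
        K ◁ G ◁ (ev K ▷ G) ⊗≫ K ◁ G ◁ e ≫ (α_ K G T).inv ≫ e ▷ T ≫ m := by
      monoidal
    _ = 𝟙 _ ⊗≫ (β_ H K).hom ▷ (G ⊗ K ⊗ G) ⊗≫ K ◁ (β_ H G).hom ▷ (K ⊗ G) ⊗≫
        K ◁ G ◁ (ev K ▷ G) ⊗≫ K ◁ ((α_ G K G).hom ≫ G ◁ e ≫ a) ≫ e := by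
      rw [← a_e]
      monoidal
    _ = 𝟙 _ ⊗≫ (β_ H K).hom ▷ (G ⊗ K ⊗ G) ⊗≫ K ◁ (((α_ H G K).inv ≫ (β_ H G).hom ▷ K ≫
        (α_ G H K).hom ≫ G ◁ ev K ≫ μ) ▷ G ≫ ev G) ≫ e := by
      rw [← ev_eq]
      monoidal
    _ = 𝟙 _ ⊗≫ ((β_ H K).hom ▷ (G ⊗ K) ≫ (K ⊗ H) ◁ μ) ▷ G ⊗≫ K ◁ (ψ ▷ G ≫ ev G) ≫ e := by
      rw [← ψ_eq]
      monoidal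
    _ = _ := by
      rw [← whisker_exchange]
      monoidal

/-- The morphism `S` is characterized by the action of `H` on `K` being dual to that on `G`. -/
lemma ev_whiskerRight_comp
    (h : ((α_ H K H).hom ≫ H ◁ ν ≫ ev K) ▷ G ≫ e =
      ((β_ H K).hom ▷ H ≫ (α_ K H H).hom) ▷ G ≫ (α_ K (H ⊗ H) G).hom ≫
        K ◁ (ψ ▷ G ≫ ev G) ≫ e)
    (one_ν : K ◁ one ≫ ν = (ρ_ K).hom) {S : H ⟶ H} (hS : H ◁ one ≫ ψ = (ρ_ H).hom ≫ S) :
    ev K ▷ G ≫ e =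
      (β_ H K).hom ▷ G ≫ (α_ K H G).hom ≫ K ◁ (S ▷ G ≫ ev G) ≫ e := by
  calc
    _ = (ρ_ (H ⊗ K)).inv ▷ G ≫ ((α_ H K (𝟙_ C)).hom ≫ H ◁ (K ◁ one ≫ ν) ≫ ev K) ▷ G ≫ e := by
      rw [one_ν]
      monoidal
    _ = (ρ_ (H ⊗ K)).inv ▷ G ≫ ((H ⊗ K) ◁ one) ▷ G ≫
        ((α_ H K H).hom ≫ H ◁ ν ≫ ev K) ▷ G ≫ e := by monoidal
    _ = 𝟙 _ ⊗≫ ((H ⊗ K) ◁ one ≫ (β_ H K).hom ▷ H) ▷ G ⊗≫ K ◁ (ψ ▷ G ≫ ev G) ≫ e := by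
      rw [h]
      monoidal
    _ = 𝟙 _ ⊗≫ (β_ H K).hom ▷ G ⊗≫ K ◁ ((H ◁ one ≫ ψ) ▷ G ≫ ev G) ≫ e := by
      rw [whisker_exchange]
      monoidal
    _ = _ := by
      rw [hS]
      monoidal

/-- The hypothesis describes the action of `H` on itself as `x ↦ h₁ x S(h₂)`. At `x = 1`, naturality
at the unit says that this action is the counit. -/
lemma comul_ev_antipode {S : H ⟶ H} {comul : H ⟶ H ⊗ H} {counit : H ⟶ 𝟙_ C}
    (nat : ∀ {M N : C} (f : M ⟶ N), H ◁ f ≫ ev N = ev M ≫ f)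
    (ev_unit : ev (𝟙_ C) = (ρ_ H).hom ≫ counit)
    (one_ev : one ▷ G ≫ ev G = (λ_ G).hom)
    (h : ev H ▷ G ≫ ev G = (comul ▷ H ≫ (α_ H H H).hom ≫ H ◁ (β_ H H).hom) ▷ G ≫
      (α_ H (H ⊗ H) G).hom ≫ H ◁ ((α_ H H G).hom ≫ H ◁ (S ▷ G ≫ ev G) ≫ ev G) ≫ ev G) :
    comul ▷ G ≫ (α_ H H G).hom ≫ H ◁ (S ▷ G ≫ ev G) ≫ ev G = counit ▷ G ≫ (λ_ G).hom := by
  have h1 := nat one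
  rw [ev_unit] at h1
  calc
    _ = comul ▷ G ⊗≫ H ◁ (S ▷ G ≫ ev G) ≫ H ◁ (λ_ G).inv ≫ H ◁ (λ_ G).hom ≫ ev G := by
      monoidal
    _ = comul ▷ G ⊗≫ H ◁ (𝟙_ C ◁ (S ▷ G ≫ ev G) ≫ one ▷ G ≫ ev G) ≫ ev G := by
      rw [one_ev]
      monoidal
    _ = comul ▷ G ⊗≫ H ◁ ((β_ H (𝟙_ C)).hom ≫ one ▷ H) ▷ G ⊗≫
        H ◁ (H ◁ (S ▷ G ≫ ev G) ≫ ev G) ≫ ev G := by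
      rw [whisker_exchange_assoc, braiding_tensorUnit_right]
      monoidal
    _ = 𝟙 _ ⊗≫ (comul ▷ 𝟙_ C ≫ (H ⊗ H) ◁ one) ▷ G ⊗≫ H ◁ (β_ H H).hom ▷ G ⊗≫
        H ◁ (H ◁ (S ▷ G ≫ ev G) ≫ ev G) ≫ ev G := by
      rw [← BraidedCategory.braiding_naturality_right]
      monoidal
    _ = (ρ_ H).inv ▷ G ≫ (H ◁ one) ▷ G ≫ (comul ▷ H ≫ (α_ H H H).hom ≫ H ◁ (β_ H H).hom) ▷ G ≫
      (α_ H (H ⊗ H) G).hom ≫ H ◁ ((α_ H H G).hom ≫ H ◁ (S ▷ G ≫ ev G) ≫ ev G) ≫ ev G := by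
      rw [← whisker_exchange]
      monoidal
    _ = (ρ_ H).inv ▷ G ≫ (H ◁ one ≫ ev H) ▷ G ≫ ev G := by
      rw [← h]
      monoidal
    _ = counit ▷ G ≫ one ▷ G ≫ ev G := by
      rw [h1]
      monoidal
    _ = _ := by rw [one_ev]

/-- Naturality at `μ` turns the action on `H` into the diagonal action on `G ⊗ K`. The part acting
on `K` is transferred to `G` through `S` by duality, which yields `h₁ x S(h₂)` with `x = g k`. -/
lemma ev_whiskerRight_ev {S : H ⟶ H} {comul : H ⟶ H ⊗ H}
    (nat : ∀ {M N : C} (f : M ⟶ N), H ◁ f ≫ ev N = ev M ≫ f)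
    (ev_S : ev K ▷ G ≫ e = (β_ H K).hom ▷ G ≫ (α_ K H G).hom ≫ K ◁ (S ▷ G ≫ ev G) ≫ e)
    (ev_tensor : ∀ M N, ev (M ⊗ N) = comul ▷ (M ⊗ N) ≫ tensorμ H H M N ≫ (ev M ⊗ₘ ev N))
    (hT : UnitGenerated T) [∀ X Y : C, Epi (X ◁ μ ▷ Y)]
    (ev_eq : μ ▷ G ≫ ev G = (α_ G K G).hom ≫ G ◁ e ≫ a) :
    ev H ▷ G ≫ ev G = (comul ▷ H ≫ (α_ H H H).hom ≫ H ◁ (β_ H H).hom) ▷ G ≫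
      (α_ H (H ⊗ H) G).hom ≫ H ◁ ((α_ H H G).hom ≫ H ◁ (S ▷ G ≫ ev G) ≫ ev G) ≫ ev G := by
  rw [← cancel_epi (α_ H H G).inv, ← cancel_epi (H ◁ μ ▷ G), ← cancel_epi (α_ H (G ⊗ K) G).hom]
  have h1 : (G ⊗ K) ◁ (S ▷ G ≫ ev G) ≫ μ ▷ G ≫ ev G =
      (α_ G K (H ⊗ G)).hom ≫ G ◁ (K ◁ (S ▷ G ≫ ev G) ≫ e) ≫ a := by
    rw [ev_eq]
    monoidal
  calc
    _ = (H ◁ μ ≫ ev H) ▷ G ≫ ev G := by monoidal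
    _ = ev (G ⊗ K) ▷ G ≫ μ ▷ G ≫ ev G := by
      rw [nat]
      monoidal
    _ = (comul ▷ (G ⊗ K) ⊗≫ H ◁ (β_ H G).hom ▷ K) ▷ G ⊗≫ (ev G ▷ (H ⊗ K) ≫ G ◁ ev K) ▷ G ⊗≫
        G ◁ e ≫ a := by
      rw [ev_eq, ev_tensor, tensorμ, MonoidalCategory.tensorHom_def]
      monoidal
    _ = (comul ▷ (G ⊗ K) ⊗≫ H ◁ (β_ H G).hom ▷ K) ▷ G ⊗≫
        ((H ⊗ G) ◁ (ev K ▷ G ≫ e) ≫ ev G ▷ T) ≫ a := by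
      rw [whisker_exchange]
      monoidal
    _ = (comul ▷ (G ⊗ K) ⊗≫ H ◁ (β_ H G).hom ▷ K) ▷ G ⊗≫
        H ◁ G ◁ (ev K ▷ G ≫ e) ≫ (α_ H G T).inv ≫ ev G ▷ T ≫ a := by
      monoidal
    _ = (comul ▷ (G ⊗ K) ⊗≫ H ◁ (β_ H G).hom ▷ K) ▷ G ⊗≫
        H ◁ (G ◁ ((β_ H K).hom ▷ G ≫ (α_ K H G).hom) ≫ G ◁ (K ◁ (S ▷ G ≫ ev G) ≫ e) ≫ a) ≫
          ev G := by
      rw [← hT.whiskerLeft_comp_ev nat, ev_S]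
      monoidal
    _ = comul ▷ (G ⊗ K) ▷ G ⊗≫ H ◁ (β_ H (G ⊗ K)).hom ▷ G ⊗≫
        H ◁ ((G ⊗ K) ◁ (S ▷ G ≫ ev G) ≫ μ ▷ G ≫ ev G) ≫ ev G := by
      rw [h1, BraidedCategory.braiding_tensor_right_hom]
      monoidal
    _ = comul ▷ (G ⊗ K) ▷ G ⊗≫ H ◁ ((β_ H (G ⊗ K)).hom ≫ μ ▷ H) ▷ G ⊗≫
        H ◁ (H ◁ (S ▷ G ≫ ev G) ≫ ev G) ≫ ev G := by
      rw [whisker_exchange_assoc]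
      monoidal
    _ = (comul ▷ (G ⊗ K) ≫ (H ⊗ H) ◁ μ) ▷ G ⊗≫ H ◁ (β_ H H).hom ▷ G ⊗≫
        H ◁ (H ◁ (S ▷ G ≫ ev G) ≫ ev G) ≫ ev G := by
      rw [← BraidedCategory.braiding_naturality_right]
      monoidal
    _ = _ := by
      rw [← whisker_exchange]
      monoidal

variable {S : H ⟶ H} {comul : H ⟶ H ⊗ H} {counit : H ⟶ 𝟙_ C}
  (nat : ∀ {M N : C} (f : M ⟶ N), H ◁ f ≫ ev N = ev M ≫ f)
  (ev_S : ev K ▷ G ≫ e = (β_ H K).hom ▷ G ≫ (α_ K H G).hom ≫ K ◁ (S ▷ G ≫ ev G) ≫ e)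
  (ev_tensor : ∀ M N, ev (M ⊗ N) = comul ▷ (M ⊗ N) ≫ tensorμ H H M N ≫ (ev M ⊗ₘ ev N))
  (ev_unit : ev (𝟙_ C) = (ρ_ H).hom ≫ counit)
include nat ev_S ev_tensor ev_unit

/-- The pairing `e` is a morphism to `T`, on which `H` acts by the counit. Naturality at `e`
therefore says `e(h₁ k, h₂ g) = ε(h) e(k, g)` up to braiding; duality moves `h₁` to `S(h₁)` on `G`,
and the pairing separates. -/
lemma comul_antipode_ev (hT : UnitGenerated T)
    (separates : ∀ {X : C} {f g : X ⟶ G}, K ◁ f ≫ e = K ◁ g ≫ e → f = g) :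
    comul ▷ G ≫ (α_ H H G).hom ≫ H ◁ ev G ≫ S ▷ G ≫ ev G = counit ▷ G ≫ (λ_ G).hom := by
  apply separates
  rw [← cancel_epi (α_ K H G).hom, ← cancel_epi ((β_ H K).hom ▷ G)]
  have h1 := nat e
  rw [ev_tensor, hT.ev_eq nat, ev_unit, Iso.inv_hom_id_assoc] at h1
  have h2 : (β_ H K).hom ▷ G ≫ (α_ K H G).hom ≫ K ◁ (counit ▷ G ≫ (λ_ G).hom) ≫ e =
      (α_ H K G).hom ≫ H ◁ e ≫ counit ▷ T ≫ (λ_ T).hom := by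
    calc
      _ = ((β_ H K).hom ≫ K ◁ counit) ▷ G ⊗≫ e := by monoidal
      _ = _ := by
        rw [← BraidedCategory.braiding_naturality_left, whisker_exchange_assoc,
          braiding_tensorUnit_left]
        monoidal
  rw [h2, h1]
  calc
    _ = ((β_ H K).hom ≫ K ◁ comul) ▷ G ⊗≫ (K ⊗ H) ◁ ev G ⊗≫ K ◁ (S ▷ G ≫ ev G) ≫ e := by
      monoidal
    _ = (comul ▷ K ≫ (β_ (H ⊗ H) K).hom) ▷ G ⊗≫ (K ⊗ H) ◁ ev G ⊗≫ K ◁ (S ▷ G ≫ ev G) ≫ e := by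
      rw [← BraidedCategory.braiding_naturality_left]
    _ = comul ▷ K ▷ G ⊗≫ H ◁ (β_ H K).hom ▷ G ⊗≫ ((β_ H K).hom ▷ (H ⊗ G) ≫ (K ⊗ H) ◁ ev G) ⊗≫
        K ◁ (S ▷ G ≫ ev G) ≫ e := by
      rw [BraidedCategory.braiding_tensor_left_hom]
      monoidal
    _ = comul ▷ K ▷ G ⊗≫ H ◁ (β_ H K).hom ▷ G ⊗≫ (H ⊗ K) ◁ ev G ≫ (β_ H K).hom ▷ G ≫
        (α_ K H G).hom ≫ K ◁ (S ▷ G ≫ ev G) ≫ e := by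
      rw [← whisker_exchange]
      monoidal
    _ = comul ▷ K ▷ G ⊗≫ H ◁ (β_ H K).hom ▷ G ⊗≫ (H ⊗ K) ◁ ev G ≫ ev K ▷ G ≫ e := by
      rw [← ev_S]
    _ = _ := by
      rw [tensorμ, MonoidalCategory.tensorHom_def']
      monoidal

end Antipode

end BraidedHopf

/-! ### The comultiplication and the assembled Hopf structure -/

namespace BraidedHopf

open MonoidalCategory

variable {C : Type u} [Category.{v} C] [MonoidalCategory C] [BraidedCategory C]

section Comul

variable {G K T H : C}

/-- The morphism `(G ⊗ G) ⊗ (K ⊗ K) ⟶ H ⊗ H` that pairs the inner and the outer tensor factors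
and interchanges the resulting copies of `H`. -/
def nestedMul (μ : G ⊗ K ⟶ H) : (G ⊗ G) ⊗ (K ⊗ K) ⟶ H ⊗ H :=
  (α_ G G (K ⊗ K)).hom ≫ G ◁ ((α_ G K K).inv ≫ μ ▷ K ≫ (β_ H K).hom) ≫ (α_ G K H).inv ≫ μ ▷ H

/-- The pairing `(K ⊗ K) ⊗ (G ⊗ G) ⟶ T ⊗ T` of the inner and of the outer tensor factors. -/
def nestedPairing (e : K ⊗ G ⟶ T) : (K ⊗ K) ⊗ (G ⊗ G) ⟶ T ⊗ T :=
  (α_ K K (G ⊗ G)).hom ≫ K ◁ ((α_ K G G).inv ≫ e ▷ G) ≫ (α_ K T G).inv ≫ (β_ K T).hom ▷ G ≫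
    (α_ T K G).hom ≫ T ◁ e

/-- This exhibits the action of nested factors on `G ⊗ G` in the form required by `mul_ev_of_epi`,
with `G ⊗ G`, `K ⊗ K`, `T ⊗ T` in place of `G`, `K`, `T`. -/
lemma nestedMul_ev {μ : G ⊗ K ⟶ H} {e : K ⊗ G ⟶ T} {a : G ⊗ T ⟶ G} {ev : H ⊗ G ⟶ G}
    (ev_eq : μ ▷ G ≫ ev = (α_ G K G).hom ≫ G ◁ e ≫ a) :
    nestedMul μ ▷ (G ⊗ G) ≫ tensorμ H H G G ≫ (ev ⊗ₘ ev) =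
      (α_ (G ⊗ G) (K ⊗ K) (G ⊗ G)).hom ≫ (G ⊗ G) ◁ nestedPairing e ≫ tensorμ G G T T ≫
        (a ⊗ₘ a) := by
  rw [nestedMul, nestedPairing, tensorμ, tensorμ, MonoidalCategory.tensorHom_def,
    MonoidalCategory.tensorHom_def']
  calc
    _ = 𝟙 _ ⊗≫ G ◁ (μ ▷ K ≫ (β_ H K).hom) ▷ (G ⊗ G) ⊗≫
        (μ ▷ ((H ⊗ G) ⊗ G) ≫ H ◁ ((β_ H G).hom ▷ G)) ⊗≫ ev ▷ (H ⊗ G) ≫ G ◁ ev := by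
      monoidal
    _ = 𝟙 _ ⊗≫ G ◁ (μ ▷ K ≫ (β_ H K).hom) ▷ (G ⊗ G) ⊗≫ (G ⊗ K) ◁ (β_ H G).hom ▷ G ⊗≫
        (μ ▷ G ≫ ev) ▷ (H ⊗ G) ≫ G ◁ ev := by
      rw [← whisker_exchange]
      monoidal
    _ = 𝟙 _ ⊗≫ G ◁ μ ▷ (K ⊗ G ⊗ G) ⊗≫ G ◁ ((β_ H (K ⊗ G)).hom ≫ e ▷ H) ▷ G ⊗≫
        (a ▷ (H ⊗ G) ≫ G ◁ ev) := by
      rw [ev_eq, BraidedCategory.braiding_tensor_right_hom]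
      monoidal
    _ = 𝟙 _ ⊗≫ G ◁ (μ ▷ (K ⊗ G) ≫ H ◁ e) ▷ G ⊗≫ G ◁ (β_ H T).hom ▷ G ⊗≫
        (G ⊗ T) ◁ ev ≫ a ▷ G := by
      rw [← BraidedCategory.braiding_naturality_right, ← whisker_exchange]
      monoidal
    _ = 𝟙 _ ⊗≫ G ◁ (G ⊗ K) ◁ e ▷ G ⊗≫ G ◁ (μ ▷ T ≫ (β_ H T).hom) ▷ G ⊗≫
        (G ⊗ T) ◁ ev ≫ a ▷ G := by
      rw [← whisker_exchange]
      monoidal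
    _ = 𝟙 _ ⊗≫ G ◁ (G ⊗ K) ◁ e ▷ G ⊗≫ G ◁ (β_ (G ⊗ K) T).hom ▷ G ⊗≫
        (G ⊗ T) ◁ (μ ▷ G ≫ ev) ≫ a ▷ G := by
      rw [BraidedCategory.braiding_naturality_left]
      monoidal
    _ = 𝟙 _ ⊗≫ G ◁ (G ⊗ K) ◁ e ▷ G ⊗≫ G ◁ G ◁ (β_ K T).hom ▷ G ⊗≫
        G ◁ ((β_ G T).hom ▷ (K ⊗ G) ≫ (T ⊗ G) ◁ e) ⊗≫ (G ⊗ T) ◁ a ≫ a ▷ G := by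
      rw [ev_eq, BraidedCategory.braiding_tensor_left_hom]
      monoidal
    _ = _ := by
      rw [← whisker_exchange]
      monoidal

end Comul

/-- The data from which the transmuted Hopf algebra is constructed. -/
structure TransmutationData (C : Type u) [Category.{v} C] [MonoidalCategory C]
    [BraidedCategory C] where
  {G K T H E : C}
  μ : G ⊗ K ⟶ H
  e : K ⊗ G ⟶ T
  a : G ⊗ T ⟶ G
  b : T ⊗ K ⟶ K
  m : T ⊗ T ⟶ T
  unitGenerated : UnitGenerated T
  epi_μ (X Y : C) : Epi (X ◁ μ ▷ Y)
  a_μ : a ▷ K ≫ μ = (α_ G T K).hom ≫ G ◁ b ≫ μ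
  a_e : K ◁ a ≫ e = (α_ K G T).inv ≫ e ▷ T ≫ m
  b_e : b ▷ G ≫ e = (α_ T K G).hom ≫ T ◁ e ≫ m
  /-- The action of `H` on all objects. -/
  ev (M : C) : H ⊗ M ⟶ M
  naturality {M N : C} (f : M ⟶ N) : H ◁ f ≫ ev N = ev M ≫ f
  ev_eq : μ ▷ G ≫ ev G = (α_ G K G).hom ≫ G ◁ e ≫ a
  generates {X M Y Z : C} {f g : X ⊗ (M ⊗ Y) ⟶ Z} :
    (∀ p : G ⟶ M, X ◁ p ▷ Y ≫ f = X ◁ p ▷ Y ≫ g) → f = g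
  one : 𝟙_ C ⟶ H
  mul : H ⊗ H ⟶ H
  ν : K ⊗ H ⟶ K
  ψ : H ⊗ H ⟶ H
  one_ev : one ▷ G ≫ ev G = (λ_ G).hom
  mul_eq : H ◁ μ ≫ mul = (α_ H G K).inv ≫ ev G ▷ K ≫ μ
  ν_eq : K ◁ μ ≫ ν = (α_ K G K).inv ≫ e ▷ K ≫ b
  one_ν : K ◁ one ≫ ν = (ρ_ K).hom
  ψ_eq : H ◁ μ ≫ ψ = (α_ H G K).inv ≫ (β_ H G).hom ▷ K ≫ (α_ G H K).hom ≫ G ◁ ev K ≫ μ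
  /-- The multiplication of nested factors. -/
  μ₂ : (G ⊗ G) ⊗ (K ⊗ K) ⟶ E
  epi_μ₂ (X Y : C) : Epi (X ◁ μ₂ ▷ Y)
  mul₂ : H ⊗ E ⟶ E
  mul₂_eq : H ◁ μ₂ ≫ mul₂ = (α_ H (G ⊗ G) (K ⊗ K)).inv ≫ ev (G ⊗ G) ▷ (K ⊗ K) ≫ μ₂
  π : E ⟶ H ⊗ H
  π_eq : μ₂ ≫ π = nestedMul μ
  χ : G ⊗ (H ⊗ K) ⟶ E
  χ_eq : G ◁ (μ ▷ K) ≫ χ = G ◁ (α_ G K K).hom ≫ (α_ G G (K ⊗ K)).inv ≫ μ₂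
  ζ : H ⟶ E
  ζ_eq : μ ≫ ζ = G ◁ ((λ_ K).inv ≫ one ▷ K) ≫ χ

namespace TransmutationData

variable (D : TransmutationData C)

instance (X Y : C) : Epi (X ◁ D.μ ▷ Y) := D.epi_μ X Y
instance (X Y : C) : Epi (X ◁ D.μ₂ ▷ Y) := D.epi_μ₂ X Y

instance (X : C) : Epi (X ◁ D.μ) := by
  have : X ◁ D.μ = X ◁ (ρ_ _).inv ≫ X ◁ D.μ ▷ 𝟙_ C ≫ X ◁ (ρ_ _).hom := by monoidal
  rw [this]
  infer_instance

instance (X : C) : Epi (D.μ ▷ X) := by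
  have : D.μ ▷ X = (λ_ _).inv ≫ 𝟙_ C ◁ D.μ ▷ X ≫ (λ_ _).hom := by monoidal
  rw [this]
  infer_instance

instance : Epi D.μ := by
  have : D.μ = (ρ_ _).inv ≫ D.μ ▷ 𝟙_ C ≫ (ρ_ _).hom := by monoidal
  rw [this]
  infer_instance

lemma ext_generates {X M Z : C} {f g : X ⊗ M ⟶ Z}
    (h : ∀ p : D.G ⟶ M, X ◁ p ≫ f = X ◁ p ≫ g) : f = g := by
  rw [← cancel_epi (X ◁ (ρ_ M).hom)]
  refine D.generates fun p => ?_
  rw [← whiskerLeft_comp_assoc, ← whiskerLeft_comp_assoc, rightUnitor_naturality,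
    whiskerLeft_comp, Category.assoc, h, Category.assoc]

lemma ext_generates₂ {X M N Z : C} {f g : X ⊗ (M ⊗ N) ⟶ Z}
    (h : ∀ (p : D.G ⟶ M) (q : D.G ⟶ N), X ◁ (p ⊗ₘ q) ≫ f = X ◁ (p ⊗ₘ q) ≫ g) : f = g := by
  refine D.generates fun p => ?_
  rw [← cancel_epi (α_ X D.G N).hom]
  refine D.ext_generates fun q => ?_
  have := h p q
  rw [MonoidalCategory.tensorHom_def', whiskerLeft_comp, Category.assoc, Category.assoc] at this
  rw [associator_naturality_right_assoc, associator_naturality_right_assoc, this]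

/-- `M` is generated by morphisms from `G`, so by naturality the case of `G` suffices. -/
lemma mul_ev (M : C) :
    D.mul ▷ M ≫ D.ev M = (α_ D.H D.H M).hom ≫ D.H ◁ D.ev M ≫ D.ev M := by
  refine D.ext_generates fun p => ?_
  have h := mul_ev_of_epi D.naturality D.unitGenerated D.ev_eq D.mul_eq
  rw [whisker_exchange_assoc, D.naturality, reassoc_of% h, associator_naturality_right_assoc,
    ← whiskerLeft_comp_assoc D.H (D.H ◁ p), D.naturality p, whiskerLeft_comp_assoc,
    D.naturality p]

lemma one_ev_apply (M : C) : D.one ▷ M ≫ D.ev M = (λ_ M).hom := by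
  refine D.ext_generates fun p => ?_
  rw [whisker_exchange_assoc, D.naturality, reassoc_of% D.one_ev]
  simp

lemma mul_eq' : D.μ ▷ D.H ≫ D.mul = (α_ D.G D.K D.H).hom ≫ D.G ◁ D.ν ≫ D.μ :=
  whiskerRight_comp_act D.ev_eq D.a_μ D.mul_eq D.ν_eq

lemma mul_one : D.H ◁ D.one ≫ D.mul = (ρ_ D.H).hom :=
  whiskerLeft_one_comp_mul D.mul_eq' D.one_ν

lemma separates : Separates (D.ev D.G) := separates_of_epi D.mul_eq D.mul_one

/-- The invariant element of `E`. -/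
def ξ : 𝟙_ C ⟶ D.E := D.one ≫ D.ζ

/-- The comultiplication. -/
def comul : D.H ⟶ D.H ⊗ D.H := (ρ_ D.H).inv ≫ D.H ◁ D.ξ ≫ D.mul₂ ≫ D.π

/-- The counit. -/
def counit : D.H ⟶ 𝟙_ C := (ρ_ D.H).inv ≫ D.ev (𝟙_ C)

/-- The antipode. -/
def antipode : D.H ⟶ D.H := (ρ_ D.H).inv ≫ D.H ◁ D.one ≫ D.ψ

/-- Inserting the unit between `g` and `k` and then untangling the nesting gives `g k ⊗ 1`; at `g k
= 1` this is `1 ⊗ 1`. -/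
lemma ξ_π : D.ξ ≫ D.π = (λ_ (𝟙_ C)).inv ≫ (D.one ⊗ₘ D.one) := by
  have h : D.ζ ≫ D.π = (ρ_ D.H).inv ≫ D.H ◁ D.one := by
    have h1 : D.χ ≫ D.π = D.G ◁ (β_ D.H D.K).hom ≫ (α_ D.G D.K D.H).inv ≫ D.μ ▷ D.H := by
      rw [← cancel_epi (D.G ◁ (D.μ ▷ D.K)), reassoc_of% D.χ_eq, D.π_eq, nestedMul,
        Iso.inv_hom_id_assoc, ← whiskerLeft_comp_assoc, Iso.hom_inv_id_assoc,
        whiskerLeft_comp_assoc]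
    rw [← cancel_epi D.μ, reassoc_of% D.ζ_eq, h1]
    simp only [whiskerLeft_comp, Category.assoc]
    rw [← whiskerLeft_comp_assoc D.G (D.one ▷ D.K), BraidedCategory.braiding_naturality_left,
      braiding_tensorUnit_left]
    calc
      _ = 𝟙 _ ⊗≫ ((D.G ⊗ D.K) ◁ D.one ≫ D.μ ▷ D.H) := by monoidal
      _ = _ := by
        rw [whisker_exchange]
        monoidal
  rw [ξ, Category.assoc, h, MonoidalCategory.tensorHom_def, rightUnitor_inv_naturality_assoc,
    unitors_inv_equal]

/-- By naturality only `G ⊗ G` matters. There `π` turns `mul₂` into composition of actions, so `π (h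
· ξ)` acts as `π ξ` followed by the action of `h`, and `π ξ = 1 ⊗ 1` acts trivially. -/
lemma ev_tensor (M N : C) :
    D.ev (M ⊗ N) = D.comul ▷ (M ⊗ N) ≫ tensorμ D.H D.H M N ≫ (D.ev M ⊗ₘ D.ev N) := by
  refine D.ext_generates₂ fun p q => ?_
  have h1 : D.μ₂ ▷ (D.G ⊗ D.G) ≫ D.π ▷ (D.G ⊗ D.G) ≫ tensorμ D.H D.H D.G D.G ≫
      (D.ev D.G ⊗ₘ D.ev D.G) = (α_ _ _ _).hom ≫ (D.G ⊗ D.G) ◁ nestedPairing D.e ≫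
        tensorμ D.G D.G D.T D.T ≫ (D.a ⊗ₘ D.a) := by
    rw [← comp_whiskerRight_assoc, D.π_eq, nestedMul_ev D.ev_eq]
  have h2 := mul_ev_of_epi D.naturality (D.unitGenerated.tensor D.unitGenerated) h1 D.mul₂_eq
  have h3 : D.ξ ▷ (D.G ⊗ D.G) ≫ D.π ▷ (D.G ⊗ D.G) ≫ tensorμ D.H D.H D.G D.G ≫
      (D.ev D.G ⊗ₘ D.ev D.G) = (λ_ (D.G ⊗ D.G)).hom := by
    rw [← comp_whiskerRight_assoc, D.ξ_π, comp_whiskerRight, Category.assoc,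
      tensorμ_natural_left_assoc, tensorHom_comp_tensorHom, D.one_ev]
    exact (tensor_left_unitality _ _).symm
  have h4 : D.comul ▷ (D.G ⊗ D.G) ≫ tensorμ D.H D.H D.G D.G ≫ (D.ev D.G ⊗ₘ D.ev D.G) =
      D.ev (D.G ⊗ D.G) := by
    simp only [comul, comp_whiskerRight, Category.assoc]
    rw [h2, associator_naturality_middle_assoc, ← whiskerLeft_comp_assoc, h3]
    simp
  rw [D.naturality, whisker_exchange_assoc, tensorμ_natural_right_assoc, tensorHom_comp_tensorHom,
    D.naturality, D.naturality, ← tensorHom_comp_tensorHom, ← h4]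
  simp

/-- The action of `H` on all objects, with the structure maps of `H`. -/
def naturalAction : NaturalAction D.H where
  mul := D.mul
  one := D.one
  comul := D.comul
  counit := D.counit
  ev := D.ev
  naturality := D.naturality
  mul_ev := D.mul_ev
  one_ev := D.one_ev_apply
  ev_tensor := D.ev_tensor
  ev_unit := by simp [counit]
  G := D.G
  separates := D.separates

lemma ev_antipode :
    D.ev D.K ▷ D.G ≫ D.e = (β_ D.H D.K).hom ▷ D.G ≫ (α_ D.K D.H D.G).hom ≫
      D.K ◁ (D.antipode ▷ D.G ≫ D.ev D.G) ≫ D.e :=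
  ev_whiskerRight_comp (ev_whiskerRight_comp_of_epi D.unitGenerated D.naturality D.a_e D.b_e
    D.ev_eq D.ν_eq D.ψ_eq) D.one_ν (by simp [antipode])

/-- The Hopf monoid structure. -/
@[reducible]
def hopfObj : HopfObj D.H where
  __ := D.naturalAction.bimonObj
  antipode := D.antipode
  antipode_left := by
    refine D.naturalAction.ext ?_
    change (D.comul ≫ D.antipode ▷ D.H ≫ D.mul) ▷ D.G ≫ D.ev D.G =
      (D.counit ≫ D.one) ▷ D.G ≫ D.ev D.G
    -- Both sides are compared through their action on `G`: the product acts by composition, the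
    -- unit trivially.
    have h := comul_antipode_ev D.naturality D.ev_antipode D.ev_tensor
      D.naturalAction.ev_unit D.unitGenerated
      (eq_of_whiskerLeft_comp_eq D.naturality D.one_ev_apply D.ev_eq)
    simp only [comp_whiskerRight, Category.assoc]
    rw [D.mul_ev, D.one_ev, associator_naturality_left_assoc, ← whisker_exchange_assoc]
    exact h
  antipode_right := by
    refine D.naturalAction.ext ?_
    change (D.comul ≫ D.H ◁ D.antipode ≫ D.mul) ▷ D.G ≫ D.ev D.G =
      (D.counit ≫ D.one) ▷ D.G ≫ D.ev D.G
    have h := comul_ev_antipode D.naturality D.naturalAction.ev_unit D.one_ev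
      (ev_whiskerRight_ev D.naturality D.ev_antipode D.ev_tensor
        D.unitGenerated D.ev_eq)
    simp only [comp_whiskerRight, Category.assoc]
    rw [D.mul_ev, D.one_ev, associator_naturality_middle_assoc, ← whiskerLeft_comp_assoc]
    exact h

end TransmutationData

end BraidedHopf

/-! ### Calculus of Sweedler sums -/

section Sweedler

open scoped TensorProduct

variable {k U V W X M N : Type*} [Field k] [AddCommGroup U] [Module k U] [AddCommGroup V]
  [Module k V] [AddCommGroup W] [Module k W] [AddCommGroup X] [Module k X]
  [AddCommGroup M] [AddCommGroup N]

/-- The sum runs over a fixed finite presentation of the tensor, so additivity of `L` is enough and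
nothing is required of `f`. -/
lemma map_sweedler₂ {F : Type*} [FunLike F M N] [AddMonoidHomClass F M N] (L : F) (t : V ⊗[k] W)
    (f : V → W → M) : L (sweedler₂ t f) = sweedler₂ t fun v w => L (f v w) := by
  rw [sweedler₂, map_multiset_sum, Multiset.map_map]
  rfl

lemma map_sweedler₃ {F : Type*} [FunLike F M N] [AddMonoidHomClass F M N] (L : F)
    (t : U ⊗[k] (V ⊗[k] W)) (f : U → V → W → M) :
    L (sweedler₃ t f) = sweedler₃ t fun u v w => L (f u v w) := by
  simp only [sweedler₃, map_sweedler₂]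

lemma sweedler₂_comm (t : V ⊗[k] W) (s : U ⊗[k] X) (f : V → W → U → X → M) :
    (sweedler₂ t fun v w => sweedler₂ s fun u x => f v w u x) =
      sweedler₂ s fun u x => sweedler₂ t fun v w => f v w u x := by
  simp only [sweedler₂]
  exact Multiset.sum_map_sum_map _ _

variable [Module k M]

/-- The passage between sums over a chosen presentation and values of linear maps, which do not
depend on it. -/
lemma sweedler₂_tmul (t : V ⊗[k] W) (L : V ⊗[k] W →ₗ[k] M) :
    (sweedler₂ t fun v w => L (v ⊗ₜ w)) = L t := by
  exact (sweedler₂_eq_lift t _ ((TensorProduct.mk k V W).compr₂ L) fun _ _ => rfl).trans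
    (by rw [TensorProduct.lift_mk_compr₂])

lemma sweedler₃_tmul (t : U ⊗[k] (V ⊗[k] W)) (L : U ⊗[k] (V ⊗[k] W) →ₗ[k] M) :
    (sweedler₃ t fun u v w => L (u ⊗ₜ (v ⊗ₜ w))) = L t := by
  rw [← sweedler₂_tmul]
  exact congrArg (sweedler₂ t) (funext fun u => funext fun s =>
    sweedler₂_tmul s (L ∘ₗ TensorProduct.mk k U (V ⊗[k] W) u))

lemma sweedler₄_tmul (t : U ⊗[k] (V ⊗[k] (W ⊗[k] X))) (L : U ⊗[k] (V ⊗[k] (W ⊗[k] X)) →ₗ[k] M) :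
    (sweedler₄ t fun u v w x => L (u ⊗ₜ (v ⊗ₜ (w ⊗ₜ x)))) = L t := by
  rw [← sweedler₂_tmul]
  exact congrArg (sweedler₂ t) (funext fun u => funext fun s =>
    sweedler₃_tmul s (L ∘ₗ TensorProduct.mk k U _ u))

end Sweedler

/-! ### The constraints of the module category on elements -/

namespace QuasitriangularQuasiHopfAlgebra

open scoped TensorProduct

variable {k H : Type u} [Field k] [Ring H] [Algebra k H] {A : QuasitriangularQuasiHopfAlgebra k H}

namespace Rep

section Elements

variable {M N P Q M' N' : A.Rep}

/-- A pure tensor in a tensor product of modules. -/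
def tmul (m : M.V) (n : N.V) : (M ⊗ N : A.Rep).V := m ⊗ₜ[k] n

local infixl:70 " ⊠ " => tmul

lemma lin_whiskerLeft (f : N ⟶ N') (m : M.V) (n : N.V) :
    lin (M ◁ f) (m ⊠ n) = m ⊠ lin f n := rfl

lemma lin_whiskerRight (f : M ⟶ M') (m : M.V) (n : N.V) :
    lin (f ▷ N) (m ⊠ n) = lin f m ⊠ n := rfl

lemma hom_ext₂ {f g : M ⊗ N ⟶ P} (h : ∀ m n, lin f (m ⊠ n) = lin g (m ⊠ n)) : f = g :=
  hom_ext fun x => LinearMap.congr_fun (TensorProduct.ext' h) x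

lemma hom_ext₃ {f g : (M ⊗ N) ⊗ P ⟶ Q}
    (h : ∀ m n p, lin f ((m ⊠ n) ⊠ p) = lin g ((m ⊠ n) ⊠ p)) : f = g :=
  hom_ext fun x => LinearMap.congr_fun (TensorProduct.ext_threefold h) x

lemma hom_ext₃' {f g : M ⊗ (N ⊗ P) ⟶ Q}
    (h : ∀ m n p, lin f (m ⊠ (n ⊠ p)) = lin g (m ⊠ (n ⊠ p))) : f = g :=
  hom_ext fun x => LinearMap.congr_fun (TensorProduct.ext_threefold' h) x

lemma tmul_sweedler₂ {U V : Type*} [AddCommGroup U] [Module k U] [AddCommGroup V] [Module k V]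
    (m : M.V) (t : U ⊗[k] V) (f : U → V → N.V) :
    m ⊠ sweedler₂ t f = sweedler₂ t fun u v => m ⊠ f u v :=
  map_sweedler₂ (TensorProduct.mk k M.V N.V m) t f

lemma sweedler₂_tmul_right {U V : Type*} [AddCommGroup U] [Module k U] [AddCommGroup V]
    [Module k V] (n : N.V) (t : U ⊗[k] V) (f : U → V → M.V) :
    sweedler₂ t f ⊠ n = sweedler₂ t fun u v => f u v ⊠ n :=
  map_sweedler₂ ((TensorProduct.mk k M.V N.V).flip n) t f

lemma lin_sweedler₂ {U V : Type*} [AddCommGroup U] [Module k U] [AddCommGroup V]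
    [Module k V] (g : M ⟶ N) (t : U ⊗[k] V) (f : U → V → M.V) :
    lin g (sweedler₂ t f) = sweedler₂ t fun u v => lin g (f u v) :=
  map_sweedler₂ _ t f

lemma ρ_tmul (h : H) (m : M.V) (n : N.V) :
    (M ⊗ N : A.Rep).ρ h (m ⊠ n) = sweedler₂ (A.comul h) fun a b => M.ρ a m ⊠ N.ρ b n :=
  (sweedler₂_tmul (A.comul h) ((tensorAction M.ρ N.ρ).toLinearMap.flip (m ⊗ₜ n))).symm

lemma lin_associator (m : M.V) (n : N.V) (p : P.V) :
    lin (α_ M N P).hom ((m ⊠ n) ⊠ p) = sweedler₃ (A.Φ : H ⊗[k] (H ⊗[k] H)) fun a b c =>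
      M.ρ a m ⊠ (N.ρ b n ⊠ P.ρ c p) :=
  (sweedler₃_tmul (A.Φ : H ⊗[k] (H ⊗[k] H))
    ((tensorAction M.ρ (tensorAction N.ρ P.ρ)).toLinearMap.flip (m ⊗ₜ (n ⊗ₜ p)))).symm

lemma lin_associator_inv (m : M.V) (n : N.V) (p : P.V) :
    lin (α_ M N P).inv (m ⊠ (n ⊠ p)) = sweedler₃ A.Φinv fun a b c =>
      (M.ρ a m ⊠ N.ρ b n) ⊠ P.ρ c p := by
  refine Eq.trans ?_ (sweedler₃_tmul A.Φinv ((TensorProduct.assoc k M.V N.V P.V).symm.toLinearMap ∘ₗ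
    (tensorAction M.ρ (tensorAction N.ρ P.ρ)).toLinearMap.flip (m ⊗ₜ (n ⊗ₜ p)))).symm
  rfl

lemma lin_braiding (m : M.V) (n : N.V) :
    lin (β_ M N).hom (m ⊠ n) = sweedler₂ (A.R : H ⊗[k] H) fun a b => N.ρ b n ⊠ M.ρ a m :=
  (sweedler₂_tmul (A.R : H ⊗[k] H) ((TensorProduct.comm k M.V N.V).toLinearMap ∘ₗ
    (tensorAction M.ρ N.ρ).toLinearMap.flip (m ⊗ₜ n))).symm

/-- The element `1` of the tensor unit. -/
def unitOne (A : QuasitriangularQuasiHopfAlgebra k H) : (𝟙_ A.Rep).V := (1 : k)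

lemma lin_leftUnitor_inv (m : M.V) : lin (λ_ M).inv m = unitOne A ⊠ m := rfl

lemma lin_rightUnitor_inv (m : M.V) : lin (ρ_ M).inv m = m ⊠ unitOne A := rfl

/-- The defining axiom only normalises the middle leg of `Φ`. For the outer legs the triviality of
the associator on points is taken from monoidal coherence. -/
lemma lin_associator_unit_left (m : M.V) (n : N.V) (t : 𝟙_ A.Rep ⟶ P) :
    lin (α_ P M N).hom ((lin t (unitOne A) ⊠ m) ⊠ n) = lin t (unitOne A) ⊠ (m ⊠ n) := by
  have h : (λ_ M).inv ▷ N ≫ t ▷ M ▷ N ≫ (α_ P M N).hom = (λ_ (M ⊗ N)).inv ≫ t ▷ (M ⊗ N) := by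
    simp
  exact congrArg (fun f => lin f (m ⊠ n)) h

lemma lin_associator_unit_middle (m : M.V) (n : N.V) (t : 𝟙_ A.Rep ⟶ P) :
    lin (α_ M P N).hom ((m ⊠ lin t (unitOne A)) ⊠ n) = m ⊠ (lin t (unitOne A) ⊠ n) := by
  have h : (ρ_ M).inv ▷ N ≫ (M ◁ t) ▷ N ≫ (α_ M P N).hom = M ◁ ((λ_ N).inv ≫ t ▷ N) := by
    monoidal
  exact congrArg (fun f => lin f (m ⊠ n)) h

lemma lin_associator_unit_right (m : M.V) (n : N.V) (t : 𝟙_ A.Rep ⟶ P) :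
    lin (α_ M N P).hom ((m ⊠ n) ⊠ lin t (unitOne A)) = m ⊠ (n ⊠ lin t (unitOne A)) := by
  have h : (ρ_ (M ⊗ N)).inv ≫ (M ⊗ N) ◁ t ≫ (α_ M N P).hom = M ◁ ((ρ_ N).inv ≫ N ◁ t) := by
    monoidal
  exact congrArg (fun f => lin f (m ⊠ n)) h

end Elements

end Rep

end QuasitriangularQuasiHopfAlgebra

section Sweedler

open scoped TensorProduct

variable {k V W B : Type*} [Field k] [AddCommGroup V] [Module k V] [AddCommGroup W]
  [Module k W] [Ring B]

lemma mul_sweedler₂ (x : B) (t : V ⊗[k] W) (f : V → W → B) :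
    x * sweedler₂ t f = sweedler₂ t fun v w => x * f v w :=
  map_sweedler₂ (AddMonoidHom.mulLeft x) t f

lemma sweedler₂_mul (x : B) (t : V ⊗[k] W) (f : V → W → B) :
    sweedler₂ t f * x = sweedler₂ t fun v w => f v w * x :=
  map_sweedler₂ (AddMonoidHom.mulRight x) t f

end Sweedler

/-! ### The regular, coregular and trivial modules and their products -/

namespace QuasitriangularQuasiHopfAlgebra

open scoped TensorProduct

variable {k H : Type u} [Field k] [Ring H] [Algebra k H] (A : QuasitriangularQuasiHopfAlgebra k H)

namespace Rep

local infixl:70 " ⊠ " => tmul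

/-- The regular module. -/
def regular : A.Rep where
  V := H
  ρ := Algebra.lmul k H

/-- The module `H` with the action `y ▷ a = a S(y)`. -/
noncomputable def coregular : A.Rep where
  V := H
  ρ := A.mulRightAntipode

/-- The vector space `H` with the trivial action. -/
def trivial : A.Rep where
  V := H
  ρ := (Algebra.ofId k (Module.End k H)).comp A.counit

/-- The elements of the regular module. -/
def toRegular : H →ₗ[k] (regular A).V := LinearMap.id

/-- The elements of the coregular module. -/
noncomputable def toCoregular : H →ₗ[k] (coregular A).V := LinearMap.id

/-- The elements of the trivial module. -/
def toTrivial : H →ₗ[k] (trivial A).V := LinearMap.id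

/-- The elements of the transmuted Hopf algebra. -/
noncomputable def toTransmuted : H →ₗ[k] A.transmuted.V := LinearMap.id

variable {A}

lemma ρ_regular (h x : H) : (regular A).ρ h (toRegular A x) = toRegular A (h * x) := rfl

lemma ρ_coregular (h x : H) :
    (coregular A).ρ h (toCoregular A x) = toCoregular A (x * A.S h) := rfl

lemma ρ_trivial (h x : H) :
    (trivial A).ρ h (toTrivial A x) = toTrivial A (A.counit h • x) := rfl

lemma ρ_transmuted (h x : H) :
    A.transmuted.ρ h (toTransmuted A x) = toTransmuted A (A.adjoint h x) := rfl

/-- A morphism on a tensor product, from a bilinear map. -/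
noncomputable def mkHom₂ {M N P : A.Rep} (B : M.V →ₗ[k] N.V →ₗ[k] P.V)
    (hB : ∀ h m n, (sweedler₂ (A.comul h) fun a b => B (M.ρ a m) (N.ρ b n)) = P.ρ h (B m n)) :
    M ⊗ N ⟶ P :=
  mkHom (M := M ⊗ N) (TensorProduct.lift B) fun h x => LinearMap.congr_fun
    (TensorProduct.ext' fun m n => (congrArg (TensorProduct.lift B) (ρ_tmul h m n)).trans
      ((map_sweedler₂ (TensorProduct.lift B) (A.comul h) _).trans (hB h m n)) :
      TensorProduct.lift B ∘ₗ (M ⊗ N : A.Rep).ρ h = P.ρ h ∘ₗ TensorProduct.lift B) x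

lemma lin_mkHom₂ {M N P : A.Rep} (B : M.V →ₗ[k] N.V →ₗ[k] P.V) (hB) (m : M.V) (n : N.V) :
    lin (mkHom₂ (M := M) (N := N) (P := P) B hB) (m ⊠ n) = B m n := rfl

lemma sweedler_counit_right {U : Type*} [AddCommGroup U] [Module k U] (h : H) (L : H →ₗ[k] U) :
    (sweedler₂ (A.comul h) fun a b => A.counit b • L a) = L h := by
  have := congrArg (TensorProduct.lift ((LinearMap.lsmul k U).flip ∘ₗ L)) (A.counit_right h)
  rw [TensorProduct.lift.tmul] at this
  simp only [LinearMap.comp_apply, LinearMap.flip_apply, LinearMap.lsmul_apply, one_smul] at this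
  rw [← this]
  exact sweedler₂_tmul (A.comul h) ((TensorProduct.lift ((LinearMap.lsmul k U).flip ∘ₗ L)) ∘ₗ
    (Algebra.TensorProduct.map (AlgHom.id k H) A.counit).toLinearMap)

lemma sweedler_counit_left {U : Type*} [AddCommGroup U] [Module k U] (h : H) (L : H →ₗ[k] U) :
    (sweedler₂ (A.comul h) fun a b => A.counit a • L b) = L h := by
  have := congrArg (TensorProduct.lift ((LinearMap.lsmul k U).compl₂ L)) (A.counit_left h)
  rw [TensorProduct.lift.tmul] at this
  simp only [LinearMap.compl₂_apply, LinearMap.lsmul_apply, one_smul] at this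
  rw [← this]
  exact sweedler₂_tmul (A.comul h) ((TensorProduct.lift ((LinearMap.lsmul k U).compl₂ L)) ∘ₗ
    (Algebra.TensorProduct.map A.counit (AlgHom.id k H)).toLinearMap)

lemma sweedler_S_left (h : H) :
    (sweedler₂ (A.comul h) fun a b => A.S a * (A.α * b)) = A.counit h • A.α := by
  rw [← A.S_left h, ← sweedler₂_tmul]
  rfl

lemma sweedler_S_right (h : H) :
    (sweedler₂ (A.comul h) fun a b => a * A.β * A.S b) = A.counit h • A.β := by
  rw [← A.S_right h, ← sweedler₂_tmul]
  rfl

lemma sweedler_S_Φ :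
    (sweedler₃ (A.Φ : H ⊗[k] (H ⊗[k] H)) fun a b c => a * A.β * (A.S b * (A.α * c))) = 1 := by
  rw [← A.S_Φ, ← sweedler₃_tmul]
  rfl

lemma sweedler_S_Φinv :
    (sweedler₃ A.Φinv fun a b c => A.S a * (A.α * (b * A.β * A.S c))) = 1 := by
  refine Eq.trans ?_ A.S_Φ_inv
  exact sweedler₃_tmul A.Φinv (TensorProduct.lift ((LinearMap.mul k H).compl₁₂ A.S.toLinearMap
      (LinearMap.mulLeft k A.α ∘ₗ TensorProduct.lift
        ((LinearMap.mul k H).compl₁₂ (LinearMap.mulRight k A.β) A.S.toLinearMap))))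

/-- The action of `H` on an element, as a morphism. -/
noncomputable def orbit {M : A.Rep} (m : M.V) : regular A ⟶ M :=
  mkHom (M := regular A) (M.ρ.toLinearMap.flip m) fun h v =>
    LinearMap.congr_fun (map_mul M.ρ h v) m

lemma lin_orbit {M : A.Rep} (m : M.V) (h : H) : lin (orbit m) (toRegular A h) = M.ρ h m := rfl

lemma lin_orbit_one {M : A.Rep} (m : M.V) : lin (orbit m) (toRegular A 1) = m := by
  rw [lin_orbit, map_one, Module.End.one_apply]

/-- An element of a trivial module, as a morphism. -/
noncomputable def trivialElement (t : H) : 𝟙_ A.Rep ⟶ trivial A :=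
  mkHom (M := unitObj) (N := trivial A) (LinearMap.toSpanSingleton k H t) fun h c =>
    mul_smul (A.counit h) (c : k) t

lemma lin_trivialElement (t : H) :
    lin (trivialElement (A := A) t) (unitOne A) = toTrivial A t :=
  one_smul k t

/-- On a trivial module the action is by the counit, so every element is a morphism from the tensor
unit. -/
lemma unitGenerated_trivial : BraidedHopf.UnitGenerated (trivial A) := by
  intro X Y Z f g h
  refine hom_ext₃' fun x (t : H) y => ?_
  have := congrArg (fun f => lin f (x ⊠ (unitOne A ⊠ y))) (h (trivialElement t))
  simp only [lin_comp, lin_whiskerLeft, lin_whiskerRight] at this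
  rw [lin_trivialElement t] at this
  exact this

/-- Every element of a module is the image of `1` under its orbit morphism. -/
lemma regular_generates {X M Y Z : A.Rep} {f g : X ⊗ (M ⊗ Y) ⟶ Z}
    (h : ∀ p : regular A ⟶ M, X ◁ p ▷ Y ≫ f = X ◁ p ▷ Y ≫ g) : f = g := by
  refine hom_ext₃' fun x m y => ?_
  have := congrArg (fun f => lin f (x ⊠ (toRegular A 1 ⊠ y))) (h (orbit m))
  simpa only [lin_comp, lin_whiskerLeft, lin_whiskerRight, lin_orbit_one] using this

variable (A)

/-- The multiplication `regular ⊗ coregular ⟶ transmuted`. -/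
noncomputable def μ : regular A ⊗ coregular A ⟶ A.transmuted :=
  mkHom₂ (M := regular A) (N := coregular A) (P := A.transmuted) (LinearMap.mul k H)
    fun h (m n : H) => by
    refine Eq.trans ?_ (adjoint_apply A h (m * n)).symm
    refine congrArg (sweedler₂ (A.comul h)) (funext fun a => funext fun b => ?_)
    change (a * m) * (n * A.S b) = a * (m * n) * A.S b
    simp only [mul_assoc]

/-- The pairing `x ⊗ m ↦ x α m`. -/
noncomputable def e : coregular A ⊗ regular A ⟶ trivial A :=
  mkHom₂ (M := coregular A) (N := regular A) (P := trivial A)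
    (LinearMap.mul k H ∘ₗ LinearMap.mulRight k A.α) fun h (x m : H) => by
    -- Equivariance of the pairing is the antipode axiom `S(h₁) α h₂ = ε(h) α`.
    have h1 := congrArg (fun z : H => x * z * m) (sweedler_S_left (A := A) h)
    simp only [mul_sweedler₂, sweedler₂_mul] at h1
    refine Eq.trans ?_ (h1.trans ?_)
    · refine congrArg (sweedler₂ (A.comul h)) (funext fun a => funext fun b => ?_)
      change (x * A.S a) * A.α * (b * m) = x * (A.S a * (A.α * b)) * m
      simp only [mul_assoc]
    · change x * (A.counit h • A.α) * m = A.counit h • (x * A.α * m)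
      simp

/-- The right multiplication of a trivial module on the regular module. -/
noncomputable def a : regular A ⊗ trivial A ⟶ regular A :=
  mkHom₂ (M := regular A) (N := trivial A) (P := regular A) (LinearMap.mul k H)
    fun h (m t : H) => by
    refine Eq.trans ?_ ((sweedler_counit_right (A := A) h (LinearMap.mulRight k (m * t))).trans
      rfl)
    refine congrArg (sweedler₂ (A.comul h)) (funext fun a => funext fun b => ?_)
    change (a * m) * (A.counit b • t) = A.counit b • (a * (m * t))
    simp [mul_assoc]

/-- The left multiplication of a trivial module on the coregular module. -/
noncomputable def b : trivial A ⊗ coregular A ⟶ coregular A :=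
  mkHom₂ (M := trivial A) (N := coregular A) (P := coregular A) (LinearMap.mul k H)
    fun h (t x : H) => by
    refine Eq.trans ?_ ((sweedler_counit_left (A := A) h
      (LinearMap.mulLeft k (t * x) ∘ₗ A.S.toLinearMap)).trans rfl)
    refine congrArg (sweedler₂ (A.comul h)) (funext fun a => funext fun b => ?_)
    change (A.counit a • t) * (x * A.S b) = A.counit a • (t * x * A.S b)
    simp [mul_assoc]

/-- The multiplication of the trivial module. -/
noncomputable def m : trivial A ⊗ trivial A ⟶ trivial A :=
  mkHom₂ (M := trivial A) (N := trivial A) (P := trivial A) (LinearMap.mul k H)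
    fun h (s t : H) => by
    refine Eq.trans ?_ ((sweedler_counit_right (A := A) h
      (LinearMap.toSpanSingleton k H (s * t) ∘ₗ A.counit.toLinearMap)).trans rfl)
    refine congrArg (sweedler₂ (A.comul h)) (funext fun a => funext fun b => ?_)
    change (A.counit a • s) * (A.counit b • t) = A.counit b • (A.counit a • (s * t))
    simp [smul_smul]

variable {A}

lemma lin_μ (x y : H) :
    lin (μ A) (toRegular A x ⊠ toCoregular A y) = toTransmuted A (x * y) := rfl

lemma lin_e (x y : H) :
    lin (e A) (toCoregular A x ⊠ toRegular A y) = toTrivial A (x * A.α * y) := rfl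

lemma lin_a (x t : H) :
    lin (a A) (toRegular A x ⊠ toTrivial A t) = toRegular A (x * t) := rfl

lemma lin_b (t x : H) :
    lin (b A) (toTrivial A t ⊠ toCoregular A x) = toCoregular A (t * x) := rfl

lemma lin_m (s t : H) :
    lin (m A) (toTrivial A s ⊠ toTrivial A t) = toTrivial A (s * t) := rfl

lemma lin_associator_trivial_left {M N : A.Rep} (t : H) (x : M.V) (y : N.V) :
    lin (α_ (trivial A) M N).hom ((toTrivial A t ⊠ x) ⊠ y) = toTrivial A t ⊠ (x ⊠ y) := by
  have := lin_associator_unit_left x y (trivialElement t)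
  rwa [lin_trivialElement] at this

lemma lin_associator_trivial_middle {M N : A.Rep} (t : H) (x : M.V) (y : N.V) :
    lin (α_ M (trivial A) N).hom ((x ⊠ toTrivial A t) ⊠ y) = x ⊠ (toTrivial A t ⊠ y) := by
  have := lin_associator_unit_middle x y (trivialElement t)
  rwa [lin_trivialElement] at this

lemma lin_associator_trivial_right {M N : A.Rep} (t : H) (x : M.V) (y : N.V) :
    lin (α_ M N (trivial A)).hom ((x ⊠ y) ⊠ toTrivial A t) = x ⊠ (y ⊠ toTrivial A t) := by
  have := lin_associator_unit_right x y (trivialElement t)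
  rwa [lin_trivialElement] at this

lemma a_μ : a A ▷ coregular A ≫ μ A =
    (α_ (regular A) (trivial A) (coregular A)).hom ≫ regular A ◁ b A ≫ μ A := by
  refine hom_ext₃ fun (x t y : H) => ?_
  change lin (_ ≫ _) ((toRegular A x ⊠ toTrivial A t) ⊠ toCoregular A y) =
    lin (_ ≫ _ ≫ _) ((toRegular A x ⊠ toTrivial A t) ⊠ toCoregular A y)
  simp only [lin_comp, lin_associator_trivial_middle, lin_whiskerLeft, lin_whiskerRight, lin_a,
    lin_b, lin_μ, mul_assoc]

lemma a_e : coregular A ◁ a A ≫ e A =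
    (α_ (coregular A) (regular A) (trivial A)).inv ≫ e A ▷ trivial A ≫ m A := by
  rw [Iso.eq_inv_comp]
  refine hom_ext₃ fun (x y t : H) => ?_
  change lin (_ ≫ _ ≫ _) ((toCoregular A x ⊠ toRegular A y) ⊠ toTrivial A t) =
    lin (_ ≫ _) ((toCoregular A x ⊠ toRegular A y) ⊠ toTrivial A t)
  simp only [lin_comp, lin_associator_trivial_right, lin_whiskerLeft, lin_whiskerRight, lin_a,
    lin_e, lin_m, mul_assoc]

lemma b_e : b A ▷ regular A ≫ e A =
    (α_ (trivial A) (coregular A) (regular A)).hom ≫ trivial A ◁ e A ≫ m A := by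
  refine hom_ext₃ fun (t x y : H) => ?_
  change lin (_ ≫ _) ((toTrivial A t ⊠ toCoregular A x) ⊠ toRegular A y) =
    lin (_ ≫ _ ≫ _) ((toTrivial A t ⊠ toCoregular A x) ⊠ toRegular A y)
  simp only [lin_comp, lin_associator_trivial_left, lin_whiskerLeft, lin_whiskerRight, lin_b,
    lin_e, lin_m, mul_assoc]

end Rep

end QuasitriangularQuasiHopfAlgebra

/-! ### Descent along `μ` -/

namespace QuasitriangularQuasiHopfAlgebra

open scoped TensorProduct

variable {k H : Type u} [Field k] [Ring H] [Algebra k H] {A : QuasitriangularQuasiHopfAlgebra k H}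

namespace Rep

local infixl:70 " ⊠ " => tmul

lemma toRegular_surjective (x : (regular A).V) : ∃ y : H, toRegular A y = x := ⟨x, rfl⟩

lemma toCoregular_surjective (x : (coregular A).V) : ∃ y : H, toCoregular A y = x := ⟨x, rfl⟩

lemma toTransmuted_surjective (x : A.transmuted.V) : ∃ y : H, toTransmuted A y = x := ⟨x, rfl⟩

section Descent

variable {M N P Q X Y : A.Rep}

/-- A linear section of a morphism. -/
structure LinearSection (p : M ⟶ N) where
  /-- The linear map. -/
  s : N.V →ₗ[k] M.V
  lin_s (n : N.V) : lin p (s n) = n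

/-- The section induced on a tensor product by a section of the second factor. -/
noncomputable def LinearSection.whiskerLeft {p : M ⟶ N} (s : LinearSection p) (X : A.Rep) :
    LinearSection (X ◁ p) where
  s := TensorProduct.map LinearMap.id s.s
  lin_s n := LinearMap.congr_fun (TensorProduct.ext' fun x n => congrArg (x ⊠ ·) (s.lin_s n) :
    lin (X ◁ p) ∘ₗ TensorProduct.map LinearMap.id s.s = LinearMap.id) n

/-- The section induced on a tensor product by a section of the first factor. -/
noncomputable def LinearSection.whiskerRight {p : M ⟶ N} (s : LinearSection p) (X : A.Rep) :
    LinearSection (p ▷ X) where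
  s := TensorProduct.map s.s LinearMap.id
  lin_s n := LinearMap.congr_fun (TensorProduct.ext' fun n x => congrArg (· ⊠ x) (s.lin_s n) :
    lin (p ▷ X) ∘ₗ TensorProduct.map s.s LinearMap.id = LinearMap.id) n

lemma LinearSection.epi {p : M ⟶ N} (s : LinearSection p) : Epi p where
  left_cancellation f g h := hom_ext fun n => by
    rw [← s.lin_s n, ← lin_comp, h, lin_comp]

/-- A morphism on a quotient. -/
def LinearSection.desc {p : M ⟶ N} (s : LinearSection p) (f : M ⟶ P)
    (hf : lin f ∘ₗ s.s ∘ₗ lin p = lin f) : N ⟶ P :=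
  mkHom (lin f ∘ₗ s.s) fun h n => by
    -- The section need not be equivariant: `h n` is the image under `p` of `h s(n)`, and `f ∘ s ∘ p
    -- = f`.
    have : N.ρ h n = lin p (M.ρ h (s.s n)) := by rw [lin_comm, s.lin_s]
    rw [LinearMap.comp_apply, this]
    exact (LinearMap.congr_fun hf _).trans (lin_comm f h _)

lemma LinearSection.comp_desc {p : M ⟶ N} (s : LinearSection p) (f : M ⟶ P)
    (hf : lin f ∘ₗ s.s ∘ₗ lin p = lin f) : p ≫ s.desc f hf = f :=
  hom_ext fun m => LinearMap.congr_fun hf m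

variable (A) in
/-- A linear section of the multiplication `μ`. -/
noncomputable def sectionμ : LinearSection (μ A) where
  s := (TensorProduct.mk k H H).flip 1
  lin_s (n : H) := mul_one n

variable {X Y : A.Rep}

/-- Descent along `μ`. -/
noncomputable def descμ (f : regular A ⊗ coregular A ⟶ P)
    (hf : ∀ x y : H, lin f (toRegular A (x * y) ⊠ toCoregular A 1) =
      lin f (toRegular A x ⊠ toCoregular A y)) : A.transmuted ⟶ P :=
  (sectionμ A).desc f (TensorProduct.ext' hf)

lemma μ_descμ (f : regular A ⊗ coregular A ⟶ P) (hf) : μ A ≫ descμ f hf = f :=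
  LinearSection.comp_desc _ _ (TensorProduct.ext' hf)

/-- Descent along `X ◁ μ`. -/
noncomputable def descLeft (f : X ⊗ (regular A ⊗ coregular A) ⟶ P)
    (hf : ∀ (p : X.V) (x y : H), lin f (p ⊠ (toRegular A (x * y) ⊠ toCoregular A 1)) =
      lin f (p ⊠ (toRegular A x ⊠ toCoregular A y))) : X ⊗ A.transmuted ⟶ P :=
  ((sectionμ A).whiskerLeft X).desc f (TensorProduct.ext_threefold' hf)

lemma whiskerLeft_descLeft (f : X ⊗ (regular A ⊗ coregular A) ⟶ P) (hf) :
    X ◁ μ A ≫ descLeft f hf = f :=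
  LinearSection.comp_desc _ _ (TensorProduct.ext_threefold' hf)

/-- Descent along `μ ▷ Y`. -/
noncomputable def descRight (f : (regular A ⊗ coregular A) ⊗ Y ⟶ P)
    (hf : ∀ (x y : H) (q : Y.V), lin f ((toRegular A (x * y) ⊠ toCoregular A 1) ⊠ q) =
      lin f ((toRegular A x ⊠ toCoregular A y) ⊠ q)) : A.transmuted ⊗ Y ⟶ P :=
  ((sectionμ A).whiskerRight Y).desc f (TensorProduct.ext_threefold hf)

/-- Descent along `X ◁ μ ▷ Y`. -/
noncomputable def descMiddle (f : X ⊗ ((regular A ⊗ coregular A) ⊗ Y) ⟶ P)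
    (hf : ∀ (p : X.V) (x y : H) (q : Y.V),
      lin f (p ⊠ ((toRegular A (x * y) ⊠ toCoregular A 1) ⊠ q)) =
        lin f (p ⊠ ((toRegular A x ⊠ toCoregular A y) ⊠ q))) :
    X ⊗ (A.transmuted ⊗ Y) ⟶ P :=
  (((sectionμ A).whiskerRight Y).whiskerLeft X).desc f (TensorProduct.ext' fun p r =>
    LinearMap.congr_fun (TensorProduct.ext_threefold (hf p) :
      (lin f ∘ₗ (((sectionμ A).whiskerRight Y).whiskerLeft X).s ∘ₗ lin (X ◁ μ A ▷ Y)) ∘ₗ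
        TensorProduct.mk k X.V _ p = lin f ∘ₗ TensorProduct.mk k X.V _ p) r)

lemma whiskerLeft_descMiddle (f : X ⊗ ((regular A ⊗ coregular A) ⊗ Y) ⟶ P) (hf) :
    X ◁ (μ A ▷ Y) ≫ descMiddle f hf = f :=
  LinearSection.comp_desc _ _ _

end Descent

/-! ### The action of the transmuted algebra on modules -/

section Evaluation

variable (A) in
/-- The action of the transmuted Hopf algebra on the regular module. -/
noncomputable def evRegular : A.transmuted ⊗ regular A ⟶ regular A :=
  descRight ((α_ (regular A) (coregular A) (regular A)).hom ≫ regular A ◁ e A ≫ a A)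
    fun x y q => by
      obtain ⟨q, rfl⟩ := toRegular_surjective q
      simp only [lin_comp, lin_associator, sweedler₃, lin_sweedler₂, lin_whiskerLeft, ρ_regular,
        ρ_coregular, lin_e, lin_a, mul_assoc, one_mul]

variable (A) in
/-- The element `X₁ a S(X₂) α X₃` by which the element `a` of the transmuted Hopf algebra acts. -/
noncomputable def θ : H →ₗ[k] H :=
  lin (evRegular A) ∘ₗ (TensorProduct.mk k H H).flip 1

lemma θ_apply (x : H) : θ A x = sweedler₃ (A.Φ : H ⊗[k] (H ⊗[k] H)) fun X₁ X₂ X₃ =>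
    X₁ * x * A.S X₂ * A.α * X₃ := by
  have : lin ((α_ (regular A) (coregular A) (regular A)).hom ≫ regular A ◁ e A ≫ a A)
      ((toRegular A x ⊠ toCoregular A 1) ⊠ toRegular A 1) =
      toRegular A (sweedler₃ (A.Φ : H ⊗[k] (H ⊗[k] H)) fun X₁ X₂ X₃ =>
        X₁ * x * A.S X₂ * A.α * X₃) := by
    simp only [lin_comp, lin_associator, sweedler₃, lin_whiskerLeft, ρ_regular, ρ_coregular,
      lin_e, lin_a, mul_assoc, one_mul, mul_one, map_sweedler₂]
  exact this

lemma lin_evRegular (x y : H) :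
    lin (evRegular A) (toTransmuted A x ⊠ toRegular A y) = toRegular A (θ A x * y) := by
  have : lin ((α_ (regular A) (coregular A) (regular A)).hom ≫ regular A ◁ e A ≫ a A)
      ((toRegular A x ⊠ toCoregular A 1) ⊠ toRegular A y) = toRegular A (θ A x * y) := by
    simp only [θ_apply, lin_comp, lin_associator, sweedler₃, lin_whiskerLeft, ρ_regular,
      ρ_coregular, lin_e, lin_a, mul_assoc, one_mul, map_sweedler₂, sweedler₂_mul]
  exact this

/-- Equivariance of the action on the regular module, evaluated at `1`. This single identity makes
`x ⊗ m ↦ θ(x) m` a module morphism for every module. -/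
lemma sweedler_θ_adjoint (h x : H) :
    (sweedler₂ (A.comul h) fun a b => θ A (A.adjoint a x) * b) = h * θ A x := by
  have := lin_comm (evRegular A) h (toTransmuted A x ⊠ toRegular A 1)
  simp only [ρ_tmul, lin_sweedler₂, ρ_transmuted, ρ_regular, lin_evRegular, mul_one,
    ← map_sweedler₂] at this
  exact this

variable (A) in
/-- The action of the transmuted Hopf algebra on a module. -/
noncomputable def ev (M : A.Rep) : A.transmuted ⊗ M ⟶ M :=
  mkHom₂ (M := A.transmuted) (N := M) (M.ρ.toLinearMap ∘ₗ θ A : H →ₗ[k] M.V →ₗ[k] M.V)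
    fun h (x : H) m => by
      refine Eq.trans ?_ (LinearMap.congr_fun (map_mul M.ρ h (θ A x)) m)
      rw [← sweedler_θ_adjoint]
      refine Eq.trans ?_ (map_sweedler₂ (M.ρ.toLinearMap.flip m) (A.comul h) _).symm
      exact congrArg (sweedler₂ (A.comul h)) (funext fun a => funext fun b =>
        (LinearMap.congr_fun (map_mul M.ρ _ _) m).symm)

lemma lin_ev {M : A.Rep} (x : H) (m : M.V) :
    lin (ev A M) (toTransmuted A x ⊠ m) = M.ρ (θ A x) m := rfl

lemma lin_ev_regular (x y : H) :
    lin (ev A (regular A)) (toTransmuted A x ⊠ toRegular A y) = toRegular A (θ A x * y) := rfl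

lemma lin_ev_coregular (x y : H) :
    lin (ev A (coregular A)) (toTransmuted A x ⊠ toCoregular A y) =
      toCoregular A (y * A.S (θ A x)) := rfl

lemma ev_naturality {M N : A.Rep} (f : M ⟶ N) :
    A.transmuted ◁ f ≫ ev A N = ev A M ≫ f := by
  refine hom_ext₂ fun x m => ?_
  obtain ⟨x, rfl⟩ := toTransmuted_surjective x
  simp only [lin_comp, lin_whiskerLeft, lin_ev, lin_comm]

lemma μ_ev : μ A ▷ regular A ≫ ev A (regular A) =
    (α_ (regular A) (coregular A) (regular A)).hom ≫ regular A ◁ e A ≫ a A := by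
  refine hom_ext₃ fun x y z => ?_
  obtain ⟨x, rfl⟩ := toRegular_surjective x
  obtain ⟨y, rfl⟩ := toCoregular_surjective y
  obtain ⟨z, rfl⟩ := toRegular_surjective z
  simp only [lin_ev_regular, θ_apply, lin_comp, lin_associator, sweedler₃, lin_whiskerLeft,
    lin_whiskerRight, lin_μ, ρ_regular, ρ_coregular, lin_e, lin_a, mul_assoc, map_sweedler₂,
    sweedler₂_mul]

variable (A) in
/-- The unit of the transmuted Hopf algebra. -/
noncomputable def one : 𝟙_ A.Rep ⟶ A.transmuted :=
  mkHom (M := unitObj) (N := A.transmuted) (LinearMap.toSpanSingleton k H A.β) fun h (c : k) => by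
    change (A.counit h • c) • A.β = A.adjoint h (c • A.β)
    rw [map_smul, adjoint_apply, sweedler_S_right, smul_smul, smul_eq_mul, mul_comm]

variable (A) in
lemma lin_one : lin (one A) (unitOne A) = toTransmuted A A.β := one_smul k A.β

variable (A) in
-- This is the axiom `X₁ β S(X₂) α X₃ = 1`, and the reason why `β` is the unit.
lemma θ_β : θ A A.β = 1 := by
  rw [θ_apply, ← sweedler_S_Φ (A := A)]
  simp only [mul_assoc]

lemma one_ev : one A ▷ regular A ≫ ev A (regular A) = (λ_ (regular A)).hom := by
  rw [← Iso.inv_comp_eq_id]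
  refine hom_ext fun x => ?_
  rw [lin_comp, lin_comp, lin_leftUnitor_inv, lin_whiskerRight, lin_one, lin_ev, θ_β A, map_one]
  rfl

end Evaluation

/-! ### Multiplication, right action on `K`, and the source of the antipode -/

section Multiplication

variable (A)

/-- The action of the transmuted Hopf algebra on the coregular module. -/
noncomputable def ν : coregular A ⊗ A.transmuted ⟶ coregular A :=
  descLeft ((α_ (coregular A) (regular A) (coregular A)).inv ≫ e A ▷ coregular A ≫ b A)
    fun p x y => by
      obtain ⟨p, rfl⟩ := toCoregular_surjective p
      -- The value is the sum of `p S(x₁) α x₂ x y S(x₃)` over `Φ⁻¹ = x₁ ⊗ x₂ ⊗ x₃`, which depends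
      -- on `x` and `y` only through `x y`.
      simp only [lin_comp, lin_associator_inv, sweedler₃, lin_sweedler₂, lin_whiskerRight,
        ρ_regular, ρ_coregular, lin_e, lin_b, mul_assoc, one_mul]

/-- The multiplication of the transmuted Hopf algebra. -/
noncomputable def mul : A.transmuted ⊗ A.transmuted ⟶ A.transmuted :=
  descLeft ((α_ A.transmuted (regular A) (coregular A)).inv ≫ ev A (regular A) ▷ coregular A ≫ μ A)
    fun p x y => by
      obtain ⟨p, rfl⟩ := toTransmuted_surjective p
      simp only [lin_comp, lin_associator_inv, sweedler₃, lin_sweedler₂, lin_whiskerRight,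
        ρ_regular, ρ_coregular, ρ_transmuted, lin_ev, lin_μ, mul_assoc, one_mul]

/-- The morphism from which the antipode of the transmuted Hopf algebra is obtained. -/
noncomputable def ψ : A.transmuted ⊗ A.transmuted ⟶ A.transmuted :=
  descLeft ((α_ A.transmuted (regular A) (coregular A)).inv ≫
      (β_ A.transmuted (regular A)).hom ▷ coregular A ≫
      (α_ (regular A) A.transmuted (coregular A)).hom ≫ regular A ◁ ev A (coregular A) ≫ μ A)
    fun p x y => by
      obtain ⟨p, rfl⟩ := toTransmuted_surjective p
      simp only [lin_comp, lin_associator_inv, lin_associator, lin_braiding, sweedler₃,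
        lin_sweedler₂, lin_whiskerRight, lin_whiskerLeft, sweedler₂_tmul_right,
        ρ_regular, ρ_coregular, ρ_transmuted, lin_ev, lin_μ, mul_assoc, one_mul]

variable {A}

lemma ν_eq : coregular A ◁ μ A ≫ ν A =
    (α_ (coregular A) (regular A) (coregular A)).inv ≫ e A ▷ coregular A ≫ b A :=
  whiskerLeft_descLeft _ _

lemma mul_eq : A.transmuted ◁ μ A ≫ mul A =
    (α_ A.transmuted (regular A) (coregular A)).inv ≫ ev A (regular A) ▷ coregular A ≫ μ A :=
  whiskerLeft_descLeft _ _

lemma ψ_eq : A.transmuted ◁ μ A ≫ ψ A =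
    (α_ A.transmuted (regular A) (coregular A)).inv ≫
      (β_ A.transmuted (regular A)).hom ▷ coregular A ≫
      (α_ (regular A) A.transmuted (coregular A)).hom ≫ regular A ◁ ev A (coregular A) ≫ μ A :=
  whiskerLeft_descLeft _ _

lemma lin_ν (x y : H) : lin (ν A) (toCoregular A x ⊠ toTransmuted A y) =
    toCoregular A (sweedler₃ A.Φinv fun x₁ x₂ x₃ => x * A.S x₁ * A.α * x₂ * y * A.S x₃) := by
  have : lin ((α_ (coregular A) (regular A) (coregular A)).inv ≫ e A ▷ coregular A ≫ b A)
      (toCoregular A x ⊠ (toRegular A y ⊠ toCoregular A 1)) =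
    toCoregular A (sweedler₃ A.Φinv fun x₁ x₂ x₃ => x * A.S x₁ * A.α * x₂ * y * A.S x₃) := by
    simp only [lin_comp, lin_associator_inv, sweedler₃, map_sweedler₂, lin_whiskerRight,
        ρ_regular, ρ_coregular, lin_e, lin_b, mul_assoc, one_mul]
  exact this

/-- This is the second normalisation axiom, `S(x₁) α x₂ β S(x₃) = 1`. -/
lemma one_ν : coregular A ◁ one A ≫ ν A = (ρ_ (coregular A)).hom := by
  rw [← Iso.inv_comp_eq_id]
  refine hom_ext fun x => ?_
  obtain ⟨x, rfl⟩ := toCoregular_surjective x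
  have := congrArg (x * ·) (sweedler_S_Φinv (A := A))
  simp only [sweedler₃, mul_sweedler₂, mul_one, ← mul_assoc] at this
  rw [lin_comp, lin_comp, lin_rightUnitor_inv, lin_whiskerLeft, lin_one, lin_ν, sweedler₃, this]
  rfl

end Multiplication

end Rep

end QuasitriangularQuasiHopfAlgebra

/-! ### Nested factors and the transmutation data -/

namespace QuasitriangularQuasiHopfAlgebra

open scoped TensorProduct

variable {k H : Type u} [Field k] [Ring H] [Algebra k H] (A : QuasitriangularQuasiHopfAlgebra k H)

namespace Rep

local infixl:70 " ⊠ " => tmul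

/-- The anti-homomorphism `y ↦ (S ⊗ S)(Δ^op(y))`. -/
noncomputable def antipodeComulOp : H →ₗ[k] H ⊗[k] H :=
  TensorProduct.map A.S.toLinearMap A.S.toLinearMap ∘ₗ
    (TensorProduct.comm k H H).toLinearMap ∘ₗ A.comul.toLinearMap

lemma map_antipode_mul (s t : H ⊗[k] H) :
    TensorProduct.map A.S.toLinearMap A.S.toLinearMap (TensorProduct.comm k H H (s * t)) =
      TensorProduct.map A.S.toLinearMap A.S.toLinearMap (TensorProduct.comm k H H t) *
        TensorProduct.map A.S.toLinearMap A.S.toLinearMap (TensorProduct.comm k H H s) := by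
  induction s with
  | zero => simp
  | add x y hx hy => simp only [add_mul, mul_add, map_add, hx, hy]
  | tmul a b =>
    induction t with
    | zero => simp
    | add x y hx hy => simp only [add_mul, mul_add, map_add, hx, hy]
    | tmul c d => simp [A.S_mul]

lemma antipodeComulOp_mul (x y : H) :
    antipodeComulOp A (x * y) = antipodeComulOp A y * antipodeComulOp A x := by
  simp only [antipodeComulOp, LinearMap.comp_apply, AlgHom.toLinearMap_apply, map_mul]
  exact map_antipode_mul A _ _

lemma antipodeComulOp_one : antipodeComulOp A 1 = 1 := by
  simp [antipodeComulOp, Algebra.TensorProduct.one_def, A.S_one]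

/-- The action of `H` on `H ⊗ H` by right multiplication with `(S ⊗ S)(Δ^op(y))`. -/
noncomputable def mulRightAntipodeComulOp : H →ₐ[k] Module.End k (H ⊗[k] H) :=
  AlgHom.ofLinearMap ((LinearMap.mul k (H ⊗[k] H)).flip ∘ₗ antipodeComulOp A)
    (LinearMap.ext fun a => by simp [antipodeComulOp_one])
    (fun x y => LinearMap.ext fun a => by simp [antipodeComulOp_mul, mul_assoc])

/-- The action of `H ⊗ H` on `H ⊗ H` by `(a ⊗ b) ▷ w = Δ(a) w (S ⊗ S)(Δ^op(b))`. -/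
noncomputable def adjointTensorAction : H ⊗[k] H →ₐ[k] Module.End k (H ⊗[k] H) :=
  Algebra.TensorProduct.lift ((Algebra.lmul k (H ⊗[k] H)).comp A.comul)
    (mulRightAntipodeComulOp A) fun x y =>
      LinearMap.ext fun a => by simp [mulRightAntipodeComulOp, mul_assoc]

lemma adjointTensorAction_tmul (a b : H) (w : H ⊗[k] H) :
    adjointTensorAction A (a ⊗ₜ b) w = A.comul a * w * antipodeComulOp A b := by
  simp [adjointTensorAction, mulRightAntipodeComulOp, mul_assoc]

/-- The module `H ⊗ H` with the action `h ▷ w = Δ(h₁) w (S ⊗ S)(Δ^op(h₂))`. -/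
noncomputable def adjointTensor : A.Rep where
  V := H ⊗[k] H
  ρ := (adjointTensorAction A).comp A.comul

/-- The elements of `adjointTensor`. -/
noncomputable def toAdjointTensor : H ⊗[k] H →ₗ[k] (adjointTensor A).V := LinearMap.id

/-- The elements of the tensor square of the regular module. -/
noncomputable def toRegular₂ : H ⊗[k] H →ₗ[k] (regular A ⊗ regular A : A.Rep).V := LinearMap.id

/-- The elements of the tensor square of the coregular module, with the factors interchanged. -/
noncomputable def toCoregular₂ : H ⊗[k] H →ₗ[k] (coregular A ⊗ coregular A : A.Rep).V :=
  (TensorProduct.comm k H H).toLinearMap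

variable {A}

lemma toRegular₂_surjective (x : (regular A ⊗ regular A : A.Rep).V) :
    ∃ y : H ⊗[k] H, toRegular₂ A y = x := ⟨x, rfl⟩

lemma toCoregular₂_surjective (x : (coregular A ⊗ coregular A : A.Rep).V) :
    ∃ y : H ⊗[k] H, toCoregular₂ A y = x := (TensorProduct.comm k H H).surjective x

lemma toRegular_tmul (x y : H) : toRegular A x ⊠ toRegular A y = toRegular₂ A (x ⊗ₜ y) := rfl

lemma toCoregular_tmul (x y : H) :
    toCoregular A x ⊠ toCoregular A y = toCoregular₂ A (y ⊗ₜ x) := rfl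

lemma ρ_regular₂ (h : H) (w : H ⊗[k] H) :
    (regular A ⊗ regular A : A.Rep).ρ h (toRegular₂ A w) = toRegular₂ A (A.comul h * w) := by
  change tensorAction (Algebra.lmul k H) (Algebra.lmul k H) (A.comul h) w = A.comul h * w
  generalize A.comul h = t
  induction t with
  | zero => simp
  | add x y hx hy => simp only [map_add, LinearMap.add_apply, add_mul, hx, hy]
  | tmul x y =>
    induction w with
    | zero => simp
    | add x y hx hy => simp only [map_add, mul_add, hx, hy]
    | tmul a b => simp

lemma ρ_coregular₂ (h : H) (w : H ⊗[k] H) :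
    (coregular A ⊗ coregular A : A.Rep).ρ h (toCoregular₂ A w) =
      toCoregular₂ A (w * antipodeComulOp A h) := by
  change tensorAction A.mulRightAntipode A.mulRightAntipode (A.comul h)
    (TensorProduct.comm k H H w) = TensorProduct.comm k H H (w *
      TensorProduct.map A.S.toLinearMap A.S.toLinearMap (TensorProduct.comm k H H (A.comul h)))
  generalize A.comul h = t
  induction t with
  | zero => simp
  | add x y hx hy => simp only [map_add, LinearMap.add_apply, mul_add, hx, hy]
  | tmul x y =>
    induction w with
    | zero => simp
    | add x y hx hy => simp only [map_add, add_mul, hx, hy]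
    | tmul a b => simp [mulRightAntipode]

lemma ρ_adjointTensor (h : H) (w : H ⊗[k] H) : (adjointTensor A).ρ h (toAdjointTensor A w) =
    toAdjointTensor A
      (sweedler₂ (A.comul h) fun a b => A.comul a * w * antipodeComulOp A b) := by
  refine (sweedler₂_tmul (A.comul h)
    ((adjointTensorAction A).toLinearMap.flip w)).symm.trans ?_
  simp only [LinearMap.flip_apply, AlgHom.toLinearMap_apply, adjointTensorAction_tmul]
  rfl

variable (A)

/-- The multiplication of nested factors, as a bilinear map. -/
noncomputable def mulNested : (regular A ⊗ regular A : A.Rep).V →ₗ[k]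
    (coregular A ⊗ coregular A : A.Rep).V →ₗ[k] (adjointTensor A).V :=
  (LinearMap.mul k (H ⊗[k] H)).compl₂ (TensorProduct.comm k H H).toLinearMap

lemma mulNested_apply (w z : H ⊗[k] H) :
    mulNested A (toRegular₂ A w) (toCoregular₂ A z) = toAdjointTensor A (w * z) :=
  congrArg (w * ·) ((TensorProduct.comm k H H).symm_apply_apply z)

/-- The multiplication of nested factors. -/
noncomputable def μ₂ :
    (regular A ⊗ regular A) ⊗ (coregular A ⊗ coregular A) ⟶ adjointTensor A :=
  mkHom₂ (mulNested A) fun h w z => by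
    obtain ⟨w, rfl⟩ := toRegular₂_surjective w
    obtain ⟨z, rfl⟩ := toCoregular₂_surjective z
    -- With the coregular factors interchanged, nesting is plain multiplication in `H ⊗ H`, and
    -- equivariance is associativity.
    simp only [mulNested_apply, ρ_adjointTensor, map_sweedler₂, ρ_regular₂, ρ_coregular₂,
      mul_assoc]

variable {A}

lemma lin_μ₂ (w z : H ⊗[k] H) :
    lin (μ₂ A) (toRegular₂ A w ⊠ toCoregular₂ A z) = toAdjointTensor A (w * z) :=
  mulNested_apply A w z

lemma lin_μ₂_tmul (x y z w : H) :
    lin (μ₂ A) ((toRegular A x ⊠ toRegular A y) ⊠ (toCoregular A z ⊠ toCoregular A w)) =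
      toAdjointTensor A ((x * w) ⊗ₜ (y * z)) := by
  rw [toRegular_tmul, toCoregular_tmul, lin_μ₂, Algebra.TensorProduct.tmul_mul_tmul]

variable (A) in
/-- A linear section of the multiplication `μ₂`. -/
noncomputable def sectionμ₂ : LinearSection (μ₂ A) where
  s := (TensorProduct.mk k (H ⊗[k] H) (H ⊗[k] H)).flip 1
  lin_s (n : H ⊗[k] H) := mul_one n

section Descent

variable {X P : A.Rep}

lemma sectionμ₂_ext (f : (regular A ⊗ regular A) ⊗ (coregular A ⊗ coregular A) ⟶ P)
    (hf : ∀ x y z w : H, lin f ((toRegular A (x * w) ⊠ toRegular A (y * z)) ⊠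
      (toCoregular A 1 ⊠ toCoregular A 1)) =
        lin f ((toRegular A x ⊠ toRegular A y) ⊠ (toCoregular A z ⊠ toCoregular A w))) :
    lin f ∘ₗ (sectionμ₂ A).s ∘ₗ lin (μ₂ A) = lin f :=
  TensorProduct.ext_fourfold' fun (x y z w : H) =>
    (congrArg (fun n => lin f ((sectionμ₂ A).s n)) (lin_μ₂_tmul x y z w)).trans (hf x y z w)

lemma sectionμ₂_whiskerLeft_ext
    (f : X ⊗ ((regular A ⊗ regular A) ⊗ (coregular A ⊗ coregular A)) ⟶ P)
    (hf : ∀ (p : X.V) (w z : H ⊗[k] H),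
      lin f (p ⊠ (toRegular₂ A (w * z) ⊠ toCoregular₂ A 1)) =
        lin f (p ⊠ (toRegular₂ A w ⊠ toCoregular₂ A z))) :
    lin f ∘ₗ ((sectionμ₂ A).whiskerLeft X).s ∘ₗ lin (X ◁ μ₂ A) = lin f :=
  TensorProduct.ext_threefold' fun p w z => by
    obtain ⟨w, rfl⟩ := toRegular₂_surjective w
    obtain ⟨z, rfl⟩ := toCoregular₂_surjective z
    exact (congrArg (fun n => lin f (p ⊠ (sectionμ₂ A).s n)) (lin_μ₂ w z)).trans (hf p w z)

/-- Descent along `μ₂`. -/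
noncomputable def descμ₂ (f : (regular A ⊗ regular A) ⊗ (coregular A ⊗ coregular A) ⟶ P)
    (hf : ∀ x y z w : H, lin f ((toRegular A (x * w) ⊠ toRegular A (y * z)) ⊠
      (toCoregular A 1 ⊠ toCoregular A 1)) =
        lin f ((toRegular A x ⊠ toRegular A y) ⊠ (toCoregular A z ⊠ toCoregular A w))) :
    adjointTensor A ⟶ P :=
  (sectionμ₂ A).desc f (sectionμ₂_ext f hf)

lemma μ₂_descμ₂ (f : (regular A ⊗ regular A) ⊗ (coregular A ⊗ coregular A) ⟶ P) (hf) :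
    μ₂ A ≫ descμ₂ f hf = f :=
  LinearSection.comp_desc _ _ (sectionμ₂_ext f hf)

/-- Descent along `X ◁ μ₂`. -/
noncomputable def descLeft₂ (f : X ⊗ ((regular A ⊗ regular A) ⊗ (coregular A ⊗ coregular A)) ⟶ P)
    (hf : ∀ (p : X.V) (w z : H ⊗[k] H),
      lin f (p ⊠ (toRegular₂ A (w * z) ⊠ toCoregular₂ A 1)) =
        lin f (p ⊠ (toRegular₂ A w ⊠ toCoregular₂ A z))) : X ⊗ adjointTensor A ⟶ P :=
  ((sectionμ₂ A).whiskerLeft X).desc f (sectionμ₂_whiskerLeft_ext f hf)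

lemma whiskerLeft_descLeft₂
    (f : X ⊗ ((regular A ⊗ regular A) ⊗ (coregular A ⊗ coregular A)) ⟶ P) (hf) :
    X ◁ μ₂ A ≫ descLeft₂ f hf = f :=
  LinearSection.comp_desc _ _ (sectionμ₂_whiskerLeft_ext f hf)

end Descent

variable (A)

/-- The multiplication on nested factors with a factor of the transmuted Hopf algebra. -/
noncomputable def mul₂ : A.transmuted ⊗ adjointTensor A ⟶ adjointTensor A :=
  descLeft₂ ((α_ A.transmuted (regular A ⊗ regular A) (coregular A ⊗ coregular A)).inv ≫
      ev A (regular A ⊗ regular A) ▷ (coregular A ⊗ coregular A) ≫ μ₂ A)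
    fun p w z => by
      obtain ⟨p, rfl⟩ := toTransmuted_surjective p
      simp only [lin_comp, lin_associator_inv, sweedler₃, lin_sweedler₂, lin_whiskerRight,
        ρ_regular₂, ρ_coregular₂, ρ_transmuted, lin_ev, lin_μ₂, mul_assoc, one_mul]

/-- The interchange of nested factors. -/
noncomputable def π : adjointTensor A ⟶ A.transmuted ⊗ A.transmuted :=
  descμ₂ (BraidedHopf.nestedMul (μ A)) fun x y z w => by
    simp only [BraidedHopf.nestedMul, lin_comp, lin_associator_inv, lin_associator, lin_braiding,
      sweedler₃, ρ_tmul, tmul_sweedler₂,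
      lin_sweedler₂, lin_whiskerRight, lin_whiskerLeft,
      ρ_regular, ρ_coregular, ρ_transmuted, lin_μ, mul_assoc, one_mul]

/-- The insertion of an element of the transmuted Hopf algebra between two factors. -/
noncomputable def χ : regular A ⊗ (A.transmuted ⊗ coregular A) ⟶ adjointTensor A :=
  descMiddle (regular A ◁ (α_ (regular A) (coregular A) (coregular A)).hom ≫
    (α_ (regular A) (regular A) (coregular A ⊗ coregular A)).inv ≫ μ₂ A) fun p x y q => by
    obtain ⟨p, rfl⟩ := toRegular_surjective p
    obtain ⟨q, rfl⟩ := toCoregular_surjective q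
    simp only [lin_comp, lin_associator_inv, lin_associator, sweedler₃, ρ_tmul, tmul_sweedler₂,
      lin_sweedler₂, lin_whiskerLeft,
      ρ_regular, ρ_coregular, lin_μ₂_tmul, mul_assoc, one_mul]

variable {A}

/-- At `x = z = 1`-type arguments around `β` this is the shape in which `ξ` will be recognised, see
`ξ_eq`. -/
lemma lin_χ (x y z : H) :
    lin (χ A) (toRegular A x ⊠ (toTransmuted A y ⊠ toCoregular A z)) =
      toAdjointTensor A (sweedler₃ (A.Φ : H ⊗[k] (H ⊗[k] H)) fun X₁ X₂ X₃ =>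
        sweedler₃ A.Φinv fun x₁ x₂ x₃ => sweedler₂ (A.comul x₃) fun x₃' x₃'' =>
          (x₁ * x * z * A.S X₃ * A.S x₃'') ⊗ₜ[k] (x₂ * X₁ * y * A.S X₂ * A.S x₃')) := by
  have : lin (regular A ◁ (α_ (regular A) (coregular A) (coregular A)).hom ≫
    (α_ (regular A) (regular A) (coregular A ⊗ coregular A)).inv ≫ μ₂ A)
    (toRegular A x ⊠ ((toRegular A y ⊠ toCoregular A 1) ⊠ toCoregular A z)) =
      toAdjointTensor A (sweedler₃ (A.Φ : H ⊗[k] (H ⊗[k] H)) fun X₁ X₂ X₃ =>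
        sweedler₃ A.Φinv fun x₁ x₂ x₃ => sweedler₂ (A.comul x₃) fun x₃' x₃'' =>
          (x₁ * x * z * A.S X₃ * A.S x₃'') ⊗ₜ[k] (x₂ * X₁ * y * A.S X₂ * A.S x₃')) := by
    simp only [lin_comp, lin_associator_inv, lin_associator, sweedler₃, ρ_tmul, tmul_sweedler₂,
      map_sweedler₂, lin_whiskerLeft,
      ρ_regular, ρ_coregular, lin_μ₂_tmul, mul_assoc, one_mul]
  exact this

variable (A)

/-- The insertion of the unit of the transmuted Hopf algebra between two factors. -/
noncomputable def ζ : A.transmuted ⟶ adjointTensor A :=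
  descμ (regular A ◁ ((λ_ (coregular A)).inv ≫ one A ▷ coregular A) ≫ χ A) fun x y => by
    simp only [lin_comp, lin_whiskerLeft, lin_leftUnitor_inv, lin_whiskerRight, lin_one, lin_χ,
      mul_assoc, one_mul]

/-- The transmutation data of a quasitriangular quasi-Hopf algebra. -/
noncomputable def transmutationData : BraidedHopf.TransmutationData A.Rep where
  G := regular A
  K := coregular A
  T := trivial A
  H := A.transmuted
  E := adjointTensor A
  μ := μ A
  e := e A
  a := a A
  b := b A
  m := m A
  unitGenerated := unitGenerated_trivial
  epi_μ X Y := (((sectionμ A).whiskerRight Y).whiskerLeft X).epi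
  a_μ := a_μ
  a_e := a_e
  b_e := b_e
  ev := ev A
  naturality := ev_naturality
  ev_eq := μ_ev
  generates := regular_generates
  one := one A
  mul := mul A
  ν := ν A
  ψ := ψ A
  one_ev := one_ev
  mul_eq := mul_eq
  ν_eq := ν_eq
  one_ν := one_ν
  ψ_eq := ψ_eq
  μ₂ := μ₂ A
  epi_μ₂ X Y := (((sectionμ₂ A).whiskerRight Y).whiskerLeft X).epi
  mul₂ := mul₂ A
  mul₂_eq := whiskerLeft_descLeft₂ _ _
  π := π A
  π_eq := μ₂_descμ₂ _ _
  χ := χ A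
  χ_eq := whiskerLeft_descMiddle _ _
  ζ := ζ A
  ζ_eq := μ_descμ _ _

end Rep

end QuasitriangularQuasiHopfAlgebra

/-! ### Interchange of independent Sweedler sums -/

section Sweedler

open scoped TensorProduct

variable {k U V W U' V' W' M : Type*} [Field k] [AddCommGroup U] [Module k U] [AddCommGroup V]
  [Module k V] [AddCommGroup W] [Module k W] [AddCommGroup U'] [Module k U'] [AddCommGroup V']
  [Module k V'] [AddCommGroup W'] [Module k W'] [AddCommGroup M]

lemma sweedler₃_sweedler₂_comm (t : U ⊗[k] (V ⊗[k] W)) (s : U' ⊗[k] V')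
    (f : U → V → W → U' → V' → M) :
    (sweedler₃ t fun u v w => sweedler₂ s fun x y => f u v w x y) =
      sweedler₂ s fun x y => sweedler₃ t fun u v w => f u v w x y := by
  simp only [sweedler₃, sweedler₂_comm _ s]

lemma sweedler₃_comm (t : U ⊗[k] (V ⊗[k] W)) (s : U' ⊗[k] (V' ⊗[k] W'))
    (f : U → V → W → U' → V' → W' → M) :
    (sweedler₃ t fun u v w => sweedler₃ s fun x y z => f u v w x y z) =
      sweedler₃ s fun x y z => sweedler₃ t fun u v w => f u v w x y z := by
  refine Eq.trans (congrArg (sweedler₂ t) (funext fun u => funext fun r => ?_))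
    (sweedler₃_sweedler₂_comm s t _).symm
  exact (sweedler₃_sweedler₂_comm s r _).symm

end Sweedler

/-! ### Explicit counit, multiplication and antipode -/

namespace QuasitriangularQuasiHopfAlgebra

open scoped TensorProduct

variable {k H : Type u} [Field k] [Ring H] [Algebra k H] (A : QuasitriangularQuasiHopfAlgebra k H)

/-- Applying `ε` to `X₁ β S(X₂) α X₃ = 1` would otherwise give `0 = 1` in the field. -/
lemma counit_α_ne_zero : A.counit A.α ≠ 0 := by
  intro h
  have := congrArg A.counit (Rep.sweedler_S_Φ (A := A))
  simp only [sweedler₃, map_sweedler₂, map_mul, h, mul_zero, zero_mul, map_one] at this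
  simp [sweedler₂] at this

/-- Apply `ε` to `S(h₁) α h₂ = ε(h) α` and cancel the nonzero scalar `ε(α)`. -/
lemma counit_S (h : H) : A.counit (A.S h) = A.counit h := by
  have h1 := congrArg A.counit (Rep.sweedler_S_left (A := A) h)
  have h2 := Rep.sweedler_counit_right (A := A) h
    (A.counit.toLinearMap ∘ₗ LinearMap.mulRight k A.α ∘ₗ A.S.toLinearMap)
  simp only [map_sweedler₂, map_mul, map_smul, smul_eq_mul] at h1
  simp only [LinearMap.comp_apply, LinearMap.mulRight_apply, AlgHom.toLinearMap_apply,
    LinearEquiv.coe_coe, map_mul, smul_eq_mul] at h2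
  refine mul_right_cancel₀ A.counit_α_ne_zero (h2.symm.trans (Eq.trans ?_ h1))
  refine congrArg (sweedler₂ (A.comul h)) (funext fun a => funext fun b => ?_)
  ring

lemma sweedler_counit_Φ :
    (sweedler₃ (A.Φ : H ⊗[k] (H ⊗[k] H)) fun a b c =>
      A.counit a * A.counit b * A.counit c) = 1 := by
  let L := TensorProduct.lift ((LinearMap.mul k k).compl₁₂ A.counit.toLinearMap
    (TensorProduct.lift ((LinearMap.mul k k).compl₁₂ LinearMap.id A.counit.toLinearMap)))
  have h1 := congrArg L A.counit_Φ
  have h2 := sweedler₃_tmul (A.Φ : H ⊗[k] (H ⊗[k] H)) (L ∘ₗ (Algebra.TensorProduct.map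
    (AlgHom.id k H) (Algebra.TensorProduct.map A.counit (AlgHom.id k H))).toLinearMap)
  simp only [mul_assoc]
  refine (h2.trans h1).trans ?_
  simp [L, Algebra.TensorProduct.one_def]

namespace Rep

local infixl:70 " ⊠ " => tmul

variable {A}

/-- The transmuted counit is the action on the tensor unit, that is `ε ∘ θ`; this is the origin of
the factor `ε(α)`. -/
lemma counit_θ (h : H) : A.counit (θ A h) = A.counit A.α * A.counit h := by
  have := congrArg (A.counit A.α * A.counit h * ·) A.sweedler_counit_Φ
  simp only [sweedler₃, mul_sweedler₂, mul_one] at this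
  rw [← this, θ_apply]
  simp only [sweedler₃, map_sweedler₂, map_mul, counit_S]
  refine congrArg (sweedler₂ _) (funext fun a => funext fun s => ?_)
  refine congrArg (sweedler₂ _) (funext fun b => funext fun c => ?_)
  ring

lemma lin_counit (h : H) : lin (transmutationData A).counit (toTransmuted A h) =
    (A.counit A.α * A.counit h : k) := by
  rw [← counit_θ]
  exact mul_one (A.counit (θ A h))

/-- The defining description of the product gives `θ(x₁ ▷ x) x₂ y S(x₃)`. The stated formula results
from the other description, through the right action `ν` on `K`, evaluated at `x = μ (x ⊗ 1)`. -/
lemma lin_mul (x y : H) :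
    lin (mul A) (toTransmuted A x ⊠ toTransmuted A y) = toTransmuted A (A.transMul x y) := by
  have := congrArg (fun f => lin f ((toRegular A x ⊠ toCoregular A 1) ⊠ toTransmuted A y))
    (transmutationData A).mul_eq'
  change lin (μ A ▷ A.transmuted ≫ mul A) _ = lin ((α_ (regular A) (coregular A) A.transmuted).hom
    ≫ regular A ◁ ν A ≫ μ A) _ at this
  simp only [lin_comp, lin_whiskerRight, lin_whiskerLeft, lin_μ, mul_one, lin_associator,
    ρ_regular, ρ_coregular, ρ_transmuted, lin_ν, adjoint_apply, sweedler₃, tmul_sweedler₂,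
    map_sweedler₂, one_mul] at this
  rw [this, transMul]
  simp only [sweedler₃_sweedler₂_comm]
  simp only [sweedler₃, map_sweedler₂, A.S_mul, mul_assoc]

lemma sweedler_q (f : H →ₗ[k] H →ₗ[k] H) : (sweedler₂ A.q fun x y => f x y) =
    sweedler₃ (A.Φ : H ⊗[k] (H ⊗[k] H)) fun X₁ X₂ X₃ => f X₁ (A.S.symm (A.α * X₃) * X₂) := by
  refine (sweedler₂_tmul A.q (TensorProduct.lift f)).trans ?_
  rw [q, map_sweedler₃]
  rfl

lemma sweedler_p (f : H →ₗ[k] H →ₗ[k] H) : (sweedler₂ A.p fun x y => f x y) =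
    sweedler₃ A.Φinv fun x₁ x₂ x₃ => f x₁ (x₂ * A.β * A.S x₃) := by
  refine (sweedler₂_tmul A.p (TensorProduct.lift f)).trans ?_
  rw [p, map_sweedler₃]
  rfl

/-- Since `q₂ = S⁻¹(α X₃) X₂`, the antipode turns it into `S(X₂) α X₃`; thus `q₁ y S(q₂)` sums to
`θ(y)`. -/
lemma sweedler_q_antipode (x y z : H) :
    (sweedler₂ A.q fun q₁ q₂ => x * A.S (q₁ * y * A.S q₂ * z)) = x * A.S (θ A y * z) := by
  refine (sweedler_q (A := A) (((LinearMap.mul k H).compl₁₂ (LinearMap.mulRight k y)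
    A.S.toLinearMap).compr₂ (LinearMap.mulLeft k x ∘ₗ A.S.toLinearMap ∘ₗ
      LinearMap.mulRight k z))).trans ?_
  simp [θ_apply, sweedler₃, sweedler₂_mul, map_sweedler₂, mul_sweedler₂, A.S_mul, mul_assoc]

lemma sweedler_p_antipode (x y z h : H) :
    (sweedler₂ A.p fun p₁ p₂ => x * p₂ * A.S (θ A (A.adjoint (y * p₁) h) * z)) =
      sweedler₃ A.Φinv fun x₁ x₂ x₃ =>
        x * (x₂ * A.β * A.S x₃) * A.S (θ A (A.adjoint (y * x₁) h) * z) :=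
  sweedler_p ((LinearMap.mul k H).compl₁₂ (LinearMap.mulLeft k x)
    (A.S.toLinearMap ∘ₗ LinearMap.mulRight k z ∘ₗ θ A ∘ₗ A.adjoint.toLinearMap.flip h ∘ₗ
      LinearMap.mulLeft k y)).flip

/-- The antipode is `ψ` at the unit `β = μ (1 ⊗ β)`. Rebracketing by `Φ⁻¹`, braiding by `R` and
rebracketing by `Φ` supply `p`, `R` and the `X` of the formula, and the action on `K` supplies `S`
of `θ`. -/
lemma lin_antipode (h : H) : lin (transmutationData A).antipode (toTransmuted A h) =
    toTransmuted A (A.transAntipode h) := by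
  have h1 : lin (transmutationData A).antipode (toTransmuted A h) =
      lin (A.transmuted ◁ μ A ≫ ψ A) (toTransmuted A h ⊠ (toRegular A 1 ⊠ toCoregular A A.β)) := by
    rw [lin_comp, lin_whiskerLeft, lin_μ, one_mul, ← lin_one]
    rfl
  rw [h1, ψ_eq, transAntipode]
  simp only [sweedler_q_antipode, sweedler_p_antipode]
  simp only [← sweedler₃_sweedler₂_comm A.Φinv]
  rw [sweedler₃_comm]
  simp only [sweedler₃_sweedler₂_comm (A.Φ : H ⊗[k] (H ⊗[k] H))]
  simp only [lin_comp, lin_associator_inv, lin_associator, lin_braiding, sweedler₃,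
    map_sweedler₂, lin_whiskerRight, lin_whiskerLeft, sweedler₂_tmul_right,
    ρ_regular, ρ_coregular, ρ_transmuted, lin_ev_coregular, lin_μ, mul_assoc, one_mul, A.S_mul,
    map_mul, Module.End.mul_apply]
  rfl

end Rep

end QuasitriangularQuasiHopfAlgebra

/-! ### The invariant element `ξ` -/

namespace QuasitriangularQuasiHopfAlgebra

open scoped TensorProduct

variable {k H : Type u} [Field k] [Ring H] [Algebra k H] (A : QuasitriangularQuasiHopfAlgebra k H)

section Invariant

lemma mul_eq_of_mul_mul_eq {M : Type*} [Monoid M] {a b c d e c' d' : M}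
    (h : a * b * c = d * e) (hc : c * c' = 1) (hd : d' * d = 1) : e * c' = d' * a * b := by
  calc
    _ = d' * (d * e) * c' := by rw [← mul_assoc, hd, one_mul]
    _ = d' * a * b * (c * c') := by simp only [← h, mul_assoc]
    _ = _ := by rw [hc, mul_one]

lemma Φ_mul_Φinv : (A.Φ : H ⊗[k] (H ⊗[k] H)) * A.Φinv = 1 := A.Φ.mul_inv

lemma Φinv_mul_Φ : A.Φinv * (A.Φ : H ⊗[k] (H ⊗[k] H)) = 1 := A.Φ.inv_mul

/-- The pentagon identity, solved for `B`. -/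
lemma B_eq : A.B = Algebra.TensorProduct.map (AlgHom.id k H)
        (Algebra.TensorProduct.map (AlgHom.id k H) A.comul) A.Φinv *
      ((1 : H) ⊗ₜ[k] (A.Φ : H ⊗[k] (H ⊗[k] H))) *
      Algebra.TensorProduct.map (AlgHom.id k H)
        ((Algebra.TensorProduct.assoc k k k H H H).toAlgHom.comp
          (Algebra.TensorProduct.map A.comul (AlgHom.id k H))) A.Φ := by
  let P := Algebra.TensorProduct.map (AlgHom.id k H)
    (Algebra.TensorProduct.map (AlgHom.id k H) A.comul)
  let Q (t : H ⊗[k] (H ⊗[k] H)) := Algebra.TensorProduct.map (AlgHom.id k H)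
    (Algebra.TensorProduct.assoc k k k H H H).toAlgHom
      (Algebra.TensorProduct.assoc k k k H (H ⊗[k] H) H (t ⊗ₜ[k] (1 : H)))
  have hP : P A.Φinv * P A.Φ = 1 := by rw [← map_mul, Φinv_mul_Φ, map_one]
  have hQ : Q A.Φ * Q A.Φinv = 1 := by
    simp only [Q]
    rw [← map_mul, ← map_mul, Algebra.TensorProduct.tmul_mul_tmul, Φ_mul_Φinv, mul_one,
      ← Algebra.TensorProduct.one_def, map_one, map_one]
  exact mul_eq_of_mul_mul_eq A.pentagon hQ hP

/-- The linear map `a ⊗ b ↦ a β S(b)`. -/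
noncomputable def pairβ : H ⊗[k] H →ₗ[k] H :=
  TensorProduct.lift ((LinearMap.mul k H).compl₁₂ (LinearMap.mulRight k A.β) A.S.toLinearMap)

/-- The linear map `a ⊗ b ⊗ c ⊗ d ↦ a β S(d) ⊗ b β S(c)`. -/
noncomputable def nestedβ : H ⊗[k] (H ⊗[k] (H ⊗[k] H)) →ₗ[k] H ⊗[k] H :=
  TensorProduct.map A.pairβ A.pairβ ∘ₗ
    (TensorProduct.assoc k H H (H ⊗[k] H)).symm.toLinearMap ∘ₗ
    TensorProduct.map LinearMap.id ((TensorProduct.comm k (H ⊗[k] H) H).toLinearMap ∘ₗ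
      (TensorProduct.assoc k H H H).symm.toLinearMap)

lemma nestedβ_tmul (a b c d : H) : A.nestedβ (a ⊗ₜ (b ⊗ₜ (c ⊗ₜ d))) =
    (a * A.β * A.S d) ⊗ₜ (b * A.β * A.S c) := rfl

lemma ξ_eq_nestedβ : A.ξ = A.nestedβ A.B := by
  rw [ξ, ← sweedler₄_tmul]
  simp only [nestedβ_tmul]

/-- Distributivity in a tensor product of algebras, for iterated tensor products in which the
instances are not found. -/
lemma tensor_mul_add {V W : Type*} [Ring V] [Algebra k V] [Ring W] [Algebra k W]
    (x y z : V ⊗[k] W) : x * (y + z) = x * y + x * z := mul_add x y z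

lemma tensor_add_mul {V W : Type*} [Ring V] [Algebra k V] [Ring W] [Algebra k W]
    (x y z : V ⊗[k] W) : (x + y) * z = x * z + y * z := add_mul x y z

lemma tensor_mul_one {V W : Type*} [Ring V] [Algebra k V] [Ring W] [Algebra k W]
    (x : V ⊗[k] W) : x * 1 = x := mul_one x

lemma tensor_mul_zero {V W : Type*} [Ring V] [Algebra k V] [Ring W] [Algebra k W]
    (x : V ⊗[k] W) : x * 0 = 0 := mul_zero x

lemma tensor_zero_mul {V W : Type*} [Ring V] [Algebra k V] [Ring W] [Algebra k W]
    (x : V ⊗[k] W) : 0 * x = 0 := zero_mul x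

/-- The second and third legs of `(1 ⊗ Δ ⊗ 1)(D)` are adjacent in the inner pairing and meet as `b₁
β S(b₂) = ε(b) β`, so the middle leg of `D` contributes only its counit. -/
lemma nestedβ_mul_comul (C : H ⊗[k] (H ⊗[k] (H ⊗[k] H))) (D : H ⊗[k] (H ⊗[k] H)) :
    A.nestedβ (C * Algebra.TensorProduct.map (AlgHom.id k H)
        ((Algebra.TensorProduct.assoc k k k H H H).toAlgHom.comp
          (Algebra.TensorProduct.map A.comul (AlgHom.id k H))) D) =
      A.nestedβ (C * TensorProduct.map LinearMap.id (TensorProduct.mk k H _ 1 ∘ₗ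
        TensorProduct.mk k H _ 1 ∘ₗ (TensorProduct.lid k H).toLinearMap)
          (Algebra.TensorProduct.map (AlgHom.id k H)
            (Algebra.TensorProduct.map A.counit (AlgHom.id k H)) D)) := by
  have mul_add' (x y z : H ⊗[k] (H ⊗[k] (H ⊗[k] H))) : x * (y + z) = x * y + x * z :=
    tensor_mul_add x y z
  have add_mul' (x y z : H ⊗[k] (H ⊗[k] (H ⊗[k] H))) : (x + y) * z = x * z + y * z :=
    tensor_add_mul x y z
  have mul_zero' (x : H ⊗[k] (H ⊗[k] (H ⊗[k] H))) : x * 0 = 0 := tensor_mul_zero x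
  have zero_mul' (x : H ⊗[k] (H ⊗[k] (H ⊗[k] H))) : 0 * x = 0 := tensor_zero_mul x
  have key (c₁ c₂ c₃ c₄ a c : H) (t : H ⊗[k] H) :
      A.nestedβ ((c₁ ⊗ₜ[k] (c₂ ⊗ₜ[k] (c₃ ⊗ₜ[k] c₄))) *
        (a ⊗ₜ[k] Algebra.TensorProduct.assoc k k k H H H (t ⊗ₜ[k] c))) =
      (c₁ * a * A.β * A.S (c₄ * c)) ⊗ₜ (c₂ * A.pairβ t * A.S c₃) := by
    induction t with
    | zero => simp [mul_zero']
    | add x y hx hy =>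
      simp only [TensorProduct.add_tmul, map_add, TensorProduct.tmul_add, mul_add', mul_add, hx, hy,
        add_mul]
    | tmul x y => simp [nestedβ_tmul, pairβ, A.S_mul, mul_assoc]
  induction D with
  | zero => simp [mul_zero']
  | add x y hx hy => simp only [map_add, mul_add', hx, hy]
  | tmul a s =>
    induction s with
    | zero => simp [mul_zero']
    | add x y hx hy => simp only [TensorProduct.tmul_add, map_add, mul_add', hx, hy]
    | tmul b c =>
      induction C with
      | zero => simp [zero_mul']
      | add x y hx hy => simp only [map_add, add_mul', hx, hy]
      | tmul c₁ s =>
        induction s with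
        | zero => simp [zero_mul']
        | add x y hx hy => simp only [TensorProduct.tmul_add, map_add, add_mul', hx, hy]
        | tmul c₂ s =>
          induction s with
          | zero => simp [zero_mul']
          | add x y hx hy => simp only [TensorProduct.tmul_add, map_add, add_mul', hx, hy]
          | tmul c₃ c₄ =>
            refine (key c₁ c₂ c₃ c₄ a c (A.comul b)).trans ?_
            have : A.pairβ (A.comul b) = A.counit b • A.β := A.S_right b
            rw [this]
            simp only [Algebra.TensorProduct.map_tmul, TensorProduct.map_tmul,
              LinearMap.comp_apply, LinearEquiv.coe_coe, TensorProduct.lid_tmul,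
              TensorProduct.mk_apply, LinearMap.id_apply, AlgHom.id_apply,
              Algebra.TensorProduct.tmul_mul_tmul, nestedβ_tmul, mul_one]
            simp [mul_assoc, TensorProduct.smul_tmul']

/-- With `B` rewritten by the pentagon, the factor `(1 ⊗ Δ ⊗ 1)(Φ)` is absorbed by the contraction
because `(1 ⊗ ε ⊗ 1)(Φ) = 1`. What remains is the expression produced by inserting `β` between two
factors. -/
lemma ξ_eq : A.ξ = sweedler₃ (A.Φ : H ⊗[k] (H ⊗[k] H)) fun X₁ X₂ X₃ =>
    sweedler₃ A.Φinv fun x₁ x₂ x₃ => sweedler₂ (A.comul x₃) fun x₃' x₃'' =>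
      (x₁ * A.β * A.S X₃ * A.S x₃'') ⊗ₜ[k] (x₂ * X₁ * A.β * A.S X₂ * A.S x₃') := by
  rw [ξ_eq_nestedβ, B_eq, nestedβ_mul_comul, A.counit_Φ]
  have h1 : TensorProduct.map LinearMap.id (TensorProduct.mk k H _ 1 ∘ₗ
        TensorProduct.mk k H _ 1 ∘ₗ (TensorProduct.lid k H).toLinearMap)
        (1 : H ⊗[k] (k ⊗[k] H)) = 1 := by
    simp [Algebra.TensorProduct.one_def]
  rw [h1, tensor_mul_one]
  refine (sweedler₃_tmul (A.Φ : H ⊗[k] (H ⊗[k] H)) (A.nestedβ ∘ₗ LinearMap.mulLeft k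
    (Algebra.TensorProduct.map (AlgHom.id k H)
      (Algebra.TensorProduct.map (AlgHom.id k H) A.comul) A.Φinv) ∘ₗ
        TensorProduct.mk k H (H ⊗[k] (H ⊗[k] H)) 1)).symm.trans ?_
  refine congrArg (sweedler₃ (A.Φ : H ⊗[k] (H ⊗[k] H))) (funext fun X₁ => funext fun X₂ =>
    funext fun X₃ => ?_)
  refine (sweedler₃_tmul A.Φinv (A.nestedβ ∘ₗ LinearMap.mulRight k
    ((1 : H) ⊗ₜ[k] (X₁ ⊗ₜ[k] (X₂ ⊗ₜ[k] X₃))) ∘ₗ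
    (Algebra.TensorProduct.map (AlgHom.id k H)
      (Algebra.TensorProduct.map (AlgHom.id k H) A.comul)).toLinearMap)).symm.trans ?_
  refine congrArg (sweedler₃ A.Φinv) (funext fun x₁ => funext fun x₂ => funext fun x₃ => ?_)
  refine (sweedler₂_tmul (A.comul x₃) (A.nestedβ ∘ₗ LinearMap.mulRight k
    ((1 : H) ⊗ₜ[k] (X₁ ⊗ₜ[k] (X₂ ⊗ₜ[k] X₃))) ∘ₗ TensorProduct.mk k H _ x₁ ∘ₗ
      TensorProduct.mk k H _ x₂)).symm.trans ?_
  refine congrArg (sweedler₂ (A.comul x₃)) (funext fun x₃' => funext fun x₃'' => ?_)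
  simp [nestedβ_tmul, A.S_mul, mul_assoc]

end Invariant

end QuasitriangularQuasiHopfAlgebra

/-- Independent sums may be interchanged; only the sum over `c X₃` has to stay inside the one that
binds `X₃`. The new order is the one in which the constraints of `nestedMul` are applied. -/
lemma sweedler_reorder {k H M : Type*} [Field k] [Ring H] [Algebra k H] [AddCommGroup M]
    (t t' s : TensorProduct k H (TensorProduct k H H)) (c : H → TensorProduct k H H)
    (r : TensorProduct k H H)
    (f : H → H → H → H → H → H → H → H → H → H → H → H → H → M) :
    (sweedler₃ t fun x₁ x₂ x₃ => sweedler₃ t' fun y₁ y₂ y₃ => sweedler₃ s fun X₁ X₂ X₃ =>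
      sweedler₂ (c X₃) fun X₃' X₃'' => sweedler₂ r fun R₁ R₂ =>
        f x₁ x₂ x₃ y₁ y₂ y₃ X₁ X₂ X₃ X₃' X₃'' R₁ R₂) =
    sweedler₃ s fun X₁ X₂ X₃ => sweedler₂ (c X₃) fun X₃' X₃'' =>
      sweedler₃ t' fun y₁ y₂ y₃ => sweedler₂ r fun R₁ R₂ => sweedler₃ t fun x₁ x₂ x₃ =>
        f x₁ x₂ x₃ y₁ y₂ y₃ X₁ X₂ X₃ X₃' X₃'' R₁ R₂ := by
  rw [sweedler₃_comm t t']
  simp only [sweedler₃_comm t s, sweedler₃_sweedler₂_comm t]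
  rw [sweedler₃_comm t' s]
  exact congrArg (sweedler₃ s) (funext fun _ => funext fun _ => funext fun X₃ =>
    sweedler₃_sweedler₂_comm t' (c X₃) _)

/-! ### Explicit comultiplication -/

namespace QuasitriangularQuasiHopfAlgebra

open scoped TensorProduct

variable {k H : Type u} [Field k] [Ring H] [Algebra k H] (A : QuasitriangularQuasiHopfAlgebra k H)

namespace Rep

local infixl:70 " ⊠ " => tmul

/-- The module `H ⊗ H` with the action `y ▷ w = w (S ⊗ S)(Δ^op(y))`. -/
noncomputable def coregularTensor : A.Rep where
  V := H ⊗[k] H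
  ρ := mulRightAntipodeComulOp A

/-- The elements of `coregularTensor`. -/
noncomputable def toCoregularTensor : H ⊗[k] H →ₗ[k] (coregularTensor A).V := LinearMap.id

variable {A}

lemma toCoregularTensor_surjective (x : (coregularTensor A).V) :
    ∃ y : H ⊗[k] H, toCoregularTensor A y = x := ⟨x, rfl⟩

lemma toTrivial_surjective (x : (trivial A).V) : ∃ y : H, toTrivial A y = x := ⟨x, rfl⟩

lemma toAdjointTensor_surjective (x : (adjointTensor A).V) :
    ∃ y : H ⊗[k] H, toAdjointTensor A y = x := ⟨x, rfl⟩

lemma ρ_coregularTensor (h : H) (w : H ⊗[k] H) :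
    (coregularTensor A).ρ h (toCoregularTensor A w) =
      toCoregularTensor A (w * antipodeComulOp A h) := rfl

variable (A)

/-- The bilinear map `g ⊗ w ↦ Δ(g) w` to `adjointTensor`. -/
noncomputable def comulMul : (regular A).V →ₗ[k] (coregularTensor A).V →ₗ[k] (adjointTensor A).V :=
  LinearMap.mul k (H ⊗[k] H) ∘ₗ A.comul.toLinearMap

lemma comulMul_apply (g : H) (w : H ⊗[k] H) :
    comulMul A (toRegular A g) (toCoregularTensor A w) = toAdjointTensor A (A.comul g * w) := rfl

/-- The bilinear map `t ⊗ w ↦ Δ(t) w` on a trivial module. -/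
noncomputable def comulMulTrivial :
    (trivial A).V →ₗ[k] (coregularTensor A).V →ₗ[k] (coregularTensor A).V :=
  LinearMap.mul k (H ⊗[k] H) ∘ₗ A.comul.toLinearMap

lemma comulMulTrivial_apply (t : H) (w : H ⊗[k] H) :
    comulMulTrivial A (toTrivial A t) (toCoregularTensor A w) =
      toCoregularTensor A (A.comul t * w) := rfl

/-- The morphism `g ⊗ w ↦ Δ(g) w` to `adjointTensor`. -/
noncomputable def μ₃ : regular A ⊗ coregularTensor A ⟶ adjointTensor A :=
  mkHom₂ (comulMul A) fun h g w => by
    obtain ⟨g, rfl⟩ := toRegular_surjective g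
    obtain ⟨w, rfl⟩ := toCoregularTensor_surjective w
    simp only [comulMul_apply, ρ_regular, ρ_coregularTensor, ρ_adjointTensor, map_sweedler₂,
      map_mul, mul_assoc]

/-- The morphism `t ⊗ w ↦ Δ(t) w` on a trivial module. -/
noncomputable def b₃ : trivial A ⊗ coregularTensor A ⟶ coregularTensor A :=
  mkHom₂ (comulMulTrivial A) fun h t w => by
    obtain ⟨t, rfl⟩ := toTrivial_surjective t
    obtain ⟨w, rfl⟩ := toCoregularTensor_surjective w
    simp only [ρ_trivial, ρ_coregularTensor, map_smul, LinearMap.smul_apply,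
      comulMulTrivial_apply, ← mul_assoc]
    exact sweedler_counit_left (A := A) h
      (toCoregularTensor A ∘ₗ LinearMap.mulLeft k (A.comul t * w) ∘ₗ antipodeComulOp A)

variable {A}

lemma lin_μ₃ (g : H) (w : H ⊗[k] H) :
    lin (μ₃ A) (toRegular A g ⊠ toCoregularTensor A w) = toAdjointTensor A (A.comul g * w) := rfl

lemma lin_b₃ (t : H) (w : H ⊗[k] H) :
    lin (b₃ A) (toTrivial A t ⊠ toCoregularTensor A w) = toCoregularTensor A (A.comul t * w) := rfl

variable (A) in
/-- A linear section of `μ₃`. -/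
noncomputable def sectionμ₃ : LinearSection (μ₃ A) where
  s := TensorProduct.mk k H (H ⊗[k] H) 1
  lin_s n := by
    obtain ⟨n, rfl⟩ := toAdjointTensor_surjective n
    change lin (μ₃ A) (toRegular A 1 ⊠ toCoregularTensor A n) = _
    rw [lin_μ₃, map_one, one_mul]

variable (A) in
/-- The action of `adjointTensor` on the coregular module. -/
noncomputable def ν₃ : coregular A ⊗ adjointTensor A ⟶ coregularTensor A :=
  ((sectionμ₃ A).whiskerLeft (coregular A)).desc
    ((α_ (coregular A) (regular A) (coregularTensor A)).inv ≫ e A ▷ coregularTensor A ≫ b₃ A)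
    (TensorProduct.ext_threefold' fun x g w => by
      obtain ⟨x, rfl⟩ := toCoregular_surjective x
      obtain ⟨g, rfl⟩ := toRegular_surjective g
      obtain ⟨w, rfl⟩ := toCoregularTensor_surjective w
      change lin ((α_ (coregular A) (regular A) (coregularTensor A)).inv ≫
        e A ▷ coregularTensor A ≫ b₃ A)
          (toCoregular A x ⊠ (toRegular A 1 ⊠ toCoregularTensor A (A.comul g * w))) =
        lin ((α_ (coregular A) (regular A) (coregularTensor A)).inv ≫
        e A ▷ coregularTensor A ≫ b₃ A)
          (toCoregular A x ⊠ (toRegular A g ⊠ toCoregularTensor A w))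
      simp only [lin_comp, lin_associator_inv, sweedler₃, lin_sweedler₂, lin_whiskerRight,
        ρ_regular, ρ_coregular, ρ_coregularTensor, lin_e, lin_b₃, mul_assoc, mul_one, map_mul])

lemma ν₃_eq : coregular A ◁ μ₃ A ≫ ν₃ A =
    (α_ (coregular A) (regular A) (coregularTensor A)).inv ≫ e A ▷ coregularTensor A ≫ b₃ A :=
  LinearSection.comp_desc _ _ _

lemma lin_ν₃ (x : H) (w : H ⊗[k] H) :
    lin (ν₃ A) (toCoregular A x ⊠ toAdjointTensor A w) =
      toCoregularTensor A (sweedler₃ A.Φinv fun x₁ x₂ x₃ =>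
        A.comul (x * A.S x₁ * A.α * x₂) * w * antipodeComulOp A x₃) := by
  have : lin ((α_ (coregular A) (regular A) (coregularTensor A)).inv ≫
      e A ▷ coregularTensor A ≫ b₃ A)
        (toCoregular A x ⊠ (toRegular A 1 ⊠ toCoregularTensor A w)) =
      toCoregularTensor A (sweedler₃ A.Φinv fun x₁ x₂ x₃ =>
        A.comul (x * A.S x₁ * A.α * x₂) * w * antipodeComulOp A x₃) := by
    simp only [lin_comp, lin_associator_inv, sweedler₃, map_sweedler₂, lin_whiskerRight,
      ρ_regular, ρ_coregular, ρ_coregularTensor, lin_e, lin_b₃, mul_assoc, mul_one]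
  exact this

lemma lin_mul₂ (x : H) (w : H ⊗[k] H) :
    lin (mul₂ A) (toTransmuted A x ⊠ toAdjointTensor A w) =
      toAdjointTensor A (sweedler₃ A.Φinv fun x₁ x₂ x₃ =>
        A.comul (θ A (A.adjoint x₁ x) * x₂) * w * antipodeComulOp A x₃) := by
  have : lin ((α_ A.transmuted (regular A ⊗ regular A) (coregular A ⊗ coregular A)).inv ≫
      ev A (regular A ⊗ regular A) ▷ (coregular A ⊗ coregular A) ≫ μ₂ A)
        (toTransmuted A x ⊠ (toRegular₂ A w ⊠ toCoregular₂ A 1)) =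
      toAdjointTensor A (sweedler₃ A.Φinv fun x₁ x₂ x₃ =>
        A.comul (θ A (A.adjoint x₁ x) * x₂) * w * antipodeComulOp A x₃) := by
    simp only [lin_comp, lin_associator_inv, sweedler₃, map_sweedler₂, lin_whiskerRight,
      ρ_regular₂, ρ_coregular₂, ρ_transmuted, lin_ev, lin_μ₂, mul_assoc, one_mul, map_mul]
  exact this

lemma a_μ₃ : a A ▷ coregularTensor A ≫ μ₃ A =
    (α_ (regular A) (trivial A) (coregularTensor A)).hom ≫ regular A ◁ b₃ A ≫ μ₃ A := by
  refine hom_ext₃ fun x t w => ?_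
  obtain ⟨x, rfl⟩ := toRegular_surjective x
  obtain ⟨t, rfl⟩ := toTrivial_surjective t
  obtain ⟨w, rfl⟩ := toCoregularTensor_surjective w
  simp only [lin_comp, lin_associator_trivial_middle, lin_whiskerLeft, lin_whiskerRight, lin_a,
    lin_b₃, lin_μ₃, map_mul, mul_assoc]

lemma mul₂_eq_ev : A.transmuted ◁ μ₃ A ≫ mul₂ A =
    (α_ A.transmuted (regular A) (coregularTensor A)).inv ≫
      ev A (regular A) ▷ coregularTensor A ≫ μ₃ A := by
  refine hom_ext₃' fun x g w => ?_
  obtain ⟨x, rfl⟩ := toTransmuted_surjective x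
  obtain ⟨g, rfl⟩ := toRegular_surjective g
  obtain ⟨w, rfl⟩ := toCoregularTensor_surjective w
  simp only [lin_comp, lin_whiskerLeft, lin_μ₃, lin_mul₂, lin_associator_inv, sweedler₃,
    map_sweedler₂, lin_whiskerRight, ρ_regular, ρ_coregularTensor, ρ_transmuted, lin_ev_regular,
    map_mul, mul_assoc]

instance (X : A.Rep) : Epi (X ◁ μ₃ A) := ((sectionμ₃ A).whiskerLeft X).epi

/-- `E` is also a quotient of `G ⊗ (H ⊗ H)` by `g ⊗ w ↦ Δ(g) w`. For this presentation the action of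
`g k` on `w` is `g` times the pairing of `k` with `w`, which leads directly to `g`. -/
lemma μ_mul₂ : μ A ▷ adjointTensor A ≫ mul₂ A =
    (α_ (regular A) (coregular A) (adjointTensor A)).hom ≫ regular A ◁ ν₃ A ≫ μ₃ A :=
  BraidedHopf.whiskerRight_comp_act μ_ev a_μ₃ mul₂_eq_ev ν₃_eq

lemma lin_ζ (y : H) : lin (ζ A) (toTransmuted A y) =
    lin (χ A) (toRegular A y ⊠ (toTransmuted A A.β ⊠ toCoregular A 1)) := by
  rw [← lin_one]
  rfl

/-- Links the abstract construction to the given data: the invariant element of `E`, written out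
through `χ`, is the `ξ` obtained from `B`. -/
lemma lin_one_ζ : lin (one A ≫ ζ A) (unitOne A) = toAdjointTensor A A.ξ := by
  rw [lin_comp, lin_one, lin_ζ, lin_χ, ξ_eq]
  simp only [mul_one]

/-- On the invariant element, the multiplication reduces to that by `g`. -/
lemma lin_mul₂_ξ (h : H) :
    lin (mul₂ A) (toTransmuted A h ⊠ toAdjointTensor A A.ξ) =
      toAdjointTensor A (A.comul h * A.g) := by
  have := congrArg (fun f => lin f ((toRegular A h ⊠ toCoregular A 1) ⊠
    lin (one A ≫ ζ A) (unitOne A))) (μ_mul₂ (A := A))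
  -- As `ξ` is the image of the tensor unit, the associator is trivial on it; what remains is `Δ(h)`
  -- times the pairing of `1` with `ξ`, which is `g` by definition.
  rw [lin_comp (μ A ▷ adjointTensor A), lin_comp (α_ _ _ _).hom, lin_associator_unit_right,
    lin_one_ζ, lin_comp] at this
  simp only [lin_whiskerLeft, lin_whiskerRight, lin_μ, mul_one, lin_ν₃, lin_μ₃, one_mul] at this
  exact this

lemma sweedler₂_mul_eq {M : Type*} [AddCommGroup M] [Module k M] (w z : H ⊗[k] H)
    (L : H ⊗[k] H →ₗ[k] M) :
    L (w * z) = sweedler₂ w fun w₁ w₂ => sweedler₂ z fun z₁ z₂ => L ((w₁ * z₁) ⊗ₜ (w₂ * z₂)) := by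
  refine (sweedler₂_tmul w (L ∘ₗ LinearMap.mulRight k z)).symm.trans ?_
  refine congrArg (sweedler₂ w) (funext fun w₁ => funext fun w₂ => ?_)
  refine (sweedler₂_tmul z (L ∘ₗ LinearMap.mulLeft k (w₁ ⊗ₜ[k] w₂))).symm.trans ?_
  simp only [LinearMap.comp_apply, LinearMap.mulLeft_apply,
    Algebra.TensorProduct.tmul_mul_tmul]

/-- Lift `u ⊗ v` along `μ₂` to `(u ⊗ v) ⊗ (1 ⊗ 1)` and follow the nested product: `Φ` rebrackets the
four factors, the first `Φ⁻¹` (`y`) the inner three, `R` braids the inner product past `K`, and the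
second `Φ⁻¹` (`x`) rebrackets at the end. -/
lemma lin_π (u v : H) : lin (π A) (toAdjointTensor A (u ⊗ₜ v)) =
    sweedler₃ A.Φinv fun x₁ x₂ x₃ =>
    sweedler₃ A.Φinv fun y₁ y₂ y₃ =>
    sweedler₃ (A.Φ : H ⊗[k] (H ⊗[k] H)) fun X₁ X₂ X₃ =>
    sweedler₂ (A.comul X₃) fun X₃' X₃'' =>
    sweedler₂ (A.R : H ⊗[k] H) fun R₁ R₂ =>
      toTransmuted A (x₁ * X₁ * u * A.S (x₂ * R₂ * y₃ * X₃'')) ⊠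
        toTransmuted A (A.adjoint (x₃ * R₁) (y₁ * X₂ * v * A.S (y₂ * X₃'))) := by
  have h : lin (π A) (toAdjointTensor A (u ⊗ₜ v)) = lin (BraidedHopf.nestedMul (μ A))
      ((toRegular A u ⊠ toRegular A v) ⊠ (toCoregular A 1 ⊠ toCoregular A 1)) := rfl
  rw [h, sweedler_reorder A.Φinv A.Φinv (A.Φ : H ⊗[k] (H ⊗[k] H)) A.comul A.R]
  simp only [BraidedHopf.nestedMul, lin_comp, lin_associator_inv, lin_associator, lin_braiding,
      sweedler₃, ρ_tmul, tmul_sweedler₂,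
      map_sweedler₂, lin_whiskerRight, lin_whiskerLeft,
      ρ_regular, ρ_coregular, ρ_transmuted, lin_μ, mul_assoc, one_mul, A.S_mul, map_mul,
      Module.End.mul_apply]

/-- `Δ(h) = π (h · ξ)` and `h · ξ = Δ(h) g` in `H ⊗ H`, so the formula is that of `π` on the tensor
`h₁ g₁ ⊗ h₂ g₂`. -/
lemma lin_comul (h : H) :
    lin (transmutationData A).comul (toTransmuted A h) = A.transComul h := by
  have h1 : lin (transmutationData A).comul (toTransmuted A h) =
      lin (π A) (lin (mul₂ A) (toTransmuted A h ⊠ lin (one A ≫ ζ A) (unitOne A))) := rfl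
  rw [h1, lin_one_ζ, lin_mul₂_ξ]
  refine (sweedler₂_mul_eq (A.comul h) A.g (lin (π A) ∘ₗ toAdjointTensor A)).trans ?_
  simp only [LinearMap.comp_apply, lin_π, transComul]
  simp only [← sweedler₃_sweedler₂_comm A.Φinv A.g, ← sweedler₃_sweedler₂_comm A.Φinv (A.comul h),
    ← sweedler₃_sweedler₂_comm (A.Φ : H ⊗[k] (H ⊗[k] H)) A.g,
    ← sweedler₃_sweedler₂_comm (A.Φ : H ⊗[k] (H ⊗[k] H)) (A.comul h)]
  refine congrArg (sweedler₃ A.Φinv) (funext fun x₁ => funext fun x₂ => funext fun x₃ => ?_)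
  refine congrArg (sweedler₃ A.Φinv) (funext fun y₁ => funext fun y₂ => funext fun y₃ => ?_)
  refine congrArg (sweedler₃ _) (funext fun X₁ => funext fun X₂ => funext fun X₃ => ?_)
  -- The sums over `Δ(h)` and `g` are outermost after expanding the product and have to be moved
  -- inside those over `Δ(X₃)` and `R`.
  simp only [sweedler₂_comm A.g (A.comul X₃)]
  rw [sweedler₂_comm (A.comul h) (A.comul X₃)]
  simp only [sweedler₂_comm A.g (A.R : H ⊗[k] H)]
  simp only [sweedler₂_comm (A.comul h) (A.R : H ⊗[k] H), ← mul_assoc]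
  rfl

end Rep

lemma Rep.isTransmutedHopf {k H : Type u} [Field k] [Ring H] [Algebra k H]
    (A : QuasitriangularQuasiHopfAlgebra k H) :
    A.IsTransmutedHopf (Rep.transmutationData A).hopfObj where
  mul := Rep.lin_mul
  one := Rep.lin_one A
  comul := Rep.lin_comul
  counit := Rep.lin_counit
  antipode := Rep.lin_antipode

end QuasitriangularQuasiHopfAlgebra

theorem mainTheorem8 {k H : Type u} [Field k] [Ring H] [Algebra k H]
    (A : QuasitriangularQuasiHopfAlgebra k H) :
    ∃ hopf : HopfObj A.transmuted, A.IsTransmutedHopf hopf ∧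
      ∀ (δ : A.transmuted ⟶ 𝟙_ A.Rep) (σ : 𝟙_ A.Rep ⟶ A.transmuted),
        BraidedHopf.IsModularPairInInvolution δ σ →
        ∃ hpara : (BraidedHopf.hopfCyclicData δ σ).IsParaCocyclic,
        ∃ hcyc : ((BraidedHopf.hopfCyclicData δ σ).kerRestrict hpara).IsCocyclic,
        ∃ HC : ℕ → A.Rep, ∀ n, HC n =
          ((BraidedHopf.hopfCyclicData δ σ).kerRestrict hpara).cyclicCohomology hcyc n := by
  refine ⟨(QuasitriangularQuasiHopfAlgebra.Rep.transmutationData A).hopfObj,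
    QuasitriangularQuasiHopfAlgebra.Rep.isTransmutedHopf A, fun δ σ h => ?_⟩
  -- The modular pair and the Connes–Moscovici operators refer to this Hopf structure.
  let _ : HopfObj A.transmuted :=
    (QuasitriangularQuasiHopfAlgebra.Rep.transmutationData A).hopfObj
  exact ⟨h.isParaCocyclic,
    CocyclicData.IsParaCocyclic.kerRestrict_isCocyclic _, _, fun _ => rfl⟩
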